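/- Consider the cubic nonlinear Schrödinger equation on the line, $$ i u_t + u_{xx} = |u|^2 u, \qquad u(0,x) = u_0(x), \qquad u : [-1,1]\times\mathbb{R} \to \mathbb{C}. \tag{NLS}$$ For $k \ge 0$ and $1 \le p \le \infty$ put $\|\langle\partial_x\rangle^{k} f\|_{L^p} = \sum_{j=0}^{k} \|\partial_x^j f\|_{L^p(\mathbb{R})}$, with weak derivatives (the norm is $\infty$ if one of them does not exist). Let $e^{it\partial_{xx}}$ be the free Schrödinger group, acting on tempered distributions. A solution of (NLS) on $[-1,1]$ is a function $u$ with $$u(t) = e^{it\partial_{xx}}u_0 - i\int_0^t e^{i(t-\tau)\partial_{xx}}\big(|u|^2u\big)(\tau)\,d\tau \qquad \text{for all } t\in[-1,1],$$ as an identity of tempered distributions on $\mathbb{R}$. The Picard iterates of $u_0$ are $u^0(t) = e^{it\partial_{xx}}u_0$ and, for $j \ge 1$, $$u^j(t) = -i\int_0^t e^{i(t-\tau)\partial_{xx}}\Big(\Big|\sum_{k=0}^{j-1}u^k\Big|^2\sum_{k=0}^{j-1}u^k\Big)(\tau)\,d\tau - \sum_{k=1}^{j-1}u^k(t).$$ Finally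 let $S^0 = L_t^\infty L_x^2([-1,1]\times\mathbb{R}) \cap L_t^4L_x^\infty([-1,1]\times\mathbb{R})$ be the Strichartz space. **Theorem.** For each integer $n \ge 1$ there is $\epsilon(n) > 0$ such that, if $$\|\langle\partial_x\rangle^{2n+1}u_0\|_{L^{4n+2}(\mathbb{R})} \le \epsilon(n),$$ then (NLS) has a solution $u \in L^{4n+2}_{t,x}([-1,1]\times\mathbb{R})$ on $[-1,1]$, and this solution has the form $u = u^0 + u^1 + \dots + u^{n-1} + v$, where the $u^j$ are the Picard iterates of $u_0$ and $v \in S^0$. Moreover, for $n = 1$ two derivatives suffice: there is $\epsilon > 0$ such that, if $\|\langle\partial_x\rangle^{2}u_0\|_{L^6(\mathbb{R})} \le \epsilon$, then (NLS) has a solution $u \in L^6_{t,x}([-1,1]\times\mathbb{R})$ on $[-1,1]$ of the form $u = e^{it\partial_{xx}}u_0 + v$ with $v \in S^0$. -/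

import Mathlib

open MeasureTheory Set
open scoped ENNReal SchwartzMap ContDiff

noncomputable section

namespace CubicNLS

/-! ### Sobolev norms built from weak derivatives -/

/-- `g` is the weak derivative of order `j` of `f` on the real line. -/
def IsWeakDeriv (j : ℕ) (f g : ℝ → ℂ) : Prop :=
  LocallyIntegrable f ∧ LocallyIntegrable g ∧
    ∀ φ : ℝ → ℝ, ContDiff ℝ ∞ φ → HasCompactSupport φ →
      ∫ x, ((iteratedDeriv j φ x : ℝ) : ℂ) * f x = (-1) ^ j * ∫ x, (φ x : ℂ) * g x

/-- The norm `∑_{j ≤ k} ‖∂ₓʲ f‖_{Lᵖ(ℝ)}` with weak derivatives `∂ₓʲ f`. Weak derivatives are unique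
almost everywhere, so the infimum is over families that all give the same value; it is `∞` when one
of the weak derivatives does not exist. -/
def sobolevNorm (k : ℕ) (p : ℝ≥0∞) (f : ℝ → ℂ) : ℝ≥0∞ :=
  ⨅ (g : ℕ → ℝ → ℂ) (_ : ∀ j ≤ k, IsWeakDeriv j f (g j)),
    ∑ j ∈ Finset.range (k + 1), eLpNorm (g j) p volume

/-! ### The Schrödinger propagator -/

/-- The Fourier symbol of `e^{it∂ₓₓ}`; Mathlib's Fourier transform has the kernel `e^{-2πixξ}`, so
`∂ₓₓ` has the symbol `-(2πξ)²`. -/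
def schrodingerSymbol (t ξ : ℝ) : ℂ :=
  Complex.exp (-(Complex.I * t * (2 * Real.pi * ξ) ^ 2))

/-- The symbol has temperate growth, so that the Fourier multiplier below is the genuine one. -/
theorem schrodingerSymbol_hasTemperateGrowth (t : ℝ) :
    (schrodingerSymbol t).HasTemperateGrowth := by
  have h1 : (fun y : ℝ => Complex.exp (Complex.I * y)).HasTemperateGrowth := by
    have hd : ∀ n : ℕ, iteratedDeriv n (fun y : ℝ => Complex.exp (Complex.I * y)) =
        fun y : ℝ => Complex.I ^ n * Complex.exp (Complex.I * y) := by
      intro n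
      induction n with
      | zero => simp
      | succ n ih =>
        rw [iteratedDeriv_succ, ih]
        funext y
        have h := (((Complex.ofRealCLM.hasDerivAt (x := y)).const_mul Complex.I).cexp).const_mul
          (Complex.I ^ n)
        have h' := h.deriv
        simp only [Complex.ofRealCLM_apply, Complex.ofReal_one, mul_one] at h'
        rw [h', pow_succ]
        ring
    refine ⟨(contDiff_const.mul Complex.ofRealCLM.contDiff).cexp, fun n => ⟨0, 1, fun y => ?_⟩⟩
    rw [norm_iteratedFDeriv_eq_norm_iteratedDeriv, hd]
    simp [mul_comm Complex.I, Complex.norm_exp_ofReal_mul_I]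
  have h2 : (fun ξ : ℝ => -(t * (2 * Real.pi * ξ) ^ 2)).HasTemperateGrowth := by fun_prop
  have h3 := h1.comp h2
  convert h3 using 1
  funext ξ
  simp only [schrodingerSymbol, Function.comp_apply]
  push_cast
  ring_nf

/-- The Schrödinger group `e^{it∂ₓₓ}` on Schwartz functions. -/
def propagator (t : ℝ) : 𝓢(ℝ, ℂ) →L[ℂ] 𝓢(ℝ, ℂ) :=
  SchwartzMap.fourierMultiplierCLM ℂ (schrodingerSymbol t)

/-! ### The Duhamel formula and the equation -/

/-- For every `t ∈ [-1, 1]`,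
`w(t) = e^{it∂ₓₓ} f - i ∫₀ᵗ e^{i(t-τ)∂ₓₓ} F(τ) dτ`
as an identity of tempered distributions on `ℝ`. The group acts on tempered distributions by
duality, `⟨e^{it∂ₓₓ} T, φ⟩ = ⟨T, e^{it∂ₓₓ} φ⟩` with the bilinear pairing `⟨g, φ⟩ = ∫ g φ`, and the
time integral is taken after pairing with `φ`. All integrals are required to converge absolutely. -/
def IsDuhamel (f : ℝ → ℂ) (F w : ℝ → ℝ → ℂ) : Prop :=
  ∀ t ∈ Icc (-1 : ℝ) 1, ∀ φ : 𝓢(ℝ, ℂ),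
    Integrable (fun x => w t x * φ x) ∧
    Integrable (fun x => f x * propagator t φ x) ∧
    Integrable (fun z : ℝ × ℝ => F z.1 z.2 * propagator (t - z.1) φ z.2)
      ((volume.restrict (uIoc 0 t)).prod volume) ∧
    ∫ x, w t x * φ x =
      (∫ x, f x * propagator t φ x) -
        Complex.I * ∫ τ in (0 : ℝ)..t, ∫ x, F τ x * propagator (t - τ) φ x

/-- The cubic nonlinearity `|z|² z`. -/
def cubic (z : ℂ) : ℂ := (‖z‖ : ℂ) ^ 2 * z

/-- `u` solves `i uₜ + uₓₓ = |u|² u`, `u(0) = u₀`, on `[-1, 1] × ℝ` (integral equation). -/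
def IsSolution (u₀ : ℝ → ℂ) (u : ℝ → ℝ → ℂ) : Prop :=
  IsDuhamel u₀ (fun τ x => cubic (u τ x)) u

/-- `U 0, …, U (n - 1)` are the Picard iterates of the datum `u₀` on `[-1, 1] × ℝ`:
`U 0 = e^{it∂ₓₓ} u₀`, and for `1 ≤ j ≤ n - 1`, with `P = ∑_{k < j} U k`,
`U j = -i ∫₀ᵗ e^{i(t-τ)∂ₓₓ} (|P|² P)(τ) dτ - ∑_{1 ≤ k < j} U k`. -/
def IsPicardSequence (n : ℕ) (u₀ : ℝ → ℂ) (U : ℕ → ℝ → ℝ → ℂ) : Prop :=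
  IsDuhamel u₀ 0 (U 0) ∧
    ∀ j, 1 ≤ j → j < n →
      IsDuhamel 0 (fun τ x => cubic (∑ k ∈ Finset.range j, U k τ x))
        (fun t x => U j t x + ∑ k ∈ Finset.Ico 1 j, U k t x)

/-! ### Space-time norms on `[-1, 1] × ℝ` -/

/-- Lebesgue measure on `[-1, 1] × ℝ`. -/
def slabMeasure : Measure (ℝ × ℝ) := (volume.restrict (Icc (-1 : ℝ) 1)).prod volume

/-- The mixed norm of `L_t^p L_x^q([-1, 1] × ℝ)`. -/
def mixedNorm (p q : ℝ≥0∞) (v : ℝ → ℝ → ℂ) : ℝ≥0∞ :=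
  eLpNorm (fun t => eLpNorm (v t) q volume) p (volume.restrict (Icc (-1 : ℝ) 1))

/-- The Strichartz space `S⁰ = L_t^∞ L_x^2 ∩ L_t^4 L_x^∞` on `[-1, 1] × ℝ`. -/
def MemStrichartz (v : ℝ → ℝ → ℂ) : Prop :=
  AEStronglyMeasurable (Function.uncurry v) slabMeasure ∧
    mixedNorm ⊤ 2 v < ⊤ ∧ mixedNorm 4 ⊤ v < ⊤

/-- There is a solution `u ∈ L_{t,x}^{4n+2}([-1, 1] × ℝ)` with datum `u₀` of the form
`u = u⁰ + ⋯ + u^{n-1} + v`, where the `u^j` are the Picard iterates and `v ∈ S⁰`. -/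
def HasLocalSolution (n : ℕ) (u₀ : ℝ → ℂ) : Prop :=
  ∃ (u : ℝ → ℝ → ℂ) (U : ℕ → ℝ → ℝ → ℂ) (v : ℝ → ℝ → ℂ),
    IsSolution u₀ u ∧
    MemLp (Function.uncurry u) ((4 * n + 2 : ℕ) : ℝ≥0∞) slabMeasure ∧
    IsPicardSequence n u₀ U ∧
    MemStrichartz v ∧
    ∀ t x, u t x = (∑ j ∈ Finset.range n, U j t x) + v t x

end CubicNLS

end

open Filter Topology
open scoped FourierTransform

noncomputable section

namespace CubicNLS

/-! ### Minkowski's integral inequality -/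

/-! For bounded times, the Schrödinger group on `Lᵖ` costs at most two derivatives. Indeed `(1 -
∂ₓₓ)⁻¹ e^{it∂ₓₓ} = ∫₀^∞ e^{-s} e^{(s+it)∂ₓₓ} ds`, and the complex heat kernel at `z = s + it` has
`L¹` norm `(|z|/s)^{1/2} ≤ 1 + s^{-1/2}`, which is integrable against `e^{-s}`. The same kernel has
an `L¹` Hölder modulus of order `3/4`, whose weight is at worst `s^{-7/8}`, still integrable. So two
derivatives in `Lᵖ` become Hölder regularity of order `3/4` in `Lᵖ`, and `3/4 > 1/2 ≥ 1/p` makes the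
result continuous and bounded (`holderLp_smoothedEvolution`, `exists_evolution`). Any order strictly
between `1/2` and `1` would serve.

Put `N = 4n + 2` and let `P j` be the sum of the first `j` Picard iterates. Then `P (j+2) - P (j+1)`
is the Duhamel integral of `|P (j+1)|² P (j+1) - |P j|² P j`. Each term of this cubic difference has
a factor `P (j+1) - P j` and two factors in `L^N`, so Hölder's inequality takes `L^{N/(2j+1)}` to
`L^{N/(2j+3)}`, while each evolution spends two derivatives (`PicardPair.exists_next`,
`exists_picard`). Hence `2n` derivatives suffice to build `P n`, and the last forcing `D = |P n|² P
n - |P (n-1)|² P (n-1)` lies in `L^{N/(2n+1)} = L²`.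

The remainder solves `v(t) = -i ∫₀ᵗ e^{i(t-τ)∂ₓₓ} (D + |P n + v|² (P n + v) - |P n|² P n)(τ) dτ`. On
`L²` the group is unitary and commutes with translations, so it preserves the `L²` Hölder class with
no loss (`exists_evolution_holderLp`). That class embeds in `L^∞` and is stable under multiplication
by `P n` (`HolderLp.mul_multiplier`). For small data the iteration stays in a ball of this class and
contracts in the weaker `L²` norm; `exists_remainder` passes to the limit. No Strichartz estimate is
needed: `v` is bounded in time with values in `L² ∩ L^∞`, and the time interval is bounded. -/

theorem eLpNorm_lintegral_mul_le {Ω : Type*} [MeasurableSpace Ω] {μ : Measure Ω} [SFinite μ]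
    {a : Ω → ℂ} (ha : Measurable a) {M : ℝ≥0∞} (hM : ∫⁻ w, ‖a w‖ₑ ∂μ ≤ M) (hMt : M ≠ ⊤)
    {H : Ω → ℝ → ℂ} (hH : Measurable (Function.uncurry H)) {q : ℝ≥0∞} (hq : 1 ≤ q) (hqt : q ≠ ⊤)
    {A : ℝ≥0∞} (hA : ∀ᵐ w ∂μ, eLpNorm (H w) q volume ≤ A) :
    eLpNorm (fun x => ∫⁻ w, ‖a w‖ₑ * ‖H w x‖ₑ ∂μ) q volume ≤ M * A := by
  have hq0 : q ≠ 0 := (zero_lt_one.trans_le hq).ne'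
  set r := q.toReal with hr
  have hr1 : 1 ≤ r := by
    have := ENNReal.toReal_mono hqt hq
    simpa using this
  have hr0 : 0 < r := by linarith
  -- The weight `|a|` is absorbed into a finite measure of mass at most `M`. Jensen's inequality for
  -- the power `r` on this measure, followed by Tonelli, is the whole proof.
  set ν := μ.withDensity (fun w => ‖a w‖ₑ) with hν
  have hνu : ν univ ≤ M := by
    rw [hν, withDensity_apply _ MeasurableSet.univ, setLIntegral_univ]; exact hM
  have hHx : ∀ x, Measurable (fun w => ‖H w x‖ₑ) := fun x =>
    (hH.comp (measurable_id.prodMk measurable_const)).enorm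
  have h1 : ∀ x, (∫⁻ w, ‖a w‖ₑ * ‖H w x‖ₑ ∂μ) ^ r ≤
      (∫⁻ w, ‖a w‖ₑ * ‖H w x‖ₑ ^ r ∂μ) * M ^ (r - 1) := by
    intro x
    have e1 : ∫⁻ w, ‖a w‖ₑ * ‖H w x‖ₑ ∂μ = ∫⁻ w, ‖H w x‖ₑ ∂ν := by
      rw [hν, lintegral_withDensity_eq_lintegral_mul _ ha.enorm (hHx x)]; rfl
    have e2 : ∫⁻ w, ‖a w‖ₑ * ‖H w x‖ₑ ^ r ∂μ = ∫⁻ w, ‖H w x‖ₑ ^ r ∂ν := by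
      rw [hν, lintegral_withDensity_eq_lintegral_mul _ ha.enorm ((hHx x).pow_const r)]; rfl
    rw [e1, e2]
    have h := eLpNorm_le_eLpNorm_mul_rpow_measure_univ (μ := ν) hq
      (f := fun w => H w x)
      (hH.comp (measurable_id.prodMk measurable_const)).aestronglyMeasurable
    rw [eLpNorm_one_eq_lintegral_enorm, eLpNorm_eq_lintegral_rpow_enorm_toReal hq0 hqt] at h
    calc (∫⁻ w, ‖H w x‖ₑ ∂ν) ^ r
        ≤ ((∫⁻ w, ‖H w x‖ₑ ^ r ∂ν) ^ (1 / r) * ν univ ^ (1 - 1 / r)) ^ r := by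
          gcongr
          simpa using h
      _ = (∫⁻ w, ‖H w x‖ₑ ^ r ∂ν) * ν univ ^ (r - 1) := by
          rw [ENNReal.mul_rpow_of_nonneg _ _ hr0.le, ← ENNReal.rpow_mul, ← ENNReal.rpow_mul]
          congr 2
          · rw [one_div_mul_cancel hr0.ne', ENNReal.rpow_one]
          · field_simp
      _ ≤ _ := by gcongr
  rw [eLpNorm_eq_lintegral_rpow_enorm_toReal hq0 hqt]
  have h2 : ∫⁻ x, ‖∫⁻ w, ‖a w‖ₑ * ‖H w x‖ₑ ∂μ‖ₑ ^ r ≤ (M * A) ^ r := by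
    calc ∫⁻ x, ‖∫⁻ w, ‖a w‖ₑ * ‖H w x‖ₑ ∂μ‖ₑ ^ r
        ≤ ∫⁻ x, (∫⁻ w, ‖a w‖ₑ * ‖H w x‖ₑ ^ r ∂μ) * M ^ (r - 1) := by
          refine lintegral_mono fun x => ?_
          simpa using h1 x
      _ = (∫⁻ x, (∫⁻ w, ‖a w‖ₑ * ‖H w x‖ₑ ^ r ∂μ)) * M ^ (r - 1) := by
          refine lintegral_mul_const' _ _ ?_
          exact ENNReal.rpow_ne_top_of_nonneg (by linarith) hMt
      _ = (∫⁻ w, ‖a w‖ₑ * (∫⁻ x, ‖H w x‖ₑ ^ r) ∂μ) * M ^ (r - 1) := by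
          congr 1
          rw [lintegral_lintegral_swap]
          · refine lintegral_congr fun w => ?_
            rw [lintegral_const_mul' _ _ enorm_ne_top]
          · refine Measurable.aemeasurable ?_
            have : Measurable fun z : ℝ × Ω => H z.2 z.1 := hH.comp measurable_swap
            exact (ha.comp measurable_snd).enorm.mul (this.enorm.pow_const r)
      _ ≤ (∫⁻ w, ‖a w‖ₑ * A ^ r ∂μ) * M ^ (r - 1) := by
          gcongr ?_ * _
          refine lintegral_mono_ae ?_
          filter_upwards [hA] with w hw
          gcongr
          rw [eLpNorm_eq_lintegral_rpow_enorm_toReal hq0 hqt] at hw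
          calc ∫⁻ x, ‖H w x‖ₑ ^ r = ((∫⁻ x, ‖H w x‖ₑ ^ r) ^ (1 / r)) ^ r := by
                rw [← ENNReal.rpow_mul, one_div_mul_cancel hr0.ne', ENNReal.rpow_one]
            _ ≤ A ^ r := by gcongr
      _ = (∫⁻ w, ‖a w‖ₑ ∂μ) * A ^ r * M ^ (r - 1) := by
          rw [lintegral_mul_const _ ha.enorm]
      _ ≤ M * A ^ r * M ^ (r - 1) := by gcongr
      _ = (M * A) ^ r := by
          rw [ENNReal.mul_rpow_of_nonneg _ _ hr0.le]
          have : M ^ r = M * M ^ (r - 1) := by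
            conv_lhs => rw [show r = 1 + (r - 1) by ring]
            rw [ENNReal.rpow_add_of_nonneg _ _ zero_le_one (by linarith), ENNReal.rpow_one]
          rw [this]; ring
  calc (∫⁻ x, ‖∫⁻ w, ‖a w‖ₑ * ‖H w x‖ₑ ∂μ‖ₑ ^ r) ^ (1 / r) ≤ ((M * A) ^ r) ^ (1 / r) := by gcongr
    _ = M * A := by rw [← ENNReal.rpow_mul, mul_one_div_cancel hr0.ne', ENNReal.rpow_one]

theorem eLpNorm_integral_mul_le {Ω : Type*} [MeasurableSpace Ω] {μ : Measure Ω} [SFinite μ]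
    {a : Ω → ℂ} (ha : Measurable a) {M : ℝ≥0∞} (hM : ∫⁻ w, ‖a w‖ₑ ∂μ ≤ M) (hMt : M ≠ ⊤)
    {H : Ω → ℝ → ℂ} (hH : Measurable (Function.uncurry H)) {q : ℝ≥0∞} (hq : 1 ≤ q) (hqt : q ≠ ⊤)
    {A : ℝ≥0∞} (hA : ∀ᵐ w ∂μ, eLpNorm (H w) q volume ≤ A) :
    eLpNorm (fun x => ∫ w, a w * H w x ∂μ) q volume ≤ M * A := by
  refine le_trans (eLpNorm_mono_enorm fun x => ?_)
    (eLpNorm_lintegral_mul_le ha hM hMt hH hq hqt hA)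
  refine (enorm_integral_le_lintegral_enorm _).trans ?_
  simp [enorm_mul]

/-- A function of finite `L^q` norm is finite almost everywhere. This permits subtracting two kernel
integrals under one integral sign in the Hölder estimate. -/
theorem ae_integrable_mul_of_eLpNorm_le {Ω : Type*} [MeasurableSpace Ω] {μ : Measure Ω} [SFinite μ]
    {a : Ω → ℂ} (ha : Measurable a) {M : ℝ≥0∞} (hM : ∫⁻ w, ‖a w‖ₑ ∂μ ≤ M) (hMt : M ≠ ⊤)
    {H : Ω → ℝ → ℂ} (hH : Measurable (Function.uncurry H)) {q : ℝ≥0∞} (hq : 1 ≤ q) (hqt : q ≠ ⊤)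
    {A : ℝ≥0∞} (hAt : A ≠ ⊤) (hA : ∀ᵐ w ∂μ, eLpNorm (H w) q volume ≤ A) :
    ∀ᵐ x, Integrable (fun w => a w * H w x) μ := by
  have h := eLpNorm_lintegral_mul_le ha hM hMt hH hq hqt hA
  have hq0 : q ≠ 0 := (zero_lt_one.trans_le hq).ne'
  have hr0 : 0 < q.toReal := ENNReal.toReal_pos hq0 hqt
  have hlt := lt_of_le_of_lt h (ENNReal.mul_lt_top hMt.lt_top hAt.lt_top)
  rw [eLpNorm_eq_lintegral_rpow_enorm_toReal hq0 hqt] at hlt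
  have hlt' := (ENNReal.rpow_lt_top_iff_of_pos (by positivity)).1 hlt
  have hmeas : Measurable fun x => ∫⁻ w, ‖a w‖ₑ * ‖H w x‖ₑ ∂μ := by
    refine Measurable.lintegral_prod_right' (f := fun z : ℝ × Ω => ‖a z.2‖ₑ * ‖H z.2 z.1‖ₑ) ?_
    have : Measurable fun z : ℝ × Ω => H z.2 z.1 := hH.comp measurable_swap
    exact (ha.comp measurable_snd).enorm.mul this.enorm
  have hae := ae_lt_top (hmeas.enorm.pow_const _) hlt'.ne
  filter_upwards [hae] with x hx
  refine ⟨(ha.mul (hH.comp (measurable_id.prodMk measurable_const))).aestronglyMeasurable, ?_⟩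
  have hx' := (ENNReal.rpow_lt_top_iff_of_pos hr0).1 hx
  simpa [HasFiniteIntegral, enorm_mul] using hx'

/-! ### Hölder classes in `Lᵖ` and their continuous representatives -/

/-- `f` has `Lᵖ` norm and `Lᵖ` Hölder seminorm of order `3/4` at most `A`. -/
structure HolderLp (p : ℝ≥0∞) (A : ℝ) (f : ℝ → ℂ) : Prop where
  aesm : AEStronglyMeasurable f volume
  norm : eLpNorm f p volume ≤ ENNReal.ofReal A
  diff : ∀ y : ℝ, eLpNorm (fun x => f (x + y) - f x) p volume ≤
    ENNReal.ofReal (A * |y| ^ (3 / 4 : ℝ))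

/-- The average of `f` over `[x, x + r]`. -/
def avg (f : ℝ → ℂ) (r x : ℝ) : ℂ := (r : ℂ)⁻¹ * ∫ y in x..x + r, f y

/-- The limit of the dyadic averages. -/
def rep (f : ℝ → ℂ) (x : ℝ) : ℂ := limUnder atTop (fun k : ℕ => avg f ((1 / 2) ^ k) x)

/-- The geometric ratio `2^{-1/4}`. -/
def ratio : ℝ := (1 / 2 : ℝ) ^ (1 / 4 : ℝ)

theorem ratio_pos : 0 < ratio := by unfold ratio; positivity

theorem ratio_lt_one : ratio < 1 :=
  Real.rpow_lt_one (by norm_num) (by norm_num) (by norm_num)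

/-- Hölder on an interval of length `r` gives `r^{-1/p}`. Since `p ≥ 2` and `r ≤ 1` this is at most
`r^{-1/2}`, one exponent for all `p` in use. -/
theorem norm_avg_le {p : ℝ≥0∞} (hp : 2 ≤ p) (hpt : p ≠ ⊤) {f : ℝ → ℂ}
    (hf : AEStronglyMeasurable f volume) {A : ℝ} (hA0 : 0 ≤ A)
    (hA : eLpNorm f p volume ≤ ENNReal.ofReal A) {r : ℝ} (hr : 0 < r) (hr1 : r ≤ 1) (x : ℝ) :
    ‖avg f r x‖ ≤ r ^ (-(1 / 2) : ℝ) * A := by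
  have hp1 : 1 ≤ p := le_trans (by norm_num) hp
  have hpr : 2 ≤ p.toReal := by simpa using ENNReal.toReal_mono hpt hp
  have h1 : ‖∫ y in x..x + r, f y‖ₑ ≤ ENNReal.ofReal (A * r ^ (1 - 1 / p.toReal)) := by
    rw [intervalIntegral.integral_of_le (by linarith)]
    refine (enorm_integral_le_lintegral_enorm _).trans ?_
    rw [← eLpNorm_one_eq_lintegral_enorm]
    refine (eLpNorm_le_eLpNorm_mul_rpow_measure_univ hp1 hf.restrict).trans ?_
    rw [ENNReal.ofReal_mul hA0]
    gcongr
    · exact (eLpNorm_restrict_le _ _ _ _).trans hA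
    · rw [Measure.restrict_apply_univ, Real.volume_Ioc, add_sub_cancel_left,
        ENNReal.ofReal_rpow_of_pos hr]
      simp
  have h2 : ‖∫ y in x..x + r, f y‖ ≤ A * r ^ (1 - 1 / p.toReal) := by
    rw [← ofReal_norm] at h1
    exact (ENNReal.ofReal_le_ofReal_iff (by positivity)).1 h1
  have h3 : r ^ (1 - 1 / p.toReal) ≤ r ^ (1 / 2 : ℝ) := by
    apply Real.rpow_le_rpow_of_exponent_ge hr hr1
    have : 1 / p.toReal ≤ 1 / 2 := by gcongr
    linarith
  calc ‖avg f r x‖ = r⁻¹ * ‖∫ y in x..x + r, f y‖ := by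
        simp [avg, abs_of_pos hr]
    _ ≤ r⁻¹ * (A * r ^ (1 / 2 : ℝ)) := by gcongr; exact h2.trans (by gcongr)
    _ = r ^ (-(1 / 2) : ℝ) * A := by
        rw [← Real.rpow_neg_one r, mul_comm A, ← mul_assoc, ← Real.rpow_add hr]; norm_num

theorem locallyIntegrable_of_eLpNorm_le {p : ℝ≥0∞} (hp : 1 ≤ p) {f : ℝ → ℂ}
    (hf : AEStronglyMeasurable f volume) {A : ℝ}
    (hA : eLpNorm f p volume ≤ ENNReal.ofReal A) : LocallyIntegrable f :=
  MemLp.locallyIntegrable ⟨hf, hA.trans_lt ENNReal.ofReal_lt_top⟩ hp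

theorem _root_.MeasureTheory.LocallyIntegrable.intervalIntegrable' {f : ℝ → ℂ}
    (hf : LocallyIntegrable f) (a b : ℝ) : IntervalIntegrable f volume a b :=
  intervalIntegrable_iff.mpr
    ((hf.integrableOn_isCompact isCompact_uIcc).mono_set uIoc_subset_uIcc)

/-- The average over an interval is the mean of the averages over its two halves, and the right half
is the left one translated by `r`. This converts the Hölder seminorm into control of consecutive
dyadic averages. -/
theorem avg_sub_avg {f : ℝ → ℂ} (hf : LocallyIntegrable f) {r : ℝ} (hr : r ≠ 0) (x : ℝ) :
    avg f (2 * r) x - avg f r x = (1 / 2) * avg (fun y => f (y + r) - f y) r x := by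
  have hi := hf.intervalIntegrable'
  have h1 : ∫ y in x..x + r, (f (y + r) - f y) =
      (∫ y in x + r..x + 2 * r, f y) - ∫ y in x..x + r, f y := by
    rw [intervalIntegral.integral_sub _ (hi _ _), intervalIntegral.integral_comp_add_right f r]
    · congr 2; ring
    · have := (hi (x + r) (x + r + r)).comp_add_right r
      simpa using this
  have h2 : ∫ y in x..x + 2 * r, f y =
      (∫ y in x..x + r, f y) + ∫ y in x + r..x + 2 * r, f y :=
    (intervalIntegral.integral_add_adjacent_intervals (hi _ _) (hi _ _)).symm
  have hr' : (r : ℂ) ≠ 0 := by exact_mod_cast hr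
  simp only [avg, h1, h2]
  push_cast
  field_simp
  ring

theorem half_pow_rpow (k : ℕ) (a : ℝ) : ((1 / 2 : ℝ) ^ k) ^ a = ((1 / 2 : ℝ) ^ a) ^ k := by
  rw [← Real.rpow_natCast, ← Real.rpow_mul (by norm_num), mul_comm, Real.rpow_mul (by norm_num),
    Real.rpow_natCast]

namespace HolderLp

variable {p : ℝ≥0∞} {A : ℝ} {f : ℝ → ℂ}

theorem locallyIntegrable (h : HolderLp p A f) (hp : 2 ≤ p) : LocallyIntegrable f :=
  locallyIntegrable_of_eLpNorm_le (le_trans (by norm_num) hp) h.aesm h.norm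

/-- The average of the increment loses `r^{-1/2}` and the increment gains `r^{3/4}`; the net gain
`r^{1/4}` is summable over dyadic `r`. -/
theorem dist_avg_le (h : HolderLp p A f) (hA : 0 ≤ A) (hp : 2 ≤ p) (hpt : p ≠ ⊤) (x : ℝ) (k : ℕ) :
    dist (avg f ((1 / 2) ^ k) x) (avg f ((1 / 2) ^ (k + 1)) x) ≤ A * ratio ^ k := by
  set r : ℝ := (1 / 2) ^ (k + 1) with hr
  have hr0 : 0 < r := by positivity
  have hr1 : r ≤ 1 := pow_le_one₀ (by norm_num) (by norm_num)
  have e : ((1 / 2 : ℝ) ^ k) = 2 * r := by rw [hr, pow_succ]; ring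
  rw [dist_eq_norm, e, avg_sub_avg (h.locallyIntegrable hp) hr0.ne']
  have hm : AEStronglyMeasurable (fun y => f (y + r) - f y) volume :=
    (h.aesm.comp_measurePreserving (measurePreserving_add_right volume r)).sub h.aesm
  have h1 := norm_avg_le hp hpt hm (by positivity) (h.diff r) hr0 hr1 x
  have h2 : r ^ (-(1 / 2) : ℝ) * (A * |r| ^ (3 / 4 : ℝ)) = A * ratio ^ (k + 1) := by
    rw [abs_of_pos hr0, mul_left_comm, ← Real.rpow_add hr0, hr, half_pow_rpow, ratio]
    norm_num
  have h3 : ratio ^ (k + 1) ≤ ratio ^ k :=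
    pow_le_pow_of_le_one ratio_pos.le ratio_lt_one.le (by omega)
  have h4 : 0 ≤ A * ratio ^ (k + 1) := mul_nonneg hA (pow_nonneg ratio_pos.le _)
  rw [norm_mul]
  calc ‖(1 / 2 : ℂ)‖ * ‖avg (fun y => f (y + r) - f y) r x‖ ≤ 1 * (A * ratio ^ (k + 1)) := by
        rw [← h2]
        gcongr
        norm_num
    _ ≤ _ := by rw [one_mul]; gcongr

theorem tendsto_avg (h : HolderLp p A f) (hA : 0 ≤ A) (hp : 2 ≤ p) (hpt : p ≠ ⊤) (x : ℝ) :
    Tendsto (fun k : ℕ => avg f ((1 / 2) ^ k) x) atTop (𝓝 (rep f x)) :=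
  (cauchySeq_of_le_geometric ratio A ratio_lt_one (h.dist_avg_le hA hp hpt x)).tendsto_limUnder

theorem dist_avg_rep_le (h : HolderLp p A f) (hA : 0 ≤ A) (hp : 2 ≤ p) (hpt : p ≠ ⊤) (x : ℝ)
    (k : ℕ) : dist (avg f ((1 / 2) ^ k) x) (rep f x) ≤ A * ratio ^ k / (1 - ratio) :=
  dist_le_of_le_geometric_of_tendsto ratio A ratio_lt_one (h.dist_avg_le hA hp hpt x)
    (h.tendsto_avg hA hp hpt x) k

/-- The geometric rate does not depend on `x`, so the continuous averages converge uniformly. -/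
theorem continuous_rep (h : HolderLp p A f) (hA : 0 ≤ A) (hp : 2 ≤ p) (hpt : p ≠ ⊤) :
    Continuous (rep f) := by
  have hi := (h.locallyIntegrable hp).intervalIntegrable'
  have hc : ∀ k : ℕ, Continuous (fun x => avg f ((1 / 2) ^ k) x) := by
    intro k
    have hp := intervalIntegral.continuous_primitive hi 0
    have : (fun x => avg f ((1 / 2) ^ k) x) = fun x => ((((1 / 2 : ℝ) ^ k : ℝ)) : ℂ)⁻¹ *
        ((∫ y in (0 : ℝ)..x + (1 / 2) ^ k, f y) - ∫ y in (0 : ℝ)..x, f y) := by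
      funext x
      rw [avg, intervalIntegral.integral_interval_sub_left (hi _ _) (hi _ _)]
    rw [this]
    exact continuous_const.mul ((hp.comp (continuous_id.add continuous_const)).sub hp)
  have hu : TendstoUniformly (fun (k : ℕ) x => avg f ((1 / 2) ^ k) x) (rep f) atTop := by
    rw [Metric.tendstoUniformly_iff]
    intro ε hε
    have hlim : Tendsto (fun k : ℕ => A * ratio ^ k / (1 - ratio)) atTop (𝓝 0) := by
      have := ((tendsto_pow_atTop_nhds_zero_of_lt_one ratio_pos.le ratio_lt_one).const_mul
        A).div_const (1 - ratio)
      simpa using this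
    filter_upwards [hlim.eventually (gt_mem_nhds hε)] with k hk x
    rw [dist_comm]
    exact (h.dist_avg_rep_le hA hp hpt x k).trans_lt hk
  exact hu.continuous (Eventually.of_forall hc).frequently

theorem rep_ae_eq (h : HolderLp p A f) (hA : 0 ≤ A) (hp : 2 ≤ p) (hpt : p ≠ ⊤) :
    rep f =ᵐ[volume] f := by
  have hl := h.locallyIntegrable hp
  filter_upwards [LocallyIntegrable.ae_hasDerivAt_integral hl] with x hx
  refine tendsto_nhds_unique (h.tendsto_avg hA hp hpt x) ?_
  have h1 := (hx x).tendsto_slope_zero_right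
  have h2 : Tendsto (fun k : ℕ => (1 / 2 : ℝ) ^ k) atTop (𝓝[>] 0) :=
    tendsto_nhdsWithin_iff.2 ⟨tendsto_pow_atTop_nhds_zero_of_lt_one (by norm_num) (by norm_num),
      Eventually.of_forall fun k => by simp⟩
  refine (h1.comp h2).congr fun k => ?_
  simp [avg, intervalIntegral.integral_same]

/-- The norm bound `B` is kept apart from the Hölder size `A`, and the averaging scale `2^{-k}` is
free. Scale `k = 0` gives the embedding into bounded functions; a scale tuned to a small `B` gives
the interpolation behind the uniform convergence of the iteration. -/
theorem norm_rep_le (h : HolderLp p A f) (hA : 0 ≤ A) (hp : 2 ≤ p) (hpt : p ≠ ⊤) {B : ℝ}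
    (hB : 0 ≤ B) (hf : eLpNorm f p volume ≤ ENNReal.ofReal B) (x : ℝ) (k : ℕ) :
    ‖rep f x‖ ≤ (2 ^ (1 / 2 : ℝ)) ^ k * B + A * ratio ^ k / (1 - ratio) := by
  have h1 := h.dist_avg_rep_le hA hp hpt x k
  have h2 := norm_avg_le hp hpt h.aesm hB hf (r := (1 / 2) ^ k) (by positivity)
    (pow_le_one₀ (by norm_num) (by norm_num)) x
  have h3 : ((1 / 2 : ℝ) ^ k) ^ (-(1 / 2) : ℝ) = (2 ^ (1 / 2 : ℝ)) ^ k := by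
    rw [half_pow_rpow, one_div, Real.inv_rpow (by norm_num), Real.rpow_neg (by norm_num), inv_inv]
  rw [h3] at h2
  rw [dist_eq_norm] at h1
  calc ‖rep f x‖ = ‖avg f ((1 / 2) ^ k) x - (avg f ((1 / 2) ^ k) x - rep f x)‖ := by simp
    _ ≤ _ := (norm_sub_le _ _).trans (add_le_add h2 h1)

theorem rep_eq_self (h : HolderLp p A f) (hA : 0 ≤ A) (hp : 2 ≤ p) (hpt : p ≠ ⊤)
    (hc : Continuous f) : rep f = f :=
  (Continuous.ae_eq_iff_eq volume (h.continuous_rep hA hp hpt) hc).1 (h.rep_ae_eq hA hp hpt)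

theorem congr_ae {g : ℝ → ℂ} (h : HolderLp p A f) (hg : g =ᵐ[volume] f) : HolderLp p A g where
  aesm := h.aesm.congr hg.symm
  norm := by rw [eLpNorm_congr_ae hg]; exact h.norm
  diff y := by
    have h1 : (fun x => g (x + y)) =ᵐ[volume] fun x => f (x + y) :=
      (measurePreserving_add_right volume y).quasiMeasurePreserving.ae_eq_comp hg
    exact (eLpNorm_congr_ae (h1.sub hg)).trans_le (h.diff y)

theorem mono {B : ℝ} (h : HolderLp p A f) (hAB : A ≤ B) : HolderLp p B f where
  aesm := h.aesm
  norm := h.norm.trans (ENNReal.ofReal_le_ofReal hAB)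
  diff y := (h.diff y).trans (ENNReal.ofReal_le_ofReal (by gcongr))

end HolderLp

/-- The constant of the embedding of the Hölder class into bounded functions. -/
def embConst : ℝ := 1 + 1 / (1 - ratio)

theorem one_le_embConst : 1 ≤ embConst := by
  have : 0 < 1 - ratio := by linarith [ratio_lt_one]
  unfold embConst
  have : 0 ≤ 1 / (1 - ratio) := by positivity
  linarith

theorem HolderLp.norm_rep_le_embConst {p : ℝ≥0∞} {A : ℝ} {f : ℝ → ℂ} (h : HolderLp p A f)
    (hA : 0 ≤ A) (hp : 2 ≤ p) (hpt : p ≠ ⊤) (x : ℝ) : ‖rep f x‖ ≤ embConst * A := by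
  have := h.norm_rep_le hA hp hpt hA h.norm x 0
  simp only [pow_zero, one_mul, mul_one] at this
  rw [embConst, add_mul, one_mul, one_div_mul_eq_div]
  exact this

/-- The representative is continuous in space and measurable in time, hence jointly measurable. Only
interval integrals are assumed measurable in time, because the `L²` evolution is constructed weakly,
separately at each time. -/
theorem measurable_uncurry_rep {p : ℝ≥0∞} {A : ℝ} {f : ℝ → ℝ → ℂ} (hA : 0 ≤ A) (hp : 2 ≤ p)
    (hpt : p ≠ ⊤) (h : ∀ t, HolderLp p A (f t))
    (hm : ∀ x r : ℝ, Measurable fun t => ∫ y in x..x + r, f t y) :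
    Measurable (Function.uncurry fun t x => rep (f t) x) := by
  have hc : ∀ t, Continuous (rep (f t)) := fun t => (h t).continuous_rep hA hp hpt
  have ht : ∀ t x, Tendsto (fun k : ℕ => avg (f t) ((1 / 2) ^ k) x) atTop (𝓝 (rep (f t) x)) :=
    fun t => (h t).tendsto_avg hA hp hpt
  have hma : ∀ (k : ℕ) (x : ℝ), Measurable (fun t => avg (f t) ((1 / 2) ^ k) x) := by
    intro k x
    simp only [avg]
    exact (hm x _).const_mul _
  generalize hR : (fun t => rep (f t)) = R
  have hR' : ∀ t, rep (f t) = R t := fun t => congrFun hR t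
  simp only [hR'] at hc ht ⊢
  have h1 : Measurable (Function.uncurry fun x t => R t x) :=
    measurable_uncurry_of_continuous_of_measurable hc fun x =>
      measurable_of_tendsto_metrizable (hma · x) (tendsto_pi_nhds.2 fun t => ht t x)
  exact h1.comp measurable_swap

theorem measurable_integral_Ioc_of_measurable {f : ℝ → ℝ → ℂ}
    (hf : Measurable (Function.uncurry f)) (x r : ℝ) :
    Measurable fun t => ∫ y in x..x + r, f t y := by
  simp only [intervalIntegral]
  have h : ∀ μ : Measure ℝ, SFinite μ → Measurable fun t => ∫ y, f t y ∂μ := fun μ _ =>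
    (StronglyMeasurable.integral_prod_right (f := f) (ν := μ) hf.stronglyMeasurable).measurable
  exact (h (volume.restrict (Ioc x (x + r))) inferInstance).sub
    (h (volume.restrict (Ioc (x + r) x)) inferInstance)

/-! ### Weak derivatives of continuous functions -/

/-- The du Bois-Reymond lemma: `f` minus a primitive of `g` has zero weak derivative, so its
mollifications are constant, and so is their pointwise limit. -/
theorem hasDerivAt_of_forall_integral_eq {f g : ℝ → ℂ} (hf : Continuous f) (hg : Continuous g)
    (h : ∀ φ : ℝ → ℝ, ContDiff ℝ ∞ φ → HasCompactSupport φ →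
      ∫ x, ((deriv φ x : ℝ) : ℂ) * f x = -∫ x, (φ x : ℂ) * g x) (x : ℝ) :
    HasDerivAt f (g x) x := by
  set G : ℝ → ℂ := fun x => f x - ∫ y in (0 : ℝ)..x, g y with hG
  have hprim : ∀ x, HasDerivAt (fun x => ∫ y in (0 : ℝ)..x, g y) (g x) x := fun x =>
    intervalIntegral.integral_hasDerivAt_right (hg.intervalIntegrable _ _)
      hg.aestronglyMeasurable.stronglyMeasurableAtFilter hg.continuousAt
  have hpc : Continuous (fun x => ∫ y in (0 : ℝ)..x, g y) :=
    continuous_iff_continuousAt.2 fun x => (hprim x).continuousAt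
  have hGc : Continuous G := hf.sub hpc
  have hG0 : ∀ φ : ℝ → ℝ, ContDiff ℝ ∞ φ → HasCompactSupport φ →
      ∫ x, deriv φ x • G x = 0 := by
    intro φ hφ hs
    have hs' : HasCompactSupport (deriv φ) := hs.deriv
    have hφ' : Continuous (deriv φ) := hφ.continuous_deriv (by simp)
    have ic : ∀ (ψ : ℝ → ℝ) (u : ℝ → ℂ), Continuous ψ → HasCompactSupport ψ → Continuous u →
        Integrable fun x => (ψ x : ℂ) * u x := by
      intro ψ u hψ hsψ hu
      refine ((Complex.continuous_ofReal.comp hψ).mul hu).integrable_of_hasCompactSupport ?_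
      exact (hsψ.comp_left (g := fun y : ℝ => (y : ℂ)) (by simp)).mul_right
    have h1 := h φ hφ hs
    have h2 : ∫ x, ((deriv φ x : ℝ) : ℂ) * (∫ y in (0 : ℝ)..x, g y) = -∫ x, (φ x : ℂ) * g x := by
      have := integral_mul_deriv_eq_deriv_mul_of_integrable (u := fun x => ∫ y in (0 : ℝ)..x, g y)
        (v := fun x => (φ x : ℂ)) (u' := g) (v' := fun x => ((deriv φ x : ℝ) : ℂ))
        (fun x _ => hprim x)
        (fun x _ => (hφ.differentiable (by simp) x).hasDerivAt.ofReal_comp) ?_ ?_ ?_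
      · simp only [mul_comm] at this ⊢
        exact this
      · exact (ic _ _ hφ' hs' hpc).congr (ae_of_all _ fun x => mul_comm _ _)
      · exact (ic _ _ hφ.continuous hs hg).congr (ae_of_all _ fun x => mul_comm _ _)
      · exact (ic _ _ hφ.continuous hs hpc).congr (ae_of_all _ fun x => mul_comm _ _)
    simp only [hG, Complex.real_smul, mul_sub]
    rw [integral_sub (ic _ _ hφ' hs' hf) (ic _ _ hφ' hs' hpc), h1, h2, sub_self]
  have hconst : ∀ (ψ : ContDiffBump (0 : ℝ)) (a b : ℝ),
      (convolution (ψ.normed volume) G (ContinuousLinearMap.lsmul ℝ ℝ) volume) a =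
      (convolution (ψ.normed volume) G (ContinuousLinearMap.lsmul ℝ ℝ) volume) b := by
    intro ψ a b
    have hd : ∀ x, HasDerivAt
        (convolution (ψ.normed volume) G (ContinuousLinearMap.lsmul ℝ ℝ) volume) 0 x := by
      intro x
      have h1 := HasCompactSupport.hasDerivAt_convolution_left (𝕜 := ℝ) (μ := volume)
        (ContinuousLinearMap.lsmul ℝ ℝ : ℝ →L[ℝ] ℂ →L[ℝ] ℂ) (f₀ := ψ.normed volume) (g₀ := G)
        ψ.hasCompactSupport_normed (ψ.contDiff_normed (n := 1)) hGc.locallyIntegrable x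
      suffices hz : convolution (deriv (ψ.normed volume)) G (ContinuousLinearMap.lsmul ℝ ℝ)
          volume x = 0 by rwa [hz] at h1
      rw [convolution_eq_swap]
      simp only [ContinuousLinearMap.lsmul_apply]
      have h2 := hG0 (fun y => -ψ.normed volume (x - y))
        ((ψ.contDiff_normed.comp (contDiff_const.sub contDiff_id)).neg)
        ((ψ.hasCompactSupport_normed.comp_homeomorph (Homeomorph.subLeft x)).neg)
      rw [← h2]
      congr 1
      funext y
      congr 1
      have h3 : HasDerivAt (fun y => -ψ.normed volume (x - y))
          (deriv (ψ.normed volume) (x - y)) y := by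
        have h4 : HasDerivAt (ψ.normed volume) (deriv (ψ.normed volume) (x - y)) (x - y) :=
          (ψ.contDiff_normed (n := 1)).differentiable (by simp) _ |>.hasDerivAt
        have h5 := (h4.scomp y ((hasDerivAt_id y).const_sub x)).neg
        exact h5.congr_deriv (by simp)
      exact h3.deriv.symm
    exact is_const_of_deriv_eq_zero (fun x => (hd x).differentiableAt) (fun x => (hd x).deriv) a b
  have hGconst : ∀ a b, G a = G b := by
    intro a b
    let ψ : ℕ → ContDiffBump (0 : ℝ) := fun k =>
      ⟨1 / (k + 1), 2 / (k + 1), by positivity, by gcongr; norm_num⟩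
    have hψ : Tendsto (fun k => (ψ k).rOut) atTop (𝓝 0) := by
      have := (tendsto_one_div_add_atTop_nhds_zero_nat (𝕜 := ℝ)).const_mul 2
      simpa [ψ, div_eq_mul_inv] using this
    have t := fun c : ℝ => ContDiffBump.convolution_tendsto_right_of_continuous (μ := volume)
      hψ hGc c
    refine tendsto_nhds_unique (t a) ((t b).congr fun k => ?_)
    exact hconst (ψ k) b a
  have hfe : f = fun x => G 0 + ∫ y in (0 : ℝ)..x, g y := by
    funext x
    rw [hGconst 0 x, hG]
    simp
  rw [hfe]
  exact (hprim x).const_add _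

/-! ### The propagator on Schwartz functions -/

theorem norm_schrodingerSymbol (t ξ : ℝ) : ‖schrodingerSymbol t ξ‖ = 1 := by
  have : -(Complex.I * t * (2 * Real.pi * ξ) ^ 2) =
      ((-(t * (2 * Real.pi * ξ) ^ 2) : ℝ) : ℂ) * Complex.I := by push_cast; ring
  rw [schrodingerSymbol, this, Complex.norm_exp_ofReal_mul_I]

theorem fourierMultiplier_apply_eq_integral {g : ℝ → ℂ} (hg : g.HasTemperateGrowth)
    (φ : 𝓢(ℝ, ℂ)) (x : ℝ) :
    SchwartzMap.fourierMultiplierCLM ℂ g φ x =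
      ∫ ξ : ℝ, Complex.exp (2 * Real.pi * x * ξ * Complex.I) * (g ξ * 𝓕 φ ξ) := by
  rw [SchwartzMap.fourierMultiplierCLM_apply, SchwartzMap.fourierInv_coe, Real.fourierInv_eq']
  refine integral_congr_ae (ae_of_all _ fun ξ => ?_)
  simp only [SchwartzMap.smulLeftCLM_apply_apply hg, smul_eq_mul]
  congr 2
  simp
  ring

theorem propagator_apply (t : ℝ) (φ : 𝓢(ℝ, ℂ)) (x : ℝ) :
    propagator t φ x =
      ∫ ξ : ℝ, Complex.exp (2 * Real.pi * x * ξ * Complex.I) * (schrodingerSymbol t ξ * 𝓕 φ ξ) :=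
  fourierMultiplier_apply_eq_integral (schrodingerSymbol_hasTemperateGrowth t) φ x

theorem norm_exp_two_pi_mul_I (x ξ : ℝ) : ‖Complex.exp (2 * Real.pi * x * ξ * Complex.I)‖ = 1 := by
  have : (2 * Real.pi * x * ξ * Complex.I : ℂ) = ((2 * Real.pi * x * ξ : ℝ) : ℂ) * Complex.I := by
    push_cast; ring
  rw [this, Complex.norm_exp_ofReal_mul_I]

/-- The Fourier inversion integrand is dominated by `|𝓕 φ|` for all times and positions. Joint
continuity supplies the measurability of the Duhamel integrands. -/
theorem continuous_propagator (φ : 𝓢(ℝ, ℂ)) :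
    Continuous fun z : ℝ × ℝ => propagator z.1 φ z.2 := by
  simp only [propagator_apply]
  refine continuous_of_dominated (bound := fun ξ => ‖𝓕 φ ξ‖) ?_ ?_ ?_ ?_
  · intro z
    refine Continuous.aestronglyMeasurable ?_
    have : Continuous (𝓕 φ : 𝓢(ℝ, ℂ)) := (𝓕 φ : 𝓢(ℝ, ℂ)).continuous
    unfold schrodingerSymbol
    fun_prop
  · intro z
    refine ae_of_all _ fun ξ => ?_
    rw [norm_mul, norm_mul, norm_exp_two_pi_mul_I, norm_schrodingerSymbol, one_mul, one_mul]
  · exact (𝓕 φ).integrable.norm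
  · refine ae_of_all _ fun ξ => ?_
    unfold schrodingerSymbol
    fun_prop

theorem eLpNorm_schwartz_eq_norm (φ : 𝓢(ℝ, ℂ)) : eLpNorm φ 2 volume = ‖φ.toLp 2‖ₑ := by
  rw [← ofReal_norm, SchwartzMap.norm_toLp, ENNReal.ofReal_toReal (φ.eLpNorm_lt_top 2 volume).ne]

theorem eLpNorm_fourier (φ : 𝓢(ℝ, ℂ)) : eLpNorm (𝓕 φ : 𝓢(ℝ, ℂ)) 2 volume = eLpNorm φ 2 volume := by
  rw [eLpNorm_schwartz_eq_norm, eLpNorm_schwartz_eq_norm, ← ofReal_norm, ← ofReal_norm,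
    SchwartzMap.norm_fourier_toL2_eq]

/-- The Schrödinger group is unitary. -/
theorem eLpNorm_propagator (t : ℝ) (φ : 𝓢(ℝ, ℂ)) :
    eLpNorm (propagator t φ) 2 volume = eLpNorm φ 2 volume := by
  rw [← eLpNorm_fourier, propagator, SchwartzMap.fourierMultiplierCLM_apply,
    FourierTransform.fourier_fourierInv_eq, ← eLpNorm_fourier φ]
  refine eLpNorm_congr_norm_ae (ae_of_all _ fun ξ => ?_)
  rw [SchwartzMap.smulLeftCLM_apply_apply (schrodingerSymbol_hasTemperateGrowth t), norm_smul,
    norm_schrodingerSymbol, one_mul]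

theorem derivCLM_eq_multiplier (φ : 𝓢(ℝ, ℂ)) :
    SchwartzMap.derivCLM ℂ ℂ φ = SchwartzMap.fourierMultiplierCLM ℂ
      (fun ξ : ℝ => 2 * Real.pi * Complex.I * ξ) φ := by
  have h := SchwartzMap.lineDeriv_eq_fourierMultiplierCLM (1 : ℝ) φ
  have h1 : SchwartzMap.derivCLM ℂ ℂ φ = LineDeriv.lineDerivOp (1 : ℝ) φ := by
    ext x
    rw [SchwartzMap.derivCLM_apply, SchwartzMap.lineDerivOp_apply_eq_fderiv]
    simp
  rw [h1, h, ← SchwartzMap.fourierMultiplierCLM_ofReal ℂ (by fun_prop)]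
  have h2 : (fun ξ : ℝ => 2 * Real.pi * Complex.I * (ξ : ℂ)) =
      (2 * Real.pi * Complex.I : ℂ) • (fun ξ : ℝ => ((inner ℝ ξ (1 : ℝ) : ℝ) : ℂ)) := by
    funext ξ
    simp
  rw [h2, SchwartzMap.fourierMultiplierCLM_smul (by fun_prop)]
  rfl

theorem hasTemperateGrowth_derivSymbol :
    (fun ξ : ℝ => 2 * Real.pi * Complex.I * (ξ : ℂ)).HasTemperateGrowth := by
  fun_prop

theorem derivCLM_propagator (t : ℝ) (φ : 𝓢(ℝ, ℂ)) :
    SchwartzMap.derivCLM ℂ ℂ (propagator t φ) = propagator t (SchwartzMap.derivCLM ℂ ℂ φ) := by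
  rw [derivCLM_eq_multiplier, derivCLM_eq_multiplier, propagator,
    SchwartzMap.fourierMultiplierCLM_fourierMultiplierCLM_apply hasTemperateGrowth_derivSymbol
      (schrodingerSymbol_hasTemperateGrowth t),
    SchwartzMap.fourierMultiplierCLM_fourierMultiplierCLM_apply
      (schrodingerSymbol_hasTemperateGrowth t) hasTemperateGrowth_derivSymbol, mul_comm]

/-- Translation is multiplication by a phase on the Fourier side, so it commutes with the group.
This transports the Hölder seminorm through the `L²` evolution. -/
theorem propagator_compSubConst (t y : ℝ) (φ : 𝓢(ℝ, ℂ)) (x : ℝ) :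
    propagator t (φ.compSubConstCLM ℂ y) x = propagator t φ (x - y) := by
  rw [propagator_apply, propagator_apply]
  refine integral_congr_ae (ae_of_all _ fun ξ => ?_)
  have h : 𝓕 (φ.compSubConstCLM ℂ y) ξ = Complex.exp (-(2 * Real.pi * y * ξ * Complex.I)) * 𝓕 φ ξ := by
    rw [SchwartzMap.fourier_coe, SchwartzMap.fourier_coe, Real.fourier_real_eq_integral_exp_smul,
      Real.fourier_real_eq_integral_exp_smul, ← integral_const_mul]
    rw [← integral_add_right_eq_self _ y]
    refine integral_congr_ae (ae_of_all _ fun v => ?_)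
    simp only [SchwartzMap.compSubConstCLM_apply, add_sub_cancel_right, smul_eq_mul]
    rw [← mul_assoc, ← Complex.exp_add]
    congr 2
    push_cast
    ring
  simp only [h]
  have e : Complex.exp (2 * Real.pi * ((x - y : ℝ) : ℂ) * ξ * Complex.I) =
      Complex.exp (2 * Real.pi * x * ξ * Complex.I) *
        Complex.exp (-(2 * Real.pi * y * ξ * Complex.I)) := by
    rw [← Complex.exp_add]
    congr 1
    push_cast
    ring
  rw [e]
  ring

/-! ### The resolvent -/

/-- The symbol of `(1 - ∂ₓₓ)⁻¹`. -/
def resolventSymbol (ξ : ℝ) : ℂ := ((1 + (2 * Real.pi * ξ) ^ 2 : ℝ) : ℂ)⁻¹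

theorem resolventSymbol_hasTemperateGrowth : resolventSymbol.HasTemperateGrowth := by
  have h1 := Function.hasTemperateGrowth_one_add_norm_sq_rpow ℝ (-1)
  have h2 : (fun ξ : ℝ => 2 * Real.pi * ξ).HasTemperateGrowth := by fun_prop
  have h3 := Function.HasTemperateGrowth.comp (g := Complex.ofReal) (by fun_prop) (h1.comp h2)
  convert h3 using 1
  funext ξ
  simp [resolventSymbol, Real.rpow_neg_one]

/-- The resolvent `(1 - ∂ₓₓ)⁻¹` on Schwartz functions. -/
def resolvent : 𝓢(ℝ, ℂ) →L[ℂ] 𝓢(ℝ, ℂ) := SchwartzMap.fourierMultiplierCLM ℂ resolventSymbol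

/-- The operator `1 - ∂ₓₓ` on Schwartz functions. -/
def helmholtz (φ : 𝓢(ℝ, ℂ)) : 𝓢(ℝ, ℂ) :=
  φ - SchwartzMap.derivCLM ℂ ℂ (SchwartzMap.derivCLM ℂ ℂ φ)

theorem helmholtz_eq_multiplier (φ : 𝓢(ℝ, ℂ)) :
    helmholtz φ = SchwartzMap.fourierMultiplierCLM ℂ
      (fun ξ : ℝ => 1 + (2 * Real.pi * (ξ : ℂ)) ^ 2) φ := by
  have h0 := hasTemperateGrowth_derivSymbol
  rw [helmholtz, derivCLM_eq_multiplier, derivCLM_eq_multiplier,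
    SchwartzMap.fourierMultiplierCLM_fourierMultiplierCLM_apply h0 h0]
  have h1 : φ = SchwartzMap.fourierMultiplierCLM ℂ (fun _ : ℝ => (1 : ℂ)) φ := by simp
  ext x
  rw [_root_.sub_apply]
  conv_lhs => rw [h1]
  rw [fourierMultiplier_apply_eq_integral (by fun_prop),
    fourierMultiplier_apply_eq_integral (h0.mul h0),
    fourierMultiplier_apply_eq_integral (by fun_prop), h1.symm, ← integral_sub]
  · refine integral_congr_ae (ae_of_all _ fun ξ => ?_)
    simp only [Pi.mul_apply]
    have : Complex.I ^ 2 = -1 := Complex.I_sq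
    linear_combination (-(Complex.exp (2 * Real.pi * x * ξ * Complex.I)) * (2 * Real.pi * ξ) ^ 2 *
      𝓕 φ ξ) * this
  all_goals
    refine (integrable_norm_iff ?_).1 ?_
  · have : Continuous (𝓕 φ : 𝓢(ℝ, ℂ)) := (𝓕 φ : 𝓢(ℝ, ℂ)).continuous
    exact Continuous.aestronglyMeasurable (by fun_prop)
  · simp only [norm_mul, norm_exp_two_pi_mul_I, one_mul]
    exact (𝓕 φ).integrable.norm
  · have : Continuous (𝓕 φ : 𝓢(ℝ, ℂ)) := (𝓕 φ : 𝓢(ℝ, ℂ)).continuous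
    refine Continuous.aestronglyMeasurable ?_
    simp only [Pi.mul_apply]
    fun_prop
  · have h2 := (SchwartzMap.smulLeftCLM ℂ ((fun ξ : ℝ => 2 * Real.pi * Complex.I * (ξ : ℂ)) *
      fun ξ : ℝ => 2 * Real.pi * Complex.I * (ξ : ℂ)) (𝓕 φ)).integrable (μ := volume)
    refine h2.norm.congr (ae_of_all _ fun ξ => ?_)
    simp only [SchwartzMap.smulLeftCLM_apply_apply (h0.mul h0)]
    simp [norm_exp_two_pi_mul_I]

theorem hasTemperateGrowth_helmholtzSymbol :
    (fun ξ : ℝ => 1 + (2 * Real.pi * (ξ : ℂ)) ^ 2).HasTemperateGrowth := by fun_prop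

theorem resolventSymbol_mul_helmholtzSymbol :
    resolventSymbol * (fun ξ : ℝ => 1 + (2 * Real.pi * (ξ : ℂ)) ^ 2) = fun _ => 1 := by
  funext ξ
  have : (1 + (2 * Real.pi * ξ) ^ 2 : ℝ) ≠ 0 := by positivity
  have h : ((1 + (2 * Real.pi * ξ) ^ 2 : ℝ) : ℂ) ≠ 0 := by exact_mod_cast this
  simp only [Pi.mul_apply, resolventSymbol]
  rw [show (1 + (2 * Real.pi * (ξ : ℂ)) ^ 2) = ((1 + (2 * Real.pi * ξ) ^ 2 : ℝ) : ℂ) by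
    push_cast; ring, inv_mul_cancel₀ h]

theorem helmholtz_resolvent (φ : 𝓢(ℝ, ℂ)) : helmholtz (resolvent φ) = φ := by
  rw [helmholtz_eq_multiplier, resolvent,
    SchwartzMap.fourierMultiplierCLM_fourierMultiplierCLM_apply
      hasTemperateGrowth_helmholtzSymbol resolventSymbol_hasTemperateGrowth, mul_comm,
    resolventSymbol_mul_helmholtzSymbol]
  simp

/-- Multipliers commute, so the two derivatives lost by the group can be placed on its argument,
leaving an operator with an integrable kernel. -/
theorem resolvent_propagator_helmholtz (t : ℝ) (φ : 𝓢(ℝ, ℂ)) :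
    resolvent (propagator t (helmholtz φ)) = propagator t φ := by
  have h := schrodingerSymbol_hasTemperateGrowth t
  have h1 := resolventSymbol_hasTemperateGrowth
  rw [helmholtz_eq_multiplier, resolvent, propagator,
    SchwartzMap.fourierMultiplierCLM_fourierMultiplierCLM_apply h
      hasTemperateGrowth_helmholtzSymbol,
    SchwartzMap.fourierMultiplierCLM_fourierMultiplierCLM_apply h1
      (h.mul hasTemperateGrowth_helmholtzSymbol), mul_left_comm,
    resolventSymbol_mul_helmholtzSymbol]
  congr 2
  funext ξ
  simp

/-! ### The complex heat kernel -/

/-- The kernel of `e^{z∂ₓₓ}` for `Re z > 0`. -/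
def heatKernel (z : ℂ) (y : ℝ) : ℂ :=
  1 / (4 * Real.pi * z) ^ (1 / 2 : ℂ) * Complex.exp (-(y : ℂ) ^ 2 / (4 * z))

/-- The multiplication formula `∫ 𝓕φ · g = ∫ φ · 𝓕g`, with `g` a Gaussian times a plane wave, whose
transform is a translated complex heat kernel. -/
theorem integral_exp_mul_fourier {z : ℂ} (hz : 0 < z.re) (φ : 𝓢(ℝ, ℂ)) (x : ℝ) :
    ∫ ξ : ℝ, Complex.exp (2 * Real.pi * x * ξ * Complex.I) *
      (Complex.exp (-z * (2 * Real.pi * ξ) ^ 2) * 𝓕 φ ξ) =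
      ∫ y, heatKernel z y * φ (x + y) := by
  have hz0 : z ≠ 0 := by rintro rfl; simp at hz
  have hpi : (Real.pi : ℂ) ≠ 0 := by exact_mod_cast Real.pi_ne_zero
  -- With this `b` the standard Gaussian `e^{-πbξ²}` is the symbol `e^{-z(2πξ)²}`.
  set b : ℂ := 4 * Real.pi * z with hb
  have hbre : 0 < b.re := by
    have : b.re = 4 * Real.pi * z.re := by
      rw [hb, show (4 * Real.pi : ℂ) = ((4 * Real.pi : ℝ) : ℂ) by push_cast; ring,
        Complex.re_ofReal_mul]
    rw [this]; positivity
  set g : ℝ → ℂ := fun ξ => Complex.exp (-Real.pi * b * ξ ^ 2 + 2 * Real.pi * (Complex.I * x) * ξ)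
    with hg
  have hgi : Integrable g := by
    have h1 : 0 < (Real.pi * b).re := by
      rw [Complex.re_ofReal_mul]; positivity
    refine (integrable_cexp_quadratic h1 (2 * Real.pi * (Complex.I * x)) 0).congr
      (ae_of_all _ fun ξ => ?_)
    simp only [hg]
    congr 1
    ring
  have hself := VectorFourier.integral_fourierIntegral_smul_eq_flip (L := innerₗ ℝ) (μ := volume)
    (ν := volume) Real.continuous_fourierChar continuous_inner (f := (φ : ℝ → ℂ)) (g := g)
    φ.integrable hgi
  have hflip : (innerₗ ℝ).flip = innerₗ ℝ := flip_innerₗ ℝ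
  rw [hflip] at hself
  have hG := fourier_gaussian_pi' hbre (Complex.I * x)
  calc ∫ ξ : ℝ, Complex.exp (2 * Real.pi * x * ξ * Complex.I) *
      (Complex.exp (-z * (2 * Real.pi * ξ) ^ 2) * 𝓕 φ ξ) = ∫ ξ, 𝓕 φ ξ • g ξ := by
        refine integral_congr_ae (ae_of_all _ fun ξ => ?_)
        simp only [hg, smul_eq_mul, hb]
        rw [← mul_assoc, ← Complex.exp_add, mul_comm]
        congr 2
        ring
    _ = ∫ w, φ w • 𝓕 g w := hself
    _ = ∫ w, heatKernel z (w - x) * φ w := by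
        refine integral_congr_ae (ae_of_all _ fun w => ?_)
        simp only [hg, hG, smul_eq_mul, heatKernel]
        rw [mul_comm, ← hb]
        congr 3
        rw [← mul_assoc, Complex.I_mul_I, hb]
        field_simp
        push_cast
        ring
    _ = _ := by
        rw [← integral_add_right_eq_self _ x]
        refine integral_congr_ae (ae_of_all _ fun y => ?_)
        simp [add_comm]

/-- The right half-plane avoids the branch cut of the square root. -/
theorem continuousOn_heatKernel :
    ContinuousOn (fun q : ℂ × ℝ => heatKernel q.1 q.2) {q | 0 < q.1.re} := by
  have hb : ∀ q : ℂ × ℝ, 0 < q.1.re → 0 < (4 * Real.pi * q.1 : ℂ).re := by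
    intro q hq
    rw [show (4 * Real.pi : ℂ) = ((4 * Real.pi : ℝ) : ℂ) by push_cast; ring,
      Complex.re_ofReal_mul]
    positivity
  have h0 : ∀ q : ℂ × ℝ, 0 < q.1.re → q.1 ≠ 0 := by
    intro q hq h; rw [h] at hq; simp at hq
  unfold heatKernel
  refine ContinuousOn.mul (ContinuousOn.div continuousOn_const ?_ ?_) ?_
  · refine ContinuousOn.cpow_const (by fun_prop) fun q hq => Or.inl (hb q hq)
  · intro q hq
    have : (4 * Real.pi * q.1 : ℂ) ≠ 0 := by
      intro h; have := hb q hq; rw [h] at this; simp at this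
    simp [Complex.cpow_eq_zero_iff, this]
  · refine ContinuousOn.cexp (ContinuousOn.div (by fun_prop) (by fun_prop) ?_)
    intro q hq
    simp [h0 q hq]

/-- Since `Re (1/z) = Re z / |z|²`, the modulus of the oscillating kernel is a real Gaussian and its
`L¹` norm is explicit. -/
theorem norm_heatKernel (z : ℂ) (y : ℝ) :
    ‖heatKernel z y‖ = (4 * Real.pi * ‖z‖) ^ (-(1 / 2) : ℝ) *
      Real.exp (-(z.re / (4 * ‖z‖ ^ 2)) * y ^ 2) := by
  rw [heatKernel, norm_mul, norm_div, norm_one, Complex.norm_exp]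
  congr 1
  · have h := Complex.norm_cpow_real (4 * Real.pi * z) (1 / 2)
    push_cast at h
    rw [h, Real.rpow_neg (by positivity), one_div]
    simp [abs_of_pos Real.pi_pos]
  · congr 1
    have : -(y : ℂ) ^ 2 / (4 * z) = ((-(y ^ 2) / 4 : ℝ) : ℂ) * z⁻¹ := by
      push_cast
      rw [div_mul_eq_mul_div, div_eq_mul_inv, mul_inv]
      ring
    rw [this, Complex.re_ofReal_mul, Complex.inv_re, Complex.normSq_eq_norm_sq]
    ring

theorem hasDerivAt_heatKernel (z : ℂ) (y : ℝ) :
    HasDerivAt (heatKernel z) (-(2 * y) / (4 * z) * heatKernel z y) y := by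
  have h1 : HasDerivAt (fun y : ℝ => -(y : ℂ) ^ 2 / (4 * z)) (-(2 * y) / (4 * z)) y := by
    have := (((hasDerivAt_id y).ofReal_comp.pow 2).neg).div_const (4 * z)
    exact this.congr_deriv (by simp)
  have h2 := (h1.cexp).const_mul (1 / (4 * Real.pi * z) ^ (1 / 2 : ℂ))
  exact h2.congr_deriv (by rw [heatKernel]; ring)

/-! ### Bounds for the complex heat kernel -/

theorem lintegral_ofReal_exp_neg_mul_sq {a : ℝ} (ha : 0 < a) :
    ∫⁻ y : ℝ, ENNReal.ofReal (Real.exp (-a * y ^ 2)) = ENNReal.ofReal (√(Real.pi / a)) := by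
  rw [← ofReal_integral_eq_lintegral_ofReal (integrable_exp_neg_mul_sq ha)
    (ae_of_all _ fun y => (Real.exp_pos _).le), integral_gaussian]

/-- The mass `(|z| / Re z)^{1/2}` of the complex heat kernel. -/
def heatMass (z : ℂ) : ℝ := √(‖z‖ / z.re)

theorem rpow_neg_half_mul_sqrt {z : ℂ} (hz : 0 < z.re) :
    (4 * Real.pi * ‖z‖) ^ (-(1 / 2) : ℝ) * √(Real.pi / (z.re / (4 * ‖z‖ ^ 2))) = heatMass z := by
  have hz0 : 0 < ‖z‖ := norm_pos_iff.2 (by rintro rfl; simp at hz)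
  have hpi := Real.pi_pos
  rw [Real.rpow_neg (by positivity), ← Real.sqrt_eq_rpow, ← Real.sqrt_inv,
    ← Real.sqrt_mul (by positivity), heatMass]
  congr 1
  field_simp

theorem lintegral_enorm_heatKernel {z : ℂ} (hz : 0 < z.re) :
    ∫⁻ y : ℝ, ‖heatKernel z y‖ₑ = ENNReal.ofReal (heatMass z) := by
  have hz0 : 0 < ‖z‖ := norm_pos_iff.2 (by rintro rfl; simp at hz)
  have ha : 0 < z.re / (4 * ‖z‖ ^ 2) := by positivity
  simp_rw [← ofReal_norm, norm_heatKernel]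
  simp_rw [ENNReal.ofReal_mul (show 0 ≤ (4 * Real.pi * ‖z‖) ^ (-(1 / 2) : ℝ) by positivity)]
  rw [lintegral_const_mul' _ _ ENNReal.ofReal_ne_top, lintegral_ofReal_exp_neg_mul_sq ha,
    ← ENNReal.ofReal_mul (by positivity), rpow_neg_half_mul_sqrt hz]

/-- Half of the Gaussian decay absorbs the linear factor, because `x ≤ 1 + x²/2 ≤ e^{x²/2}` for `x =
√a |y|`. -/
theorem mul_exp_neg_sq_le {a : ℝ} (ha : 0 < a) (y : ℝ) :
    |y| * Real.exp (-a * y ^ 2) ≤ (√a)⁻¹ * Real.exp (-(a / 2) * y ^ 2) := by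
  have hs : 0 < √a := Real.sqrt_pos.2 ha
  have h1 : √a * |y| ≤ Real.exp (a / 2 * y ^ 2) := by
    have h2 := Real.add_one_le_exp (a / 2 * y ^ 2)
    have h3 : (√a * |y|) ^ 2 = a * y ^ 2 := by rw [mul_pow, Real.sq_sqrt ha.le, sq_abs]
    nlinarith [sq_nonneg (√a * |y| - 1)]
  have h4 : Real.exp (-(a / 2) * y ^ 2) = Real.exp (-a * y ^ 2) * Real.exp (a / 2 * y ^ 2) := by
    rw [← Real.exp_add]; congr 1; ring
  rw [h4, inv_mul_eq_div, le_div_iff₀ hs]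
  nlinarith [Real.exp_pos (-a * y ^ 2)]

/-- The derivative of the complex heat kernel. -/
def heatKernelDeriv (z : ℂ) (y : ℝ) : ℂ := -(2 * y) / (4 * z) * heatKernel z y

theorem norm_heatKernelDeriv_le {z : ℂ} (hz : 0 < z.re) (y : ℝ) :
    ‖heatKernelDeriv z y‖ ≤ (√z.re)⁻¹ * ((4 * Real.pi * ‖z‖) ^ (-(1 / 2) : ℝ) *
      Real.exp (-(z.re / (4 * ‖z‖ ^ 2) / 2) * y ^ 2)) := by
  have hz0 : 0 < ‖z‖ := norm_pos_iff.2 (by rintro rfl; simp at hz)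
  have ha : 0 < z.re / (4 * ‖z‖ ^ 2) := by positivity
  have h1 := mul_exp_neg_sq_le ha y
  have h2 : √(z.re / (4 * ‖z‖ ^ 2)) = √z.re / (2 * ‖z‖) := by
    rw [Real.sqrt_div hz.le, show 4 * ‖z‖ ^ 2 = (2 * ‖z‖) ^ 2 by ring,
      Real.sqrt_sq (by positivity)]
  rw [h2] at h1
  set c := (4 * Real.pi * ‖z‖) ^ (-(1 / 2) : ℝ) with hc
  have hc0 : 0 ≤ c := by have := Real.pi_pos; positivity
  rw [heatKernelDeriv, norm_mul, norm_heatKernel, norm_div, norm_neg, norm_mul, norm_mul]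
  simp only [Complex.norm_real, Real.norm_eq_abs, Complex.norm_ofNat]
  set e1 := Real.exp (-(z.re / (4 * ‖z‖ ^ 2)) * y ^ 2) with he1
  set e2 := Real.exp (-(z.re / (4 * ‖z‖ ^ 2) / 2) * y ^ 2) with he2
  calc 2 * |y| / (4 * ‖z‖) * (c * e1) = (2 * ‖z‖)⁻¹ * c * (|y| * e1) := by field_simp; ring
    _ ≤ (2 * ‖z‖)⁻¹ * c * ((√z.re / (2 * ‖z‖))⁻¹ * e2) := by gcongr
    _ = _ := by
      have : 0 < √z.re := Real.sqrt_pos.2 hz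
      field_simp

theorem lintegral_enorm_heatKernelDeriv_le {z : ℂ} (hz : 0 < z.re) :
    ∫⁻ y : ℝ, ‖heatKernelDeriv z y‖ₑ ≤ ENNReal.ofReal (2 * (√z.re)⁻¹ * heatMass z) := by
  have hz0 : 0 < ‖z‖ := norm_pos_iff.2 (by rintro rfl; simp at hz)
  have hpi := Real.pi_pos
  have ha : 0 < z.re / (4 * ‖z‖ ^ 2) / 2 := by positivity
  calc ∫⁻ y : ℝ, ‖heatKernelDeriv z y‖ₑ
      ≤ ∫⁻ y : ℝ, ENNReal.ofReal ((√z.re)⁻¹ * (4 * Real.pi * ‖z‖) ^ (-(1 / 2) : ℝ)) *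
          ENNReal.ofReal (Real.exp (-(z.re / (4 * ‖z‖ ^ 2) / 2) * y ^ 2)) := by
        refine lintegral_mono fun y => ?_
        rw [← ENNReal.ofReal_mul (by positivity), ← ofReal_norm]
        refine ENNReal.ofReal_le_ofReal ?_
        rw [mul_assoc]
        exact norm_heatKernelDeriv_le hz y
    _ = ENNReal.ofReal ((√z.re)⁻¹ * (4 * Real.pi * ‖z‖) ^ (-(1 / 2) : ℝ) *
          √(Real.pi / (z.re / (4 * ‖z‖ ^ 2) / 2))) := by
        rw [lintegral_const_mul' _ _ ENNReal.ofReal_ne_top, lintegral_ofReal_exp_neg_mul_sq ha,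
          ← ENNReal.ofReal_mul (by positivity)]
    _ ≤ _ := by
        refine ENNReal.ofReal_le_ofReal ?_
        have h1 : √(Real.pi / (z.re / (4 * ‖z‖ ^ 2) / 2)) =
            √2 * √(Real.pi / (z.re / (4 * ‖z‖ ^ 2))) := by
          rw [← Real.sqrt_mul (by norm_num)]; congr 1; field_simp
        have h2 : √2 ≤ 2 := by
          rw [Real.sqrt_le_left (by norm_num)]; norm_num
        rw [h1, ← rpow_neg_half_mul_sqrt hz]
        calc _ = √2 * ((√z.re)⁻¹ * ((4 * Real.pi * ‖z‖) ^ (-(1 / 2) : ℝ) *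
              √(Real.pi / (z.re / (4 * ‖z‖ ^ 2))))) := by ring
          _ ≤ 2 * ((√z.re)⁻¹ * ((4 * Real.pi * ‖z‖) ^ (-(1 / 2) : ℝ) *
              √(Real.pi / (z.re / (4 * ‖z‖ ^ 2))))) := by gcongr
          _ = _ := by ring

theorem continuous_heatKernel {z : ℂ} : Continuous (heatKernel z) := by
  unfold heatKernel; fun_prop

theorem continuous_heatKernelDeriv {z : ℂ} : Continuous (heatKernelDeriv z) := by
  unfold heatKernelDeriv heatKernel; fun_prop

/-- The fundamental theorem of calculus along the segment from `y` to `y + h`, parametrized by `[0,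
1]` so that Tonelli in `y` bounds the `L¹` increment by `|h|` times the `L¹` norm of the derivative.
-/
theorem enorm_sub_le_lintegral_deriv {f f' : ℝ → ℂ} (hf : ∀ y, HasDerivAt f (f' y) y)
    (hf' : Continuous f') (y h : ℝ) :
    ‖f (y + h) - f y‖ₑ ≤ ‖h‖ₑ * ∫⁻ u in Ioc (0 : ℝ) 1, ‖f' (y + u * h)‖ₑ := by
  have h1 : ∀ u : ℝ, HasDerivAt (fun u : ℝ => f (y + u * h)) (h • f' (y + u * h)) u := by
    intro u
    have h2 : HasDerivAt (fun u : ℝ => y + u * h) h u := by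
      simpa using ((hasDerivAt_id u).mul_const h).const_add y
    exact (hf _).scomp u h2
  have h3 : ∫ u in (0 : ℝ)..1, h • f' (y + u * h) = f (y + 1 * h) - f (y + 0 * h) :=
    intervalIntegral.integral_eq_sub_of_hasDerivAt (fun u _ => h1 u)
      (Continuous.intervalIntegrable (by fun_prop) _ _)
  rw [one_mul, zero_mul, add_zero] at h3
  rw [← h3, intervalIntegral.integral_of_le zero_le_one,
    ← lintegral_const_mul' _ _ enorm_ne_top]
  exact (enorm_integral_le_lintegral_enorm _).trans (lintegral_mono fun u => (enorm_smul _ _).le)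

/-- Interpolation between the trivial bound, twice the mass, and the derivative bound, which gains
`|h| (Re z)^{-1/2}`. -/
theorem lintegral_enorm_heatKernel_sub_le {z : ℂ} (hz : 0 < z.re) (h : ℝ) :
    ∫⁻ y : ℝ, ‖heatKernel z (y + h) - heatKernel z y‖ₑ ≤
      ENNReal.ofReal (2 * heatMass z * (z.re ^ (-(3 / 8) : ℝ) * |h| ^ (3 / 4 : ℝ))) := by
  have hm0 : 0 ≤ heatMass z := Real.sqrt_nonneg _
  have hs : 0 < √z.re := Real.sqrt_pos.2 hz
  have hA : ∫⁻ y : ℝ, ‖heatKernel z (y + h) - heatKernel z y‖ₑ ≤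
      ENNReal.ofReal (2 * heatMass z * 1) := by
    calc ∫⁻ y : ℝ, ‖heatKernel z (y + h) - heatKernel z y‖ₑ
        ≤ ∫⁻ y : ℝ, (‖heatKernel z (y + h)‖ₑ + ‖heatKernel z y‖ₑ) :=
          lintegral_mono fun y => enorm_sub_le
      _ = ENNReal.ofReal (heatMass z) + ENNReal.ofReal (heatMass z) := by
          rw [lintegral_add_right _ continuous_heatKernel.measurable.enorm,
            lintegral_add_right_eq_self (fun y => ‖heatKernel z y‖ₑ) h,
            lintegral_enorm_heatKernel hz]
      _ = _ := by rw [← ENNReal.ofReal_add hm0 hm0]; congr 1; ring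
  have hB : ∫⁻ y : ℝ, ‖heatKernel z (y + h) - heatKernel z y‖ₑ ≤
      ENNReal.ofReal (2 * heatMass z * (|h| * (√z.re)⁻¹)) := by
    calc ∫⁻ y : ℝ, ‖heatKernel z (y + h) - heatKernel z y‖ₑ
        ≤ ∫⁻ y : ℝ, ‖h‖ₑ * ∫⁻ u in Ioc (0 : ℝ) 1, ‖heatKernelDeriv z (y + u * h)‖ₑ :=
          lintegral_mono fun y => enorm_sub_le_lintegral_deriv (hasDerivAt_heatKernel z)
            continuous_heatKernelDeriv y h
      _ = ‖h‖ₑ * ∫⁻ u in Ioc (0 : ℝ) 1, ∫⁻ y : ℝ, ‖heatKernelDeriv z (y + u * h)‖ₑ := by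
          rw [lintegral_const_mul' _ _ enorm_ne_top, lintegral_lintegral_swap]
          have : Continuous fun q : ℝ × ℝ => heatKernelDeriv z (q.1 + q.2 * h) :=
            continuous_heatKernelDeriv.comp (by fun_prop)
          exact this.measurable.enorm.aemeasurable
      _ = ‖h‖ₑ * ∫⁻ y : ℝ, ‖heatKernelDeriv z y‖ₑ := by
          congr 1
          rw [lintegral_congr fun u =>
            lintegral_add_right_eq_self (fun y => ‖heatKernelDeriv z y‖ₑ) (u * h)]
          simp
      _ ≤ ‖h‖ₑ * ENNReal.ofReal (2 * (√z.re)⁻¹ * heatMass z) := by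
          gcongr; exact lintegral_enorm_heatKernelDeriv_le hz
      _ = _ := by
          rw [← ofReal_norm, ← ENNReal.ofReal_mul (norm_nonneg _), Real.norm_eq_abs]
          congr 1; ring
  -- With `x = |h| (Re z)^{-1/2}` this is `min(1, x) ≤ x^{3/4}`.
  have hC : min 1 (|h| * (√z.re)⁻¹) ≤ z.re ^ (-(3 / 8) : ℝ) * |h| ^ (3 / 4 : ℝ) := by
    set x := |h| * (√z.re)⁻¹ with hx
    have hx0 : 0 ≤ x := by positivity
    have e : z.re ^ (-(3 / 8) : ℝ) * |h| ^ (3 / 4 : ℝ) = x ^ (3 / 4 : ℝ) := by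
      rw [hx, Real.mul_rpow (abs_nonneg _) (by positivity), Real.sqrt_eq_rpow,
        ← Real.rpow_neg hz.le, ← Real.rpow_mul hz.le]
      norm_num [mul_comm]
    rw [e]
    rcases le_total x 1 with h1 | h1
    · refine (min_le_right _ _).trans ?_
      rcases hx0.eq_or_lt with h0 | h0
      · rw [← h0]; positivity
      · calc x = x ^ (1 : ℝ) := (Real.rpow_one x).symm
          _ ≤ _ := Real.rpow_le_rpow_of_exponent_ge h0 h1 (by norm_num)
    · exact (min_le_left _ _).trans (Real.one_le_rpow h1 (by norm_num))
  have hD : ∫⁻ y : ℝ, ‖heatKernel z (y + h) - heatKernel z y‖ₑ ≤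
      ENNReal.ofReal (2 * heatMass z * min 1 (|h| * (√z.re)⁻¹)) := by
    rcases min_choice 1 (|h| * (√z.re)⁻¹) with h1 | h1 <;> rw [h1] <;> assumption
  refine hD.trans (ENNReal.ofReal_le_ofReal ?_)
  gcongr

/-- For fixed `t ≠ 0` the mass blows up as `s → 0`, since the Schrödinger kernel is not integrable.
The rate `s^{-1/2}` is integrable in the heat time, which is why two derivatives pay for it. -/
theorem heatMass_le {s t : ℝ} (hs : 0 < s) (ht : |t| ≤ 1) :
    heatMass (s + t * Complex.I) ≤ 1 + s ^ (-(1 / 2) : ℝ) := by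
  have h1 : ‖(s + t * Complex.I : ℂ)‖ ≤ s + 1 := by
    refine (norm_add_le _ _).trans ?_
    simpa [abs_of_pos hs] using ht
  have h2 : (s + t * Complex.I : ℂ).re = s := by simp
  have h3 : 0 ≤ s ^ (-(1 / 2) : ℝ) := by positivity
  have h4 : (s ^ (-(1 / 2) : ℝ)) ^ 2 = s⁻¹ := by
    rw [← Real.rpow_natCast, ← Real.rpow_mul hs.le, ← Real.rpow_neg_one]; norm_num
  rw [heatMass, h2, Real.sqrt_le_left (by positivity)]
  calc ‖(s + t * Complex.I : ℂ)‖ / s ≤ (s + 1) / s := by gcongr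
    _ = 1 + s⁻¹ := by field_simp
    _ ≤ _ := by rw [← h4]; nlinarith

/-! ### The kernel of `(1 - ∂ₓₓ)⁻¹ e^{it∂ₓₓ}` -/

/-- The integrand, over the heat time `s` and the space variable `y`, of the kernel of
`(1 - ∂ₓₓ)⁻¹ e^{it∂ₓₓ}`. -/
def smoothKernel (t : ℝ) (q : ℝ × ℝ) : ℂ :=
  Real.exp (-q.1) * (if 0 < q.1 then heatKernel (q.1 + t * Complex.I) q.2 else 0)

/-- The measure on the variables `(s, y)`. -/
def kernelMeasure : Measure (ℝ × ℝ) := (volume.restrict (Ioi (0 : ℝ))).prod volume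

instance : SFinite kernelMeasure := by unfold kernelMeasure; infer_instance

theorem measurable_smoothKernel :
    Measurable fun w : ℝ × (ℝ × ℝ) => smoothKernel w.1 w.2 := by
  unfold smoothKernel
  refine Measurable.mul (by fun_prop) ?_
  have hS : MeasurableSet {w : ℝ × (ℝ × ℝ) | 0 < w.2.1} :=
    measurableSet_lt measurable_const (by fun_prop)
  have hc : ContinuousOn (fun w : ℝ × (ℝ × ℝ) => heatKernel (w.2.1 + w.1 * Complex.I) w.2.2)
      {w | 0 < w.2.1} := by
    refine continuousOn_heatKernel.comp (t := {q | 0 < q.1.re})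
      (f := fun w : ℝ × (ℝ × ℝ) => ((w.2.1 : ℂ) + w.1 * Complex.I, w.2.2))
      (by fun_prop) ?_
    intro w hw
    simpa using hw
  have := (hc.measurable_piecewise (continuousOn_const (c := (0 : ℂ))) hS)
  convert this using 1
  funext w
  by_cases hw : 0 < w.2.1 <;> simp [hw]

/-- The weight in the heat time. -/
def kernelWeight (s : ℝ) : ℝ :=
  Real.exp (-s) * ((1 + s ^ (-(1 / 2) : ℝ)) * (1 + 2 * s ^ (-(3 / 8) : ℝ)))

theorem kernelWeight_nonneg {s : ℝ} (hs : 0 < s) : 0 ≤ kernelWeight s := by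
  unfold kernelWeight; positivity

/-- The product expands into four Gamma integrals, at `1`, `1/2`, `5/8` and `1/8`. The worst
singularity is `s^{-7/8}`, from the mass `s^{-1/2}` and the Hölder factor `s^{-3/8}`; a Hölder order
of `1` would make it `s^{-1}`. -/
theorem integrableOn_kernelWeight : IntegrableOn kernelWeight (Ioi 0) := by
  have h := fun {a : ℝ} (ha : 0 < a) => Real.GammaIntegral_convergent ha
  have h1 := ((h (a := 1) (by norm_num)).add (h (a := 1 / 2) (by norm_num))).add
    (((h (a := 5 / 8) (by norm_num)).const_mul 2).add
      ((h (a := 1 / 8) (by norm_num)).const_mul 2))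
  refine h1.congr_fun (fun s hs => ?_) measurableSet_Ioi
  have hs : (0 : ℝ) < s := hs
  have e : s ^ (-(7 / 8) : ℝ) = s ^ (-(1 / 2) : ℝ) * s ^ (-(3 / 8) : ℝ) := by
    rw [← Real.rpow_add hs]; norm_num
  simp only [Pi.add_apply, kernelWeight]
  norm_num
  rw [e]
  ring

/-- The constant in the bounds for the smoothing kernel. -/
def kernelConst : ℝ := ∫ s in Ioi (0 : ℝ), kernelWeight s

theorem kernelConst_nonneg : 0 ≤ kernelConst :=
  setIntegral_nonneg measurableSet_Ioi fun _ hs => kernelWeight_nonneg hs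

theorem ofReal_kernelConst :
    ENNReal.ofReal kernelConst = ∫⁻ s in Ioi (0 : ℝ), ENNReal.ofReal (kernelWeight s) :=
  ofReal_integral_eq_lintegral_ofReal integrableOn_kernelWeight
    ((ae_restrict_iff' measurableSet_Ioi).2 (ae_of_all _ fun _ hs => kernelWeight_nonneg hs))

theorem lintegral_enorm_smoothKernel_le {t : ℝ} (ht : |t| ≤ 1) :
    ∫⁻ q, ‖smoothKernel t q‖ₑ ∂kernelMeasure ≤ ENNReal.ofReal kernelConst := by
  have hm : Measurable (smoothKernel t) :=
    measurable_smoothKernel.comp (measurable_const.prodMk measurable_id)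
  rw [kernelMeasure, lintegral_prod _ hm.enorm.aemeasurable, ofReal_kernelConst]
  refine setLIntegral_mono_ae' measurableSet_Ioi (ae_of_all _ fun s hs => ?_)
  have hs : (0 : ℝ) < s := hs
  have hre : 0 < (s + t * Complex.I : ℂ).re := by simpa using hs
  simp only [smoothKernel, hs, if_true, enorm_mul]
  rw [lintegral_const_mul' _ _ enorm_ne_top, lintegral_enorm_heatKernel hre, ← ofReal_norm,
    ← ENNReal.ofReal_mul (norm_nonneg _), Complex.norm_real, Real.norm_eq_abs, Real.abs_exp]
  refine ENNReal.ofReal_le_ofReal ?_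
  unfold kernelWeight
  have h1 := heatMass_le hs ht
  have h2 : 0 ≤ s ^ (-(3 / 8) : ℝ) := by positivity
  have h3 : 0 ≤ s ^ (-(1 / 2) : ℝ) := by positivity
  gcongr
  nlinarith

theorem lintegral_enorm_smoothKernel_sub_le {t : ℝ} (ht : |t| ≤ 1) (h : ℝ) :
    ∫⁻ q, ‖smoothKernel t (q.1, q.2 + h) - smoothKernel t q‖ₑ ∂kernelMeasure ≤
      ENNReal.ofReal (kernelConst * |h| ^ (3 / 4 : ℝ)) := by
  have hm : Measurable (smoothKernel t) :=
    measurable_smoothKernel.comp (measurable_const.prodMk measurable_id)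
  have hm2 : Measurable fun q : ℝ × ℝ => smoothKernel t (q.1, q.2 + h) - smoothKernel t q :=
    (hm.comp (by fun_prop)).sub hm
  rw [kernelMeasure, lintegral_prod _ hm2.enorm.aemeasurable, ENNReal.ofReal_mul kernelConst_nonneg,
    ofReal_kernelConst, ← lintegral_mul_const' _ _ ENNReal.ofReal_ne_top]
  refine setLIntegral_mono_ae' measurableSet_Ioi (ae_of_all _ fun s hs => ?_)
  have hs : (0 : ℝ) < s := hs
  have hre : 0 < (s + t * Complex.I : ℂ).re := by simpa using hs
  simp only [smoothKernel, hs, if_true, ← mul_sub, enorm_mul]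
  rw [lintegral_const_mul' _ _ enorm_ne_top]
  calc _ ≤ ‖((Real.exp (-s) : ℝ) : ℂ)‖ₑ * ENNReal.ofReal (2 * heatMass (s + t * Complex.I) *
        ((s + t * Complex.I : ℂ).re ^ (-(3 / 8) : ℝ) * |h| ^ (3 / 4 : ℝ))) := by
        gcongr; exact lintegral_enorm_heatKernel_sub_le hre h
    _ ≤ _ := by
        rw [← ofReal_norm, ← ENNReal.ofReal_mul (norm_nonneg _), Complex.norm_real,
          Real.norm_eq_abs, Real.abs_exp, ← ENNReal.ofReal_mul (kernelWeight_nonneg hs)]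
        refine ENNReal.ofReal_le_ofReal ?_
        unfold kernelWeight
        have h1 := heatMass_le hs ht
        have h2 : 0 ≤ s ^ (-(3 / 8) : ℝ) := by positivity
        have h3 : 0 ≤ s ^ (-(1 / 2) : ℝ) := by positivity
        have h4 : (s + t * Complex.I : ℂ).re = s := by simp
        rw [h4]
        calc Real.exp (-s) * (2 * heatMass (s + t * Complex.I) *
              (s ^ (-(3 / 8) : ℝ) * |h| ^ (3 / 4 : ℝ)))
            = Real.exp (-s) * (heatMass (s + t * Complex.I) * (2 * s ^ (-(3 / 8) : ℝ))) *
              |h| ^ (3 / 4 : ℝ) := by ring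
          _ ≤ Real.exp (-s) * ((1 + s ^ (-(1 / 2) : ℝ)) * (1 + 2 * s ^ (-(3 / 8) : ℝ))) *
              |h| ^ (3 / 4 : ℝ) := by
            gcongr
            linarith

theorem integrable_smoothKernel {t : ℝ} (ht : |t| ≤ 1) :
    Integrable (smoothKernel t) kernelMeasure :=
  ⟨(measurable_smoothKernel.comp (measurable_const.prodMk measurable_id)).aestronglyMeasurable,
    (lintegral_enorm_smoothKernel_le ht).trans_lt ENNReal.ofReal_lt_top⟩

theorem integral_exp_neg_mul_Ioi_complex {a : ℝ} (ha : 0 < a) :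
    ∫ s in Ioi (0 : ℝ), Complex.exp (-(a * s)) = ((a : ℝ) : ℂ)⁻¹ := by
  have h := integral_exp_mul_complex_Ioi (a := -a) (by simpa using ha) 0
  simp only [Complex.ofReal_zero, mul_zero, Complex.exp_zero] at h
  have e : ∀ s : ℝ, Complex.exp (-(a * s)) = Complex.exp (-a * s) := fun s => by rw [neg_mul]
  simp_rw [e, h]
  rw [neg_div_neg_eq, one_div]

/-- Subordination: the resolvent symbol is `∫₀^∞ e^{-s(1+(2πξ)²)} ds`. Combined with the Schrödinger
symbol, the integrand at each `s` is `e^{-s}` times a complex heat symbol, and Fubini exchanges `s`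
and `ξ`. -/
theorem resolvent_propagator_apply {t : ℝ} (ht : |t| ≤ 1) (φ : 𝓢(ℝ, ℂ)) (x : ℝ) :
    resolvent (propagator t φ) x = ∫ q, smoothKernel t q * φ (x + q.2) ∂kernelMeasure := by
  have hmul : resolvent (propagator t φ) =
      SchwartzMap.fourierMultiplierCLM ℂ (resolventSymbol * schrodingerSymbol t) φ :=
    SchwartzMap.fourierMultiplierCLM_fourierMultiplierCLM_apply
      resolventSymbol_hasTemperateGrowth (schrodingerSymbol_hasTemperateGrowth t) φ
  rw [hmul, fourierMultiplier_apply_eq_integral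
    (resolventSymbol_hasTemperateGrowth.mul (schrodingerSymbol_hasTemperateGrowth t))]
  have hint : Integrable (fun q : ℝ × ℝ => smoothKernel t q * φ (x + q.2)) kernelMeasure := by
    refine (integrable_smoothKernel ht).mul_bdd (c := SchwartzMap.seminorm ℝ 0 0 φ)
      ?_ (ae_of_all _ fun q => SchwartzMap.norm_le_seminorm ℝ φ _)
    have : Continuous φ := φ.continuous
    exact Continuous.aestronglyMeasurable (by fun_prop)
  rw [kernelMeasure] at hint ⊢
  rw [integral_prod _ hint]
  have h1 : ∀ s ∈ Ioi (0 : ℝ), ∫ y, smoothKernel t (s, y) * φ (x + y) =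
      ∫ ξ : ℝ, Complex.exp (2 * Real.pi * x * ξ * Complex.I) *
        (Complex.exp (-((1 + (2 * Real.pi * ξ) ^ 2 : ℝ) * s)) *
          (schrodingerSymbol t ξ * 𝓕 φ ξ)) := by
    intro s hs
    have hs : (0 : ℝ) < s := hs
    have hre : 0 < (s + t * Complex.I : ℂ).re := by simpa using hs
    simp only [smoothKernel, hs, if_true, mul_assoc]
    rw [integral_const_mul, ← integral_exp_mul_fourier hre, ← integral_const_mul]
    refine integral_congr_ae (ae_of_all _ fun ξ => ?_)
    simp only [schrodingerSymbol, Complex.ofReal_exp]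
    have : Complex.exp (-(((1 + (2 * Real.pi * ξ) ^ 2 : ℝ) : ℂ) * s)) *
        Complex.exp (-(Complex.I * t * (2 * Real.pi * ξ) ^ 2)) =
        Complex.exp ((-s : ℝ) : ℂ) *
          Complex.exp (-(s + t * Complex.I) * (2 * Real.pi * ξ) ^ 2) := by
      rw [← Complex.exp_add, ← Complex.exp_add]
      congr 1
      push_cast
      ring
    simp only [mul_assoc] at this ⊢
    linear_combination (-Complex.exp (2 * (Real.pi * (x * (ξ * Complex.I)))) * 𝓕 φ ξ) * this
  rw [setIntegral_congr_fun measurableSet_Ioi h1, integral_integral_swap]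
  · refine integral_congr_ae (ae_of_all _ fun ξ => ?_)
    have ha : 0 < 1 + (2 * Real.pi * ξ) ^ 2 := by positivity
    simp only [Pi.mul_apply]
    rw [integral_const_mul, integral_mul_const, integral_exp_neg_mul_Ioi_complex ha,
      resolventSymbol]
    ring
  · have hb : Integrable (fun q : ℝ × ℝ => Real.exp (-q.1) * ‖𝓕 φ q.2‖)
        ((volume.restrict (Ioi (0 : ℝ))).prod volume) := by
      refine Integrable.mul_prod (f := fun s => Real.exp (-s)) (g := fun ξ => ‖𝓕 φ ξ‖) ?_
        (𝓕 φ).integrable.norm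
      exact integrableOn_exp_neg_Ioi 0
    refine hb.mono' ?_ ?_
    · have : Continuous (𝓕 φ : 𝓢(ℝ, ℂ)) := (𝓕 φ : 𝓢(ℝ, ℂ)).continuous
      refine Continuous.aestronglyMeasurable ?_
      unfold schrodingerSymbol
      fun_prop
    · have hae : ∀ᵐ q : ℝ × ℝ ∂((volume.restrict (Ioi (0 : ℝ))).prod volume), 0 < q.1 := by
        have : ∀ᵐ s ∂(volume.restrict (Ioi (0 : ℝ))), 0 < s :=
          (ae_restrict_iff' measurableSet_Ioi).2 (ae_of_all _ fun _ h => h)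
        exact Measure.quasiMeasurePreserving_fst.ae this
      filter_upwards [hae] with q hq
      simp only [Function.uncurry_def, norm_mul, norm_exp_two_pi_mul_I, norm_schrodingerSymbol,
        one_mul]
      gcongr
      rw [← Complex.ofReal_mul, ← Complex.ofReal_neg, ← Complex.ofReal_exp, Complex.norm_real,
        Real.norm_eq_abs, Real.abs_exp, Real.exp_le_exp]
      nlinarith [sq_nonneg (2 * Real.pi * q.2)]

theorem propagator_eq_integral {t : ℝ} (ht : |t| ≤ 1) (φ : 𝓢(ℝ, ℂ)) (x : ℝ) :
    propagator t φ x = ∫ q, smoothKernel t q * helmholtz φ (x + q.2) ∂kernelMeasure := by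
  rw [← resolvent_propagator_helmholtz, resolvent_propagator_apply ht]

/-- The Schrödinger group maps Schwartz functions to `Lᵖ`, uniformly for `|t| ≤ 1`. -/
theorem eLpNorm_propagator_le {t : ℝ} (ht : |t| ≤ 1) (φ : 𝓢(ℝ, ℂ)) {p : ℝ≥0∞} (hp : 1 ≤ p)
    (hpt : p ≠ ⊤) : eLpNorm (propagator t φ) p volume ≤
      ENNReal.ofReal kernelConst * eLpNorm (helmholtz φ) p volume := by
  have h : (propagator t φ : ℝ → ℂ) =
      fun x => ∫ q, smoothKernel t q * helmholtz φ (x + q.2) ∂kernelMeasure := by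
    funext x; exact propagator_eq_integral ht φ x
  rw [h]
  refine eLpNorm_integral_mul_le (H := fun q x => helmholtz φ (x + q.2))
    (measurable_smoothKernel.comp (measurable_const.prodMk measurable_id))
    (lintegral_enorm_smoothKernel_le ht) ENNReal.ofReal_ne_top ?_ hp hpt (ae_of_all _ fun q => ?_)
  · have : Continuous (helmholtz φ) := (helmholtz φ).continuous
    exact Continuous.measurable (by unfold Function.uncurry; fun_prop)
  · exact (eLpNorm_comp_measurePreserving (helmholtz φ).continuous.aestronglyMeasurable
      (measurePreserving_add_right volume q.2)).le

/-! ### Pairings of `Lᵖ` functions with Schwartz functions -/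

theorem lintegral_enorm_mul_le {p : ℝ≥0∞} (hp : 1 ≤ p) {f g : ℝ → ℂ}
    (hf : AEStronglyMeasurable f volume) (hg : AEStronglyMeasurable g volume) :
    ∫⁻ x, ‖f x * g x‖ₑ ≤ eLpNorm f p volume * eLpNorm g (ENNReal.conjExponent p) volume := by
  have : ENNReal.HolderConjugate p (ENNReal.conjExponent p) := .conjExponent hp
  have h := eLpNorm_smul_le_mul_eLpNorm (p := p) (q := ENNReal.conjExponent p) (r := 1) hg hf
  rw [eLpNorm_one_eq_lintegral_enorm] at h
  exact h

theorem integrable_mul_schwartz {p : ℝ≥0∞} (hp : 1 ≤ p) {f : ℝ → ℂ}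
    (hf : AEStronglyMeasurable f volume) (h : eLpNorm f p volume < ⊤) (φ : 𝓢(ℝ, ℂ)) :
    Integrable fun x => f x * φ x :=
  ⟨hf.mul φ.continuous.aestronglyMeasurable,
    (lintegral_enorm_mul_le hp hf φ.continuous.aestronglyMeasurable).trans_lt
      (ENNReal.mul_lt_top h (φ.eLpNorm_lt_top _ volume))⟩

/-- `g` is the weak derivative of `f` tested against Schwartz functions. -/
def TemperedDeriv (f g : ℝ → ℂ) : Prop :=
  ∀ χ : 𝓢(ℝ, ℂ), ∫ x, f x * SchwartzMap.derivCLM ℂ ℂ χ x = -∫ x, g x * χ x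

theorem TemperedDeriv.hasDerivAt {f g : ℝ → ℂ} (h : TemperedDeriv f g) (hf : Continuous f)
    (hg : Continuous g) (x : ℝ) : HasDerivAt f (g x) x := by
  refine hasDerivAt_of_forall_integral_eq hf hg (fun φ hφ hs => ?_) x
  have hs' : HasCompactSupport fun x => (φ x : ℂ) :=
    hs.comp_left (g := fun y : ℝ => (y : ℂ)) (by simp)
  have hφ' : ContDiff ℝ ∞ fun x => (φ x : ℂ) := Complex.ofRealCLM.contDiff.comp hφ
  have h1 := h (hs'.toSchwartzMap hφ')
  have h2 : ∀ x, SchwartzMap.derivCLM ℂ ℂ (hs'.toSchwartzMap hφ') x = ((deriv φ x : ℝ) : ℂ) := by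
    intro x
    rw [SchwartzMap.derivCLM_apply]
    exact (hφ.differentiable (by simp) x).hasDerivAt.ofReal_comp.deriv
  simp only [h2] at h1
  simp only [mul_comm (f _), mul_comm (g _)] at h1
  exact h1

theorem TemperedDeriv.of_hasDerivAt {p : ℝ≥0∞} (hp : 1 ≤ p) {f g : ℝ → ℂ}
    (hfg : ∀ x, HasDerivAt f (g x) x) (hf : eLpNorm f p volume < ⊤) (hg : Continuous g)
    (hg' : eLpNorm g p volume < ⊤) : TemperedDeriv f g := by
  intro χ
  have hfc : Continuous f := continuous_iff_continuousAt.2 fun x => (hfg x).continuousAt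
  refine integral_mul_deriv_eq_deriv_mul_of_integrable (fun x _ => hfg x) (fun x _ => ?_)
    (integrable_mul_schwartz hp hfc.aestronglyMeasurable hf _)
    (integrable_mul_schwartz hp hg.aestronglyMeasurable hg' _)
    (integrable_mul_schwartz hp hfc.aestronglyMeasurable hf _)
  rw [SchwartzMap.derivCLM_apply]
  exact χ.differentiableAt.hasDerivAt

theorem TemperedDeriv.integral_helmholtz {p : ℝ≥0∞} (hp : 1 ≤ p) {f g h : ℝ → ℂ}
    (hfm : AEStronglyMeasurable f volume) (hf : eLpNorm f p volume < ⊤)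
    (hhm : AEStronglyMeasurable h volume) (hh : eLpNorm h p volume < ⊤)
    (hfg : TemperedDeriv f g) (hgh : TemperedDeriv g h) (χ : 𝓢(ℝ, ℂ)) :
    ∫ x, f x * helmholtz χ x = ∫ x, (f x - h x) * χ x := by
  simp only [helmholtz, _root_.sub_apply, mul_sub, sub_mul]
  rw [integral_sub (integrable_mul_schwartz hp hfm hf _) (integrable_mul_schwartz hp hfm hf _),
    integral_sub (integrable_mul_schwartz hp hfm hf _) (integrable_mul_schwartz hp hhm hh _),
    hfg, hgh, neg_neg]

/-! ### The evolution operator, paired with Schwartz functions -/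

/-- Truncation of the time variable to `[-1, 1]`. -/
def clamp (t : ℝ) : ℝ := max (-1) (min 1 t)

theorem abs_clamp_le (t : ℝ) : |clamp t| ≤ 1 := by
  rw [abs_le]
  exact ⟨le_max_left _ _, max_le (by norm_num) (min_le_left _ _)⟩

theorem clamp_of_mem {t : ℝ} (ht : t ∈ Icc (-1 : ℝ) 1) : clamp t = t := by
  rw [clamp, min_eq_right ht.2, max_eq_right ht.1]

theorem measurable_clamp : Measurable clamp := by unfold clamp; fun_prop

/-- The data of a time average: a probability measure on `[0, 1]` and a weight. The Dirac mass at
`0` gives the free evolution, and Lebesgue measure gives Duhamel's integral. -/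
structure IsTimeAverage (ν : Measure ℝ) (c : ℝ → ℂ) : Prop where
  prob : IsProbabilityMeasure ν
  mem : ∀ᵐ σ ∂ν, σ ∈ Icc (0 : ℝ) 1
  meas : Measurable c
  norm_le : ∀ t, |t| ≤ 1 → ‖c t‖ ≤ 1

/-- The pairing of `c(t) ∫ e^{i(t-tσ)∂ₓₓ} F(tσ) dν(σ)` with `φ`. -/
def evolutionPairing (ν : Measure ℝ) (c : ℝ → ℂ) (F : ℝ → ℝ → ℂ) (t : ℝ) (φ : 𝓢(ℝ, ℂ)) : ℂ :=
  c t * ∫ σ, (∫ x, F (t * σ) x * propagator (t - t * σ) φ x) ∂ν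

/-- The weak form of "the derivative of the evolution is the evolution of the derivative"; the group
commutes with `∂ₓ`. -/
theorem evolutionPairing_derivCLM {ν : Measure ℝ} {c : ℝ → ℂ} {F F' : ℝ → ℝ → ℂ}
    (h : ∀ t, TemperedDeriv (F t) (F' t)) (t : ℝ) (φ : 𝓢(ℝ, ℂ)) :
    evolutionPairing ν c F t (SchwartzMap.derivCLM ℂ ℂ φ) = -evolutionPairing ν c F' t φ := by
  simp only [evolutionPairing, ← derivCLM_propagator]
  have h' : ∀ (τ : ℝ) (χ : 𝓢(ℝ, ℂ)), ∫ x, F τ x * SchwartzMap.derivCLM ℂ ℂ χ x =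
    -∫ x, F' τ x * χ x := h
  simp only [h', integral_neg, mul_neg]

theorem abs_sub_mul_le {t σ : ℝ} (ht : |t| ≤ 1) (hσ : σ ∈ Icc (0 : ℝ) 1) : |t - t * σ| ≤ 1 := by
  have h1 : |1 - σ| ≤ 1 := by rw [abs_le]; constructor <;> linarith [hσ.1, hσ.2]
  rw [show t - t * σ = t * (1 - σ) by ring, abs_mul]
  exact mul_le_one₀ ht (abs_nonneg _) h1

/-- The kernel of the smoothed evolution. -/
def evolutionKernel (c : ℝ → ℂ) (t : ℝ) (w : ℝ × (ℝ × ℝ)) : ℂ :=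
  c t * smoothKernel (t - t * w.1) w.2

/-- The smoothed evolution `c(t) ∫ (1 - ∂ₓₓ)⁻¹ e^{i(t-tσ)∂ₓₓ} H(tσ) dν(σ)`. -/
def smoothedEvolution (ν : Measure ℝ) (c : ℝ → ℂ) (H : ℝ → ℝ → ℂ) (t x : ℝ) : ℂ :=
  ∫ w, evolutionKernel c t w * H (t * w.1) (x - w.2.2) ∂(ν.prod kernelMeasure)

theorem measurable_evolutionKernel {c : ℝ → ℂ} (hc : Measurable c) :
    Measurable fun z : ℝ × (ℝ × (ℝ × ℝ)) => evolutionKernel c z.1 z.2 := by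
  unfold evolutionKernel
  refine (hc.comp measurable_fst).mul ?_
  exact measurable_smoothKernel.comp
    (f := fun z : ℝ × (ℝ × (ℝ × ℝ)) => (z.1 - z.1 * z.2.1, z.2.2)) (by fun_prop)

theorem measurable_smoothedEvolution {ν : Measure ℝ} {c : ℝ → ℂ} (hν : IsTimeAverage ν c)
    {H : ℝ → ℝ → ℂ} (hH : Measurable (Function.uncurry H)) :
    Measurable (Function.uncurry (smoothedEvolution ν c H)) := by
  have := hν.prob
  have h1 : Measurable fun z : (ℝ × ℝ) × (ℝ × (ℝ × ℝ)) =>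
      evolutionKernel c z.1.1 z.2 * H (z.1.1 * z.2.1) (z.1.2 - z.2.2.2) :=
    ((measurable_evolutionKernel hν.meas).comp
      (f := fun z : (ℝ × ℝ) × (ℝ × (ℝ × ℝ)) => (z.1.1, z.2)) (by fun_prop)).mul
      (hH.comp (f := fun z : (ℝ × ℝ) × (ℝ × (ℝ × ℝ)) => (z.1.1 * z.2.1, z.1.2 - z.2.2.2))
        (by fun_prop))
  exact (StronglyMeasurable.integral_prod_right' (ν := ν.prod kernelMeasure)
    h1.stronglyMeasurable).measurable

section

variable {ν : Measure ℝ} {c : ℝ → ℂ} {t : ℝ}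

theorem measurable_evolutionKernel_right (hν : IsTimeAverage ν c) (t : ℝ) :
    Measurable (evolutionKernel c t) :=
  (measurable_evolutionKernel hν.meas).comp (measurable_const.prodMk measurable_id)

theorem lintegral_enorm_evolutionKernel_le (hν : IsTimeAverage ν c) (ht : |t| ≤ 1) :
    ∫⁻ w, ‖evolutionKernel c t w‖ₑ ∂(ν.prod kernelMeasure) ≤ ENNReal.ofReal kernelConst := by
  have := hν.prob
  rw [lintegral_prod _ (measurable_evolutionKernel_right hν t).enorm.aemeasurable]
  calc _ ≤ ∫⁻ _, ENNReal.ofReal kernelConst ∂ν := by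
        refine lintegral_mono_ae ?_
        filter_upwards [hν.mem] with σ hσ
        simp only [evolutionKernel, enorm_mul]
        rw [lintegral_const_mul' _ _ enorm_ne_top]
        have h1 : ‖c t‖ₑ ≤ 1 := by
          rw [← ofReal_norm]; exact ENNReal.ofReal_le_one.2 (hν.norm_le t ht)
        calc _ ≤ 1 * ENNReal.ofReal kernelConst := by
              gcongr; exact lintegral_enorm_smoothKernel_le (abs_sub_mul_le ht hσ)
          _ = _ := one_mul _
    _ = _ := by simp

theorem lintegral_enorm_evolutionKernel_sub_le (hν : IsTimeAverage ν c) (ht : |t| ≤ 1) (h : ℝ) :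
    ∫⁻ w, ‖evolutionKernel c t (w.1, w.2.1, w.2.2 + h) - evolutionKernel c t w‖ₑ
      ∂(ν.prod kernelMeasure) ≤ ENNReal.ofReal (kernelConst * |h| ^ (3 / 4 : ℝ)) := by
  have := hν.prob
  have hm := measurable_evolutionKernel_right hν t
  have hm2 : Measurable fun w : ℝ × (ℝ × ℝ) =>
      evolutionKernel c t (w.1, w.2.1, w.2.2 + h) - evolutionKernel c t w :=
    (hm.comp (by fun_prop)).sub hm
  rw [lintegral_prod _ hm2.enorm.aemeasurable]
  calc _ ≤ ∫⁻ _, ENNReal.ofReal (kernelConst * |h| ^ (3 / 4 : ℝ)) ∂ν := by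
        refine lintegral_mono_ae ?_
        filter_upwards [hν.mem] with σ hσ
        simp only [evolutionKernel, ← mul_sub, enorm_mul]
        rw [lintegral_const_mul' _ _ enorm_ne_top]
        have h1 : ‖c t‖ₑ ≤ 1 := by
          rw [← ofReal_norm]; exact ENNReal.ofReal_le_one.2 (hν.norm_le t ht)
        calc _ ≤ 1 * ENNReal.ofReal (kernelConst * |h| ^ (3 / 4 : ℝ)) := by
              gcongr; exact lintegral_enorm_smoothKernel_sub_le (abs_sub_mul_le ht hσ) h
          _ = _ := one_mul _
    _ = _ := by simp

theorem measurePreserving_shift (h : ℝ) (ν : Measure ℝ) [SFinite ν] :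
    MeasurePreserving (fun w : ℝ × (ℝ × ℝ) => (w.1, w.2.1, w.2.2 + h))
      (ν.prod kernelMeasure) (ν.prod kernelMeasure) :=
  (MeasurePreserving.id ν).prod
    ((MeasurePreserving.id _).prod (measurePreserving_add_right volume h))

theorem measurableEmbedding_shift (h : ℝ) :
    MeasurableEmbedding (fun w : ℝ × (ℝ × ℝ) => (w.1, w.2.1, w.2.2 + h)) :=
  MeasurableEmbedding.id.prodMap
    (MeasurableEmbedding.id.prodMap (measurableEmbedding_addRight h))

variable {H : ℝ → ℝ → ℂ} {p : ℝ≥0∞} {B : ℝ}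

/-- Minkowski's inequality for a convolution. The Hölder regularity comes entirely from the kernel;
nothing beyond an `Lᵖ` bound is asked of `H`. -/
theorem holderLp_smoothedEvolution (hν : IsTimeAverage ν c) (ht : |t| ≤ 1)
    (hH : Measurable (Function.uncurry H)) (hp : 1 ≤ p) (hpt : p ≠ ⊤)
    (hHB : ∀ τ, eLpNorm (H τ) p volume ≤ ENNReal.ofReal B) :
    HolderLp p (kernelConst * B) (smoothedEvolution ν c H t) := by
  have := hν.prob
  have hk := measurable_evolutionKernel_right hν t
  have hH' : Measurable (Function.uncurry fun (w : ℝ × (ℝ × ℝ)) (x : ℝ) =>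
      H (t * w.1) (x - w.2.2)) :=
    hH.comp (f := fun z : (ℝ × (ℝ × ℝ)) × ℝ => (t * z.1.1, z.2 - z.1.2.2)) (by fun_prop)
  have hbd : ∀ᵐ w ∂(ν.prod kernelMeasure),
      eLpNorm (fun x => H (t * w.1) (x - w.2.2)) p volume ≤ ENNReal.ofReal B :=
    ae_of_all _ fun w => by
      have hm : Measurable (H (t * w.1)) := hH.comp (measurable_const.prodMk measurable_id)
      exact (eLpNorm_comp_measurePreserving hm.aestronglyMeasurable
        (measurePreserving_sub_right volume w.2.2)).trans_le (hHB _)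
  have hB' : ENNReal.ofReal B ≠ ⊤ := ENNReal.ofReal_ne_top
  refine ⟨?_, ?_, fun h => ?_⟩
  · exact ((measurable_smoothedEvolution hν hH).comp
      (measurable_const.prodMk measurable_id)).aestronglyMeasurable
  · rw [ENNReal.ofReal_mul kernelConst_nonneg]
    exact eLpNorm_integral_mul_le hk (lintegral_enorm_evolutionKernel_le hν ht)
      ENNReal.ofReal_ne_top hH' hp hpt hbd
  · have hks : Measurable fun w : ℝ × (ℝ × ℝ) => evolutionKernel c t (w.1, w.2.1, w.2.2 + h) :=
      hk.comp (by fun_prop)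
    have hi := ae_integrable_mul_of_eLpNorm_le hk (lintegral_enorm_evolutionKernel_le hν ht)
      ENNReal.ofReal_ne_top hH' hp hpt hB' hbd
    have hksn : ∫⁻ w, ‖evolutionKernel c t (w.1, w.2.1, w.2.2 + h)‖ₑ ∂(ν.prod kernelMeasure) ≤
        ENNReal.ofReal kernelConst := by
      refine le_trans (le_of_eq ?_) (lintegral_enorm_evolutionKernel_le hν ht)
      exact (measurePreserving_shift h ν).lintegral_comp hk.enorm
    have his := ae_integrable_mul_of_eLpNorm_le hks hksn ENNReal.ofReal_ne_top hH' hp hpt hB' hbd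
    -- A change of variable moves the translation from the result onto the kernel, whose increments
    -- are small in `L¹`.
    have hae : (fun x => smoothedEvolution ν c H t (x + h) - smoothedEvolution ν c H t x)
        =ᵐ[volume] fun x => ∫ w, (evolutionKernel c t (w.1, w.2.1, w.2.2 + h) -
          evolutionKernel c t w) * H (t * w.1) (x - w.2.2) ∂(ν.prod kernelMeasure) := by
      filter_upwards [hi, his] with x hx hxs
      simp only [sub_mul]
      rw [integral_sub hxs hx]
      congr 1
      rw [smoothedEvolution, ← (measurePreserving_shift h ν).integral_comp
        (measurableEmbedding_shift h)]
      simp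
    rw [eLpNorm_congr_ae hae, mul_right_comm,
      ENNReal.ofReal_mul (mul_nonneg kernelConst_nonneg (by positivity))]
    exact eLpNorm_integral_mul_le (hks.sub hk) (lintegral_enorm_evolutionKernel_sub_le hν ht h)
      ENNReal.ofReal_ne_top hH' hp hpt hbd

theorem integrable_evolutionKernel_mul (hν : IsTimeAverage ν c) (ht : |t| ≤ 1)
    (hH : Measurable (Function.uncurry H)) (hp : 1 ≤ p)
    (hHB : ∀ τ, eLpNorm (H τ) p volume ≤ ENNReal.ofReal B) (φ : 𝓢(ℝ, ℂ)) :
    Integrable (fun z : ℝ × (ℝ × (ℝ × ℝ)) =>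
      evolutionKernel c t z.2 * H (t * z.2.1) (z.1 - z.2.2.2) * φ z.1)
      (volume.prod (ν.prod kernelMeasure)) := by
  have := hν.prob
  have hk := measurable_evolutionKernel_right hν t
  have hm : Measurable (fun z : ℝ × (ℝ × (ℝ × ℝ)) =>
      evolutionKernel c t z.2 * H (t * z.2.1) (z.1 - z.2.2.2) * φ z.1) :=
    ((hk.comp measurable_snd).mul
      (hH.comp (f := fun z : ℝ × (ℝ × (ℝ × ℝ)) => (t * z.2.1, z.1 - z.2.2.2)) (by fun_prop))).mul
      (φ.continuous.measurable.comp measurable_fst)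
  refine ⟨hm.aestronglyMeasurable, ?_⟩
  rw [HasFiniteIntegral, lintegral_prod_symm _ hm.enorm.aemeasurable]
  set K := ENNReal.ofReal B * eLpNorm φ (ENNReal.conjExponent p) volume with hK
  have hKt : K < ⊤ := ENNReal.mul_lt_top ENNReal.ofReal_lt_top (φ.eLpNorm_lt_top _ volume)
  calc _ ≤ ∫⁻ w, ‖evolutionKernel c t w‖ₑ * K ∂(ν.prod kernelMeasure) := by
        refine lintegral_mono fun w => ?_
        simp only [mul_assoc, enorm_mul]
        rw [lintegral_const_mul' _ _ enorm_ne_top]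
        gcongr
        have hm : Measurable (H (t * w.1)) := hH.comp (measurable_const.prodMk measurable_id)
        have h1 := lintegral_enorm_mul_le hp (f := fun x => H (t * w.1) (x - w.2.2)) (g := φ)
          (hm.comp (by fun_prop)).aestronglyMeasurable φ.continuous.aestronglyMeasurable
        simp only [enorm_mul] at h1
        refine h1.trans ?_
        rw [hK]
        gcongr
        exact (eLpNorm_comp_measurePreserving hm.aestronglyMeasurable
          (measurePreserving_sub_right volume w.2.2)).trans_le (hHB _)
    _ = (∫⁻ w, ‖evolutionKernel c t w‖ₑ ∂(ν.prod kernelMeasure)) * K :=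
        lintegral_mul_const' _ _ hKt.ne
    _ < ⊤ := ENNReal.mul_lt_top
        ((lintegral_enorm_evolutionKernel_le hν ht).trans_lt ENNReal.ofReal_lt_top) hKt

/-- Fubini transposes the kernel onto `φ`: convolution at `x - y` on one side becomes `x + y` on the
other. This identifies the convolution as the intended evolution in the sense of distributions. -/
theorem integral_smoothedEvolution_mul (hν : IsTimeAverage ν c) (ht : |t| ≤ 1)
    (hH : Measurable (Function.uncurry H)) (hp : 1 ≤ p)
    (hHB : ∀ τ, eLpNorm (H τ) p volume ≤ ENNReal.ofReal B) (φ : 𝓢(ℝ, ℂ)) :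
    ∫ x, smoothedEvolution ν c H t x * φ x =
      c t * ∫ σ, (∫ x, H (t * σ) x * resolvent (propagator (t - t * σ) φ) x) ∂ν := by
  have := hν.prob
  have hint := integrable_evolutionKernel_mul hν ht hH hp hHB φ
  have h1 : ∀ w : ℝ × (ℝ × ℝ), ∫ x, evolutionKernel c t w * H (t * w.1) (x - w.2.2) * φ x =
      ∫ x, c t * (H (t * w.1) x * (smoothKernel (t - t * w.1) w.2 * φ (x + w.2.2))) := by
    intro w
    rw [← integral_add_right_eq_self _ w.2.2]
    refine integral_congr_ae (ae_of_all _ fun x => ?_)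
    simp only [evolutionKernel, add_sub_cancel_right]
    ring
  have hint2 := hint.integral_prod_right
  simp only [h1] at hint2
  calc ∫ x, smoothedEvolution ν c H t x * φ x
      = ∫ x, ∫ w, evolutionKernel c t w * H (t * w.1) (x - w.2.2) * φ x
          ∂(ν.prod kernelMeasure) := by
        simp only [smoothedEvolution, integral_mul_const]
    _ = ∫ w, (∫ x, c t * (H (t * w.1) x * (smoothKernel (t - t * w.1) w.2 * φ (x + w.2.2))))
          ∂(ν.prod kernelMeasure) := by
        rw [integral_integral_swap hint]
        simp only [h1]
    _ = ∫ σ, (∫ q, (∫ x, c t * (H (t * σ) x * (smoothKernel (t - t * σ) q * φ (x + q.2))))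
          ∂kernelMeasure) ∂ν := integral_prod _ hint2
    _ = ∫ σ, (c t * ∫ x, H (t * σ) x * resolvent (propagator (t - t * σ) φ) x) ∂ν := by
        refine integral_congr_ae ?_
        filter_upwards [hν.mem] with σ hσ
        simp only [integral_const_mul]
        congr 1
        have hr := abs_sub_mul_le ht hσ
        have hm : Measurable (H (t * σ)) := hH.comp (measurable_const.prodMk measurable_id)
        have hsk : Measurable (smoothKernel (t - t * σ)) :=
          measurable_smoothKernel.comp (measurable_const.prodMk measurable_id)
        rw [integral_integral_swap]
        · simp only [integral_const_mul, resolvent_propagator_apply hr]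
        · have hmm : Measurable (Function.uncurry fun (q : ℝ × ℝ) (x : ℝ) =>
              H (t * σ) x * (smoothKernel (t - t * σ) q * φ (x + q.2))) :=
            (hm.comp measurable_snd).mul ((hsk.comp measurable_fst).mul
              (φ.continuous.measurable.comp (f := fun z : (ℝ × ℝ) × ℝ => z.2 + z.1.2)
                (by fun_prop)))
          refine ⟨hmm.aestronglyMeasurable, ?_⟩
          rw [HasFiniteIntegral, lintegral_prod _ hmm.enorm.aemeasurable]
          set K := ENNReal.ofReal B * eLpNorm φ (ENNReal.conjExponent p) volume with hK
          have hKt : K < ⊤ :=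
            ENNReal.mul_lt_top ENNReal.ofReal_lt_top (φ.eLpNorm_lt_top _ volume)
          calc _ ≤ ∫⁻ q, ‖smoothKernel (t - t * σ) q‖ₑ * K ∂kernelMeasure := by
                refine lintegral_mono fun q => ?_
                simp only [Function.uncurry, enorm_mul, mul_left_comm ‖H _ _‖ₑ]
                rw [lintegral_const_mul' _ _ enorm_ne_top]
                gcongr
                have h1 := lintegral_enorm_mul_le hp (f := H (t * σ))
                  (g := fun x => φ (x + q.2)) hm.aestronglyMeasurable
                  (φ.continuous.comp (by fun_prop)).aestronglyMeasurable
                simp only [enorm_mul] at h1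
                refine h1.trans ?_
                rw [hK]
                gcongr
                · exact hHB _
                · exact (eLpNorm_comp_measurePreserving φ.continuous.aestronglyMeasurable
                    (measurePreserving_add_right volume q.2)).le
            _ = (∫⁻ q, ‖smoothKernel (t - t * σ) q‖ₑ ∂kernelMeasure) * K :=
                lintegral_mul_const' _ _ hKt.ne
            _ < ⊤ := ENNReal.mul_lt_top
                ((lintegral_enorm_smoothKernel_le hr).trans_lt ENNReal.ofReal_lt_top) hKt
    _ = _ := integral_const_mul _ _

end

/-! ### Regularity classes -/

/-- Jointly measurable functions, continuous and bounded by `A` in space, and bounded by `A` in the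
`Lᵖ` Hölder classes with `p ∈ S`, uniformly in time. -/
structure UniformHolder (S : Set ℝ≥0∞) (A : ℝ) (f : ℝ → ℝ → ℂ) : Prop where
  meas : Measurable (Function.uncurry f)
  cont : ∀ t, Continuous (f t)
  bound : ∀ t x, ‖f t x‖ ≤ A
  holder : ∀ p ∈ S, ∀ t, HolderLp p A (f t)

/-- The first `m` space derivatives of `f` exist and lie in the class `UniformHolder S A`. -/
def Regular (S : Set ℝ≥0∞) : ℕ → ℝ → (ℝ → ℝ → ℂ) → Prop
  | 0, A, f => UniformHolder S A f
  | m + 1, A, f => UniformHolder S A f ∧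
      ∃ f', (∀ t x, HasDerivAt (f t) (f' t x) x) ∧ Regular S m A f'

/-- The first `m` weak space derivatives of `F` exist and are bounded by `A` in `Lᵖ`, `p ∈ S`. -/
def WeaklyRegular (S : Set ℝ≥0∞) : ℕ → ℝ → (ℝ → ℝ → ℂ) → Prop
  | 0, A, F => Measurable (Function.uncurry F) ∧
      ∀ p ∈ S, ∀ t, eLpNorm (F t) p volume ≤ ENNReal.ofReal A
  | m + 1, A, F => (Measurable (Function.uncurry F) ∧
      ∀ p ∈ S, ∀ t, eLpNorm (F t) p volume ≤ ENNReal.ofReal A) ∧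
      ∃ F', (∀ t, TemperedDeriv (F t) (F' t)) ∧ WeaklyRegular S m A F'

theorem WeaklyRegular.base {S : Set ℝ≥0∞} {m : ℕ} {A : ℝ} {F : ℝ → ℝ → ℂ}
    (h : WeaklyRegular S m A F) : Measurable (Function.uncurry F) ∧
      ∀ p ∈ S, ∀ t, eLpNorm (F t) p volume ≤ ENNReal.ofReal A := by
  cases m with
  | zero => exact h
  | succ m => exact h.1

theorem Regular.uniformHolder {S : Set ℝ≥0∞} {m : ℕ} {A : ℝ} {f : ℝ → ℝ → ℂ}
    (h : Regular S m A f) : UniformHolder S A f := by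
  cases m with
  | zero => exact h
  | succ m => exact h.1

/-- The exponents in `S` lie in `[2, ∞)`. -/
def Admissible (S : Set ℝ≥0∞) : Prop := S.Nonempty ∧ ∀ p ∈ S, 2 ≤ p ∧ p ≠ ⊤

theorem Regular.weaklyRegular {S : Set ℝ≥0∞} (hS : Admissible S) {m : ℕ} {A : ℝ} {f : ℝ → ℝ → ℂ}
    (h : Regular S m A f) : WeaklyRegular S m A f := by
  induction m generalizing f with
  | zero => exact ⟨h.meas, fun p hp t => (h.holder p hp t).norm⟩
  | succ m ih =>
    obtain ⟨h1, f', hd, h2⟩ := h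
    refine ⟨⟨h1.meas, fun p hp t => (h1.holder p hp t).norm⟩, f', fun t => ?_, ih h2⟩
    obtain ⟨p, hp⟩ := hS.1
    have hp1 : 1 ≤ p := le_trans (by norm_num) (hS.2 p hp).1
    have h2' := h2.uniformHolder
    exact TemperedDeriv.of_hasDerivAt hp1 (hd t)
      ((h1.holder p hp t).norm.trans_lt ENNReal.ofReal_lt_top) (h2'.cont t)
      ((h2'.holder p hp t).norm.trans_lt ENNReal.ofReal_lt_top)

/-- The constant of the smoothing estimate for the evolution. -/
def evolutionConst : ℝ := embConst * (kernelConst * 2)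

theorem evolutionConst_nonneg : 0 ≤ evolutionConst :=
  mul_nonneg (zero_le_one.trans one_le_embConst) (mul_nonneg kernelConst_nonneg zero_le_two)

/-- The representative does not depend on the exponent, so a single `p ∈ S` yields continuity and
boundedness, and almost everywhere equality carries the Hölder bounds for every other exponent. -/
theorem uniformHolder_rep {S : Set ℝ≥0∞} (hS : Admissible S) {A : ℝ} (hA : 0 ≤ A)
    {f : ℝ → ℝ → ℂ} (hm : Measurable (Function.uncurry f))
    (h : ∀ p ∈ S, ∀ t, HolderLp p A (f t)) :
    UniformHolder S (embConst * A) (fun t => rep (f t)) := by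
  obtain ⟨p, hp⟩ := hS.1
  obtain ⟨hp2, hpt⟩ := hS.2 p hp
  refine ⟨measurable_uncurry_rep hA hp2 hpt (h p hp) (measurable_integral_Ioc_of_measurable hm),
    fun t => (h p hp t).continuous_rep hA hp2 hpt,
    fun t => (h p hp t).norm_rep_le_embConst hA hp2 hpt, fun q hq t => ?_⟩
  refine ((h q hq t).congr_ae ((h p hp t).rep_ae_eq hA hp2 hpt)).mono ?_
  nlinarith [one_le_embConst]

/-- The smoothing kernel is applied to `H = (1 - ∂ₓₓ)F`. Weak integration by parts against
`resolvent (propagator _ φ)` then recovers the evolution of `F`, as `1 - ∂ₓₓ` cancels the resolvent.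
-/
theorem exists_evolution_zero {S : Set ℝ≥0∞} (hS : Admissible S) {ν : Measure ℝ} {c : ℝ → ℂ}
    (hν : IsTimeAverage ν c) {A : ℝ} (hA : 0 ≤ A) {F F₁ F₂ : ℝ → ℝ → ℂ}
    (hF : WeaklyRegular S 0 A F) (hF₂ : WeaklyRegular S 0 A F₂)
    (h₁ : ∀ t, TemperedDeriv (F t) (F₁ t)) (h₂ : ∀ t, TemperedDeriv (F₁ t) (F₂ t)) :
    ∃ W, UniformHolder S (evolutionConst * A) W ∧
      ∀ t φ, ∫ x, W t x * φ x = evolutionPairing ν c F (clamp t) φ := by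
  have hsl : ∀ {G : ℝ → ℝ → ℂ}, Measurable (Function.uncurry G) → ∀ τ,
      AEStronglyMeasurable (G τ) volume := fun hG τ =>
    (hG.comp (measurable_const.prodMk measurable_id)).aestronglyMeasurable
  set H : ℝ → ℝ → ℂ := fun τ x => F τ x - F₂ τ x with hH
  have hHm : Measurable (Function.uncurry H) := hF.1.sub hF₂.1
  have hHB : ∀ p ∈ S, ∀ τ, eLpNorm (H τ) p volume ≤ ENNReal.ofReal (2 * A) := by
    intro p hp τ
    have hp1 : 1 ≤ p := le_trans (by norm_num) (hS.2 p hp).1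
    refine (eLpNorm_sub_le (hsl hF.1 τ) (hsl hF₂.1 τ) hp1).trans ?_
    rw [two_mul, ENNReal.ofReal_add hA hA]
    exact add_le_add (hF.2 p hp τ) (hF₂.2 p hp τ)
  have hhold : ∀ p ∈ S, ∀ t, HolderLp p (kernelConst * (2 * A))
      (smoothedEvolution ν c H (clamp t)) := fun p hp t =>
    holderLp_smoothedEvolution hν (abs_clamp_le t) hHm (le_trans (by norm_num) (hS.2 p hp).1)
      (hS.2 p hp).2 (hHB p hp)
  have hmeas : Measurable (Function.uncurry fun t => smoothedEvolution ν c H (clamp t)) :=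
    (measurable_smoothedEvolution hν hHm).comp
      (f := fun z : ℝ × ℝ => (clamp z.1, z.2))
      ((measurable_clamp.comp measurable_fst).prodMk measurable_snd)
  have hA' : 0 ≤ kernelConst * (2 * A) := mul_nonneg kernelConst_nonneg (by positivity)
  refine ⟨fun t => rep (smoothedEvolution ν c H (clamp t)), ?_, fun t φ => ?_⟩
  · have := uniformHolder_rep hS hA' hmeas hhold
    rwa [show embConst * (kernelConst * (2 * A)) = evolutionConst * A by
      rw [evolutionConst]; ring] at this
  · obtain ⟨p, hp⟩ := hS.1
    obtain ⟨hp2, hpt⟩ := hS.2 p hp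
    have hp1 : 1 ≤ p := le_trans (by norm_num) hp2
    have hae := (hhold p hp t).rep_ae_eq hA' hp2 hpt
    calc ∫ x, rep (smoothedEvolution ν c H (clamp t)) x * φ x
        = ∫ x, smoothedEvolution ν c H (clamp t) x * φ x := by
          refine integral_congr_ae ?_
          filter_upwards [hae] with x hx
          rw [hx]
      _ = _ := by
          rw [integral_smoothedEvolution_mul hν (abs_clamp_le t) hHm hp1 (hHB p hp), evolutionPairing]
          congr 1
          refine integral_congr_ae (ae_of_all _ fun σ => ?_)
          have := TemperedDeriv.integral_helmholtz hp1 (hsl hF.1 (clamp t * σ))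
            ((hF.2 p hp _).trans_lt ENNReal.ofReal_lt_top) (hsl hF₂.1 (clamp t * σ))
            ((hF₂.2 p hp _).trans_lt ENNReal.ofReal_lt_top) (h₁ _) (h₂ _)
            (resolvent (propagator (clamp t - clamp t * σ) φ))
          rw [helmholtz_resolvent] at this
          exact this.symm

/-- The evolution loses two derivatives. -/
theorem exists_evolution {S : Set ℝ≥0∞} (hS : Admissible S) {ν : Measure ℝ} {c : ℝ → ℂ}
    (hν : IsTimeAverage ν c) {A : ℝ} (hA : 0 ≤ A) (m : ℕ) {F : ℝ → ℝ → ℂ}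
    (hF : WeaklyRegular S (m + 2) A F) :
    ∃ W, Regular S m (evolutionConst * A) W ∧
      ∀ t φ, ∫ x, W t x * φ x = evolutionPairing ν c F (clamp t) φ := by
  induction m generalizing F with
  | zero =>
    obtain ⟨h0, F₁, h₁, -, F₂, h₂, hF₂⟩ := hF
    exact exists_evolution_zero hS hν hA h0 hF₂ h₁ h₂
  | succ m ih =>
    obtain ⟨h0, F₁, h₁, h₃⟩ := hF
    obtain ⟨W', hW', hp'⟩ := ih h₃
    obtain ⟨-, F₂, h₂, hF₂⟩ := h₃
    obtain ⟨W, hW, hp⟩ := exists_evolution_zero hS hν hA h0 hF₂.base h₁ h₂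
    refine ⟨W, ⟨hW, W', fun t => ?_, hW'⟩, hp⟩
    -- The evolution of `F₁` is the weak derivative of the evolution of `F`; as both are continuous,
    -- it is the classical derivative.
    refine TemperedDeriv.hasDerivAt (fun χ => ?_) (hW.cont t) (hW'.uniformHolder.cont t)
    rw [hp, hp', evolutionPairing_derivCLM h₁]

/-! ### Products in the regularity classes -/

theorem eLpNorm_mul_le_ofReal {p q r : ℝ≥0∞} [ENNReal.HolderTriple p q r] {f g : ℝ → ℂ} {A B : ℝ}
    (hA : 0 ≤ A) (hf : AEStronglyMeasurable f volume) (hg : AEStronglyMeasurable g volume)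
    (hfA : eLpNorm f p volume ≤ ENNReal.ofReal A) (hgB : eLpNorm g q volume ≤ ENNReal.ofReal B) :
    eLpNorm (fun x => f x * g x) r volume ≤ ENNReal.ofReal (A * B) := by
  rw [ENNReal.ofReal_mul hA]
  exact (eLpNorm_smul_le_mul_eLpNorm (p := p) (q := q) hg hf).trans (mul_le_mul' hfA hgB)

theorem eLpNorm_top_le_ofReal {f : ℝ → ℂ} {A : ℝ} (h : ∀ x, ‖f x‖ ≤ A) :
    eLpNorm f ⊤ volume ≤ ENNReal.ofReal A := by
  rw [eLpNorm_exponent_top]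
  refine eLpNormEssSup_le_of_ae_enorm_bound (ae_of_all _ fun x => ?_)
  rw [← ofReal_norm]
  exact ENNReal.ofReal_le_ofReal (h x)

/-- From `|f|^r ≤ |f|^p A^{r-p}`: the sup bound raises the exponent of integrability at no cost in
the constant. -/
theorem eLpNorm_le_ofReal_of_bound {p r : ℝ≥0∞} (hp : 1 ≤ p) (hpr : p ≤ r) (hr : r ≠ ⊤)
    {f : ℝ → ℂ} {A : ℝ} (hf : eLpNorm f p volume ≤ ENNReal.ofReal A)
    (hb : ∀ x, ‖f x‖ ≤ A) : eLpNorm f r volume ≤ ENNReal.ofReal A := by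
  have hp0 : p ≠ 0 := (zero_lt_one.trans_le hp).ne'
  have hpt : p ≠ ⊤ := (hpr.trans_lt hr.lt_top).ne
  have hr0 : r ≠ 0 := (zero_lt_one.trans_le (hp.trans hpr)).ne'
  have hpr' : p.toReal ≤ r.toReal := ENNReal.toReal_mono hr hpr
  have hpp : 0 < p.toReal := ENNReal.toReal_pos hp0 hpt
  have hrp : 0 < r.toReal := ENNReal.toReal_pos hr0 hr
  rw [eLpNorm_eq_lintegral_rpow_enorm_toReal hr0 hr]
  rw [eLpNorm_eq_lintegral_rpow_enorm_toReal hp0 hpt] at hf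
  have h1 : ∫⁻ x, ‖f x‖ₑ ^ p.toReal ≤ ENNReal.ofReal A ^ p.toReal := by
    calc _ = ((∫⁻ x, ‖f x‖ₑ ^ p.toReal) ^ (1 / p.toReal)) ^ p.toReal := by
          rw [← ENNReal.rpow_mul, one_div_mul_cancel hpp.ne', ENNReal.rpow_one]
      _ ≤ _ := by gcongr
  have h2 : ∫⁻ x, ‖f x‖ₑ ^ r.toReal ≤ ENNReal.ofReal A ^ r.toReal := by
    calc ∫⁻ x, ‖f x‖ₑ ^ r.toReal
        ≤ ∫⁻ x, ‖f x‖ₑ ^ p.toReal * ENNReal.ofReal A ^ (r.toReal - p.toReal) := by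
          refine lintegral_mono fun x => ?_
          have : ‖f x‖ₑ ^ r.toReal = ‖f x‖ₑ ^ p.toReal * ‖f x‖ₑ ^ (r.toReal - p.toReal) := by
            rw [← ENNReal.rpow_add_of_nonneg _ _ hpp.le (by linarith)]
            congr 1; ring
          rw [this]
          have hx : ‖f x‖ₑ ≤ ENNReal.ofReal A := by
            rw [← ofReal_norm]; exact ENNReal.ofReal_le_ofReal (hb x)
          gcongr
      _ = (∫⁻ x, ‖f x‖ₑ ^ p.toReal) * ENNReal.ofReal A ^ (r.toReal - p.toReal) :=
          lintegral_mul_const' _ _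
            (ENNReal.rpow_ne_top_of_nonneg (by linarith) ENNReal.ofReal_ne_top)
      _ ≤ ENNReal.ofReal A ^ p.toReal * ENNReal.ofReal A ^ (r.toReal - p.toReal) := by gcongr
      _ = _ := by
          rw [← ENNReal.rpow_add_of_nonneg _ _ hpp.le (by linarith)]
          congr 1; ring
  calc _ ≤ (ENNReal.ofReal A ^ r.toReal) ^ (1 / r.toReal) := by gcongr
    _ = _ := by rw [← ENNReal.rpow_mul, mul_one_div_cancel hrp.ne', ENNReal.rpow_one]

theorem aestronglyMeasurable_comp_add {f : ℝ → ℂ} (hf : AEStronglyMeasurable f volume) (y : ℝ) :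
    AEStronglyMeasurable (fun x => f (x + y)) volume :=
  hf.comp_measurePreserving (measurePreserving_add_right volume y)

theorem eLpNorm_comp_add {f : ℝ → ℂ} (hf : AEStronglyMeasurable f volume) (p : ℝ≥0∞) (y : ℝ) :
    eLpNorm (fun x => f (x + y)) p volume = eLpNorm f p volume :=
  eLpNorm_comp_measurePreserving hf (measurePreserving_add_right volume y)

/-- The Leibniz rule for differences, isolated so that the three product estimates differ only in
the exponents used in Hölder's inequality. -/
theorem holderLp_mul_of {r : ℝ≥0∞} (hr : 1 ≤ r) {f g : ℝ → ℂ} {C : ℝ} (hC : 0 ≤ C)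
    (hf : AEStronglyMeasurable f volume) (hg : AEStronglyMeasurable g volume)
    (h0 : eLpNorm (fun x => f x * g x) r volume ≤ ENNReal.ofReal C)
    (h1 : ∀ y, eLpNorm (fun x => (f (x + y) - f x) * g (x + y)) r volume ≤
      ENNReal.ofReal (C * |y| ^ (3 / 4 : ℝ)))
    (h2 : ∀ y, eLpNorm (fun x => f x * (g (x + y) - g x)) r volume ≤
      ENNReal.ofReal (C * |y| ^ (3 / 4 : ℝ))) :
    HolderLp r (2 * C) (fun x => f x * g x) where
  aesm := hf.mul hg
  norm := h0.trans (ENNReal.ofReal_le_ofReal (by linarith))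
  diff y := by
    have hfy := aestronglyMeasurable_comp_add hf y
    have hgy := aestronglyMeasurable_comp_add hg y
    have e : (fun x => f (x + y) * g (x + y) - f x * g x) =
        (fun x => (f (x + y) - f x) * g (x + y)) + fun x => f x * (g (x + y) - g x) := by
      funext x; simp only [Pi.add_apply]; ring
    rw [e]
    refine (eLpNorm_add_le ((hfy.sub hf).mul hgy) (hf.mul (hgy.sub hg)) hr).trans ?_
    refine (add_le_add (h1 y) (h2 y)).trans ?_
    rw [← ENNReal.ofReal_add (by positivity) (by positivity)]
    exact ENNReal.ofReal_le_ofReal (by linarith)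

theorem HolderLp.mul {p q r : ℝ≥0∞} [ENNReal.HolderTriple p q r] (hr : 1 ≤ r) {f g : ℝ → ℂ}
    {A B : ℝ} (hA : 0 ≤ A) (hB : 0 ≤ B) (hf : HolderLp p A f) (hg : HolderLp q B g) :
    HolderLp r (2 * (A * B)) (fun x => f x * g x) := by
  refine holderLp_mul_of hr (by positivity) hf.aesm hg.aesm
    (eLpNorm_mul_le_ofReal (p := p) (q := q) hA hf.aesm hg.aesm hf.norm hg.norm)
    (fun y => ?_) (fun y => ?_)
  · have := eLpNorm_mul_le_ofReal (p := p) (q := q) (r := r) (by positivity)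
      ((aestronglyMeasurable_comp_add hf.aesm y).sub hf.aesm)
      (aestronglyMeasurable_comp_add hg.aesm y) (hf.diff y)
      ((eLpNorm_comp_add hg.aesm q y).trans_le hg.norm)
    rwa [mul_right_comm] at this
  · have := eLpNorm_mul_le_ofReal (p := p) (q := q) (r := r) hA hf.aesm
      ((aestronglyMeasurable_comp_add hg.aesm y).sub hg.aesm) hf.norm (hg.diff y)
    rwa [← mul_assoc] at this

theorem HolderLp.mul_of_bound {p : ℝ≥0∞} (hp : 1 ≤ p) {f g : ℝ → ℂ}
    {A B : ℝ} (hA : 0 ≤ A) (hB : 0 ≤ B) (hf : HolderLp p A f) (hg : HolderLp p B g)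
    (hfb : ∀ x, ‖f x‖ ≤ A) (hgb : ∀ x, ‖g x‖ ≤ B) :
    HolderLp p (2 * (A * B)) (fun x => f x * g x) := by
  refine holderLp_mul_of hp (by positivity) hf.aesm hg.aesm
    (eLpNorm_mul_le_ofReal (p := p) (q := ⊤) hA hf.aesm hg.aesm hf.norm
      (eLpNorm_top_le_ofReal hgb)) (fun y => ?_) (fun y => ?_)
  · have := eLpNorm_mul_le_ofReal (p := p) (q := ⊤) (r := p) (by positivity)
      ((aestronglyMeasurable_comp_add hf.aesm y).sub hf.aesm)
      (aestronglyMeasurable_comp_add hg.aesm y) (hf.diff y)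
      (eLpNorm_top_le_ofReal fun x => hgb (x + y))
    rwa [mul_right_comm] at this
  · have := eLpNorm_mul_le_ofReal (p := ⊤) (q := p) (r := p) hA hf.aesm
      ((aestronglyMeasurable_comp_add hg.aesm y).sub hg.aesm) (eLpNorm_top_le_ofReal hfb)
      (hg.diff y)
    rwa [← mul_assoc] at this

theorem HolderLp.add {p : ℝ≥0∞} (hp : 1 ≤ p) {f g : ℝ → ℂ} {A B : ℝ} (hA : 0 ≤ A) (hB : 0 ≤ B)
    (hf : HolderLp p A f) (hg : HolderLp p B g) : HolderLp p (A + B) (fun x => f x + g x) where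
  aesm := hf.aesm.add hg.aesm
  norm := by
    refine (eLpNorm_add_le hf.aesm hg.aesm hp).trans ?_
    rw [ENNReal.ofReal_add hA hB]
    exact add_le_add hf.norm hg.norm
  diff y := by
    have e : (fun x => f (x + y) + g (x + y) - (f x + g x)) =
        (fun x => f (x + y) - f x) + fun x => g (x + y) - g x := by
      funext x; simp only [Pi.add_apply]; ring
    rw [e, add_mul, ENNReal.ofReal_add (by positivity) (by positivity)]
    exact (eLpNorm_add_le ((aestronglyMeasurable_comp_add hf.aesm y).sub hf.aesm)
      ((aestronglyMeasurable_comp_add hg.aesm y).sub hg.aesm) hp).trans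
      (add_le_add (hf.diff y) (hg.diff y))

theorem HolderLp.conj {p : ℝ≥0∞} {f : ℝ → ℂ} {A : ℝ} (hf : HolderLp p A f) :
    HolderLp p A (fun x => (starRingEnd ℂ) (f x)) where
  aesm := Complex.continuous_conj.comp_aestronglyMeasurable hf.aesm
  norm := by
    rw [eLpNorm_congr_norm_ae (g := f) (ae_of_all _ fun x => by simp)]
    exact hf.norm
  diff y := by
    rw [eLpNorm_congr_norm_ae (g := fun x => f (x + y) - f x)
      (ae_of_all _ fun x => by rw [← map_sub, RCLike.norm_conj])]
    exact hf.diff y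

namespace UniformHolder

variable {S : Set ℝ≥0∞} {A B : ℝ} {f g : ℝ → ℝ → ℂ}

theorem mono (h : UniformHolder S A f) (hAB : A ≤ B) : UniformHolder S B f :=
  ⟨h.meas, h.cont, fun t x => (h.bound t x).trans hAB, fun p hp t => (h.holder p hp t).mono hAB⟩

theorem subset {S' : Set ℝ≥0∞} (h : UniformHolder S A f) (hS : S' ⊆ S) : UniformHolder S' A f :=
  ⟨h.meas, h.cont, h.bound, fun p hp => h.holder p (hS hp)⟩

theorem nonneg (h : UniformHolder S A f) : 0 ≤ A := (norm_nonneg _).trans (h.bound 0 0)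

theorem add (hS : Admissible S) (hf : UniformHolder S A f) (hg : UniformHolder S B g) :
    UniformHolder S (A + B) (fun t x => f t x + g t x) where
  meas := hf.meas.add hg.meas
  cont t := (hf.cont t).add (hg.cont t)
  bound t x := (norm_add_le _ _).trans (add_le_add (hf.bound t x) (hg.bound t x))
  holder p hp t := (hf.holder p hp t).add (le_trans (by norm_num) (hS.2 p hp).1) hf.nonneg hg.nonneg
    (hg.holder p hp t)

theorem conj (hf : UniformHolder S A f) :
    UniformHolder S A (fun t x => (starRingEnd ℂ) (f t x)) where
  meas := Complex.continuous_conj.measurable.comp hf.meas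
  cont t := Complex.continuous_conj.comp (hf.cont t)
  bound t x := by rw [RCLike.norm_conj]; exact hf.bound t x
  holder p hp t := (hf.holder p hp t).conj

theorem norm_mul_le (hf : UniformHolder S A f) {S' : Set ℝ≥0∞} (hg : UniformHolder S' B g)
    (t x : ℝ) : ‖f t x * g t x‖ ≤ 2 * (A * B) := by
  have h1 := hf.nonneg
  have h2 := hg.nonneg
  rw [norm_mul]
  calc ‖f t x‖ * ‖g t x‖ ≤ A * B := by gcongr; exacts [hf.bound t x, hg.bound t x]
    _ ≤ _ := by nlinarith [mul_nonneg h1 h2]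

end UniformHolder

/-- The exponents `N` and `N / k`. -/
def exponents (N k : ℕ) : Set ℝ≥0∞ := {(N : ℝ≥0∞), (N : ℝ≥0∞) / k}

theorem two_le_div {N k : ℕ} (hk : 1 ≤ k) (h : 2 * k ≤ N) :
    (2 : ℝ≥0∞) ≤ (N : ℝ≥0∞) / k := by
  rw [ENNReal.le_div_iff_mul_le (Or.inl (Nat.cast_ne_zero.2 (by omega)))
    (Or.inl (ENNReal.natCast_ne_top k))]
  exact_mod_cast h

theorem admissible_exponents {N k : ℕ} (hk : 1 ≤ k) (h : 2 * k ≤ N) :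
    Admissible (exponents N k) := by
  refine ⟨⟨_, mem_insert _ _⟩, fun p hp => ?_⟩
  rcases hp with rfl | rfl
  · have h2 : 2 ≤ N := by omega
    exact ⟨by exact_mod_cast h2, ENNReal.natCast_ne_top N⟩
  · refine ⟨two_le_div hk h, ENNReal.div_ne_top (ENNReal.natCast_ne_top N) ?_⟩
    exact Nat.cast_ne_zero.2 (by omega)

/-- The reciprocal exponents are `k/N` and `l/N`. Writing exponents as `N / k` turns Hölder's
inequality into addition of integers. -/
theorem holderTriple_div (N k l : ℕ) :
    ENNReal.HolderTriple ((N : ℝ≥0∞) / k) (N / l) (N / (k + l : ℕ)) := by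
  refine ⟨?_⟩
  by_cases hN : N = 0
  · subst hN
    simp
  have h0 : (N : ℝ≥0∞) ≠ 0 := by exact_mod_cast hN
  rw [ENNReal.inv_div (Or.inr (ENNReal.natCast_ne_top N)) (Or.inr h0),
    ENNReal.inv_div (Or.inr (ENNReal.natCast_ne_top N)) (Or.inr h0),
    ENNReal.inv_div (Or.inr (ENNReal.natCast_ne_top N)) (Or.inr h0), ENNReal.div_add_div_same]
  push_cast
  rfl

/-- At the exponent `N` the sup bounds are used, at `N / (k + l)` Hölder's inequality. The condition
`2 (k + l) ≤ N` keeps every exponent at least `2`, as the embedding into bounded functions requires.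
-/
theorem UniformHolder.mul {N k l : ℕ} (hN : 2 * (k + l) ≤ N) (hk : 1 ≤ k) {A B : ℝ}
    {f g : ℝ → ℝ → ℂ} (hf : UniformHolder (exponents N k) A f)
    (hg : UniformHolder (exponents N l) B g) :
    UniformHolder (exponents N (k + l)) (2 * (A * B)) (fun t x => f t x * g t x) where
  meas := hf.meas.mul hg.meas
  cont t := (hf.cont t).mul (hg.cont t)
  bound := hf.norm_mul_le hg
  holder p hp t := by
    have hN1 : (1 : ℝ≥0∞) ≤ N := by exact_mod_cast (by omega : 1 ≤ N)
    rcases hp with rfl | rfl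
    · exact (hf.holder _ (mem_insert _ _) t).mul_of_bound hN1 hf.nonneg hg.nonneg
        (hg.holder _ (mem_insert _ _) t) (hf.bound t) (hg.bound t)
    · have := holderTriple_div N k l
      exact (hf.holder _ (mem_insert_of_mem _ rfl) t).mul
        (le_trans (by norm_num) (two_le_div (by omega) hN)) hf.nonneg hg.nonneg
        (hg.holder _ (mem_insert_of_mem _ rfl) t)

namespace Regular

variable {S : Set ℝ≥0∞} {m : ℕ} {A B : ℝ} {f g : ℝ → ℝ → ℂ}

theorem mono (h : Regular S m A f) (hAB : A ≤ B) : Regular S m B f := by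
  induction m generalizing f with
  | zero => exact UniformHolder.mono h hAB
  | succ m ih =>
    obtain ⟨h1, f', hd, h2⟩ := h
    exact ⟨h1.mono hAB, f', hd, ih h2⟩

theorem subset {S' : Set ℝ≥0∞} (h : Regular S m A f) (hS : S' ⊆ S) : Regular S' m A f := by
  induction m generalizing f with
  | zero => exact UniformHolder.subset h hS
  | succ m ih =>
    obtain ⟨h1, f', hd, h2⟩ := h
    exact ⟨h1.subset hS, f', hd, ih h2⟩

theorem of_succ (h : Regular S (m + 1) A f) : Regular S m A f := by
  induction m generalizing f with
  | zero => exact h.1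
  | succ m ih =>
    obtain ⟨h1, f', hd, h2⟩ := h
    exact ⟨h1, f', hd, ih h2⟩

theorem of_le {m' : ℕ} (h : Regular S m A f) (hm : m' ≤ m) : Regular S m' A f := by
  induction m with
  | zero => obtain rfl : m' = 0 := by omega
            exact h
  | succ m ih =>
    rcases hm.lt_or_eq with h1 | rfl
    · exact ih h.of_succ (by omega)
    · exact h

theorem nonneg (h : Regular S m A f) : 0 ≤ A := h.uniformHolder.nonneg

theorem add (hS : Admissible S) (hf : Regular S m A f) (hg : Regular S m B g) :
    Regular S m (A + B) (fun t x => f t x + g t x) := by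
  induction m generalizing f g with
  | zero => exact UniformHolder.add hS hf hg
  | succ m ih =>
    obtain ⟨h1, f', hd, h2⟩ := hf
    obtain ⟨k1, g', ke, k2⟩ := hg
    exact ⟨h1.add hS k1, _, fun t x => (hd t x).add (ke t x), ih h2 k2⟩

theorem conj (hf : Regular S m A f) : Regular S m A (fun t x => (starRingEnd ℂ) (f t x)) := by
  induction m generalizing f with
  | zero => exact UniformHolder.conj hf
  | succ m ih =>
    obtain ⟨h1, f', hd, h2⟩ := hf
    refine ⟨h1.conj, _, fun t x => ?_, ih h2⟩
    exact (hd t x).star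

/-- The Leibniz rule has two terms, so the constant doubles with each derivative. -/
theorem mul {N k l : ℕ} (hN : 2 * (k + l) ≤ N) (hk : 1 ≤ k)
    (hf : Regular (exponents N k) m A f) (hg : Regular (exponents N l) m B g) :
    Regular (exponents N (k + l)) m (2 ^ (m + 1) * (A * B)) (fun t x => f t x * g t x) := by
  have hAB : 0 ≤ A * B := mul_nonneg hf.nonneg hg.nonneg
  induction m generalizing f g with
  | zero => simpa using! UniformHolder.mul hN hk hf hg
  | succ m ih =>
    have hf0 := hf.of_succ
    have hg0 := hg.of_succ
    obtain ⟨h1, f', hd, h2⟩ := hf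
    obtain ⟨k1, g', ke, k2⟩ := hg
    refine ⟨(h1.mul hN hk k1).mono ?_, _, fun t x => (hd t x).mul (ke t x), ?_⟩
    · have : (2 : ℝ) ≤ 2 ^ (m + 1 + 1) := by
        calc (2 : ℝ) = 2 ^ 1 := (pow_one 2).symm
          _ ≤ _ := pow_le_pow_right₀ (by norm_num) (by omega)
      gcongr
    · have := (ih h2 hg0).add (admissible_exponents (by omega) hN) (ih hf0 k2)
      refine this.mono (le_of_eq ?_)
      ring

end Regular

theorem cubic_eq (z : ℂ) : cubic z = z * z * (starRingEnd ℂ) z := by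
  rw [cubic, ← Complex.conj_mul', mul_comm, mul_comm ((starRingEnd ℂ) z), mul_assoc]

/-- Each summand is trilinear with exactly one factor `a - b`, so the difference of the
nonlinearities inherits the better integrability of `a - b`. -/
theorem cubic_sub_cubic (a b : ℂ) : cubic a - cubic b =
    (a - b) * a * (starRingEnd ℂ) a + b * (a - b) * (starRingEnd ℂ) a +
      b * b * (starRingEnd ℂ) (a - b) := by
  rw [cubic_eq, cubic_eq, map_sub]
  ring

/-- The difference of the nonlinearities inherits the integrability of the difference. -/
theorem Regular.cubic_sub_cubic {N k m : ℕ} (hN : 2 * (k + 2) ≤ N) (hk : 1 ≤ k) {A B : ℝ}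
    {a b : ℝ → ℝ → ℂ} (hab : Regular (exponents N k) m A (fun t x => a t x - b t x))
    (ha : Regular (exponents N 1) m B a) (hb : Regular (exponents N 1) m B b) :
    Regular (exponents N (k + 2)) m (3 * (2 ^ (m + 1)) ^ 2 * (A * B ^ 2))
      (fun t x => cubic (a t x) - cubic (b t x)) := by
  have hS := admissible_exponents (N := N) (k := k + 2) (by omega) hN
  have h1 := (hab.mul (by omega) hk ha).mul (by omega) (by omega) ha.conj
  have h2 := (hb.mul (by omega) le_rfl hab).mul (by omega) (by omega) ha.conj
  have h3 := (hb.mul (by omega) le_rfl hb).mul (by omega) (by omega) hab.conj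
  rw [show k + 1 + 1 = k + 2 by ring] at h1
  rw [show 1 + k + 1 = k + 2 by ring] at h2
  rw [show 1 + 1 + k = k + 2 by ring] at h3
  have h := (h1.add hS h2).add hS h3
  simp only [← CubicNLS.cubic_sub_cubic] at h
  exact h.mono (le_of_eq (by ring))

/-! ### Duality in `L²` -/

theorem denseRange_toL2 :
    DenseRange (SchwartzMap.toLpCLM ℂ ℂ 2 volume : 𝓢(ℝ, ℂ) → Lp ℂ 2 (volume : Measure ℝ)) :=
  SchwartzMap.denseRange_toLpCLM (E := ℝ) (F := ℂ) (p := 2) (μ := volume) (by norm_num)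

theorem inner_toLp_schwartz (V : Lp ℂ 2 (volume : Measure ℝ)) (φ : 𝓢(ℝ, ℂ)) :
    inner ℂ V (φ.toLp 2) = ∫ x, (starRingEnd ℂ) (V x) * φ x := by
  rw [L2.inner_def]
  refine integral_congr_ae ?_
  filter_upwards [φ.coeFn_toLp 2 volume] with x hx
  rw [hx, RCLike.inner_apply, mul_comm]

theorem norm_le_of_inner_schwartz {V : Lp ℂ 2 (volume : Measure ℝ)} {B : ℝ} (hB : 0 ≤ B)
    (h : ∀ φ : 𝓢(ℝ, ℂ), ‖inner ℂ V (φ.toLp 2)‖ ≤ B * ‖φ.toLp 2 volume‖) : ‖V‖ ≤ B := by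
  have h1 : ∀ g : Lp ℂ 2 (volume : Measure ℝ), ‖inner ℂ V g‖ ≤ B * ‖g‖ := by
    intro g
    refine denseRange_toL2.induction_on (p := fun g => ‖inner ℂ V g‖ ≤ B * ‖g‖) g ?_ h
    exact isClosed_le (by fun_prop) (by fun_prop)
  have h2 := h1 V
  rw [inner_self_eq_norm_sq_to_K, norm_pow, RCLike.norm_ofReal, abs_norm, sq] at h2
  rcases (norm_nonneg V).eq_or_lt with h3 | h3
  · rwa [← h3]
  · exact le_of_mul_le_mul_right h2 h3

theorem eLpNorm_le_of_pairing {f : ℝ → ℂ} (hf : MemLp f 2 volume) {B : ℝ} (hB : 0 ≤ B)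
    (h : ∀ φ : 𝓢(ℝ, ℂ), ‖∫ x, f x * φ x‖ ≤ B * ‖φ.toLp 2 volume‖) :
    eLpNorm f 2 volume ≤ ENNReal.ofReal B := by
  have hc : MemLp (fun x => (starRingEnd ℂ) (f x)) 2 volume := hf.star
  have h1 : ‖hc.toLp‖ ≤ B := by
    refine norm_le_of_inner_schwartz hB fun φ => ?_
    rw [inner_toLp_schwartz]
    refine le_trans (le_of_eq ?_) (h φ)
    congr 1
    refine integral_congr_ae ?_
    filter_upwards [hc.coeFn_toLp] with x hx
    rw [hx, Complex.conj_conj]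
  have h2 : eLpNorm (fun x => (starRingEnd ℂ) (f x)) 2 volume = eLpNorm f 2 volume :=
    eLpNorm_congr_norm_ae (ae_of_all _ fun x => by simp)
  rw [Lp.norm_toLp, h2] at h1
  exact (ENNReal.le_ofReal_iff_toReal_le hf.2.ne hB).2 h1

/-- Riesz representation after extension from the dense Schwartz functions. The `L²` evolution is
built this way, from its pairings alone, since unitarity makes them bounded. -/
theorem exists_inner_eq (ℓ : 𝓢(ℝ, ℂ) →ₗ[ℂ] ℂ) {B : ℝ}
    (h : ∀ φ, ‖ℓ φ‖ ≤ B * ‖φ.toLp 2 volume‖) :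
    ∃ V : Lp ℂ 2 (volume : Measure ℝ), ∀ φ : 𝓢(ℝ, ℂ), inner ℂ V (φ.toLp 2) = ℓ φ := by
  refine ⟨(InnerProductSpace.toDual ℂ _).symm
    (ℓ.extendOfNorm (SchwartzMap.toLpCLM ℂ ℂ 2 volume).toLinearMap), fun φ => ?_⟩
  rw [InnerProductSpace.toDual_symm_apply]
  exact LinearMap.extendOfNorm_eq denseRange_toL2 ⟨B, h⟩ φ

theorem norm_integral_mul_schwartz_le {f : ℝ → ℂ} (hf : AEStronglyMeasurable f volume) {B : ℝ}
    (hB : 0 ≤ B) (h : eLpNorm f 2 volume ≤ ENNReal.ofReal B) (φ : 𝓢(ℝ, ℂ)) :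
    ‖∫ x, f x * φ x‖ ≤ B * ‖φ.toLp 2 volume‖ := by
  have h1 := lintegral_enorm_mul_le (p := 2) (by norm_num) hf φ.continuous.aestronglyMeasurable
  have h2 : ENNReal.conjExponent 2 = 2 := by
    have h3 : (2 : ℝ≥0∞) - 1 = 1 := by
      rw [← one_add_one_eq_two]; exact ENNReal.add_sub_cancel_right ENNReal.one_ne_top
    rw [ENNReal.conjExponent, h3, inv_one, one_add_one_eq_two]
  rw [h2, eLpNorm_schwartz_eq_norm] at h1
  have h3 : ‖∫ x, f x * φ x‖ₑ ≤ ENNReal.ofReal (B * ‖φ.toLp 2 volume‖) := by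
    rw [ENNReal.ofReal_mul hB, ofReal_norm]
    refine (enorm_integral_le_lintegral_enorm _).trans (h1.trans ?_)
    gcongr
  rwa [← ofReal_norm, ENNReal.ofReal_le_ofReal_iff (by positivity)] at h3

theorem norm_toLp_propagator (t : ℝ) (φ : 𝓢(ℝ, ℂ)) :
    ‖(propagator t φ).toLp 2 volume‖ = ‖φ.toLp 2 volume‖ := by
  rw [SchwartzMap.norm_toLp, SchwartzMap.norm_toLp, eLpNorm_propagator]

/-! ### The evolution in `L²` -/

section

variable {ν : Measure ℝ} {c : ℝ → ℂ} {F G : ℝ → ℝ → ℂ} {B : ℝ} {t : ℝ}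

theorem aestronglyMeasurable_slice (hF : Measurable (Function.uncurry F)) (t : ℝ) :
    AEStronglyMeasurable (F t) volume :=
  (hF.comp (measurable_const.prodMk measurable_id)).aestronglyMeasurable

theorem measurable_inner_pairing (hF : Measurable (Function.uncurry F)) (φ : 𝓢(ℝ, ℂ)) :
    Measurable fun z : ℝ × ℝ => ∫ x, F (z.1 * z.2) x * propagator (z.1 - z.1 * z.2) φ x := by
  have h : Measurable fun w : (ℝ × ℝ) × ℝ =>
      F (w.1.1 * w.1.2) w.2 * propagator (w.1.1 - w.1.1 * w.1.2) φ w.2 :=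
    (hF.comp (f := fun w : (ℝ × ℝ) × ℝ => (w.1.1 * w.1.2, w.2)) (by fun_prop)).mul
      ((continuous_propagator φ).measurable.comp
        (f := fun w : (ℝ × ℝ) × ℝ => (w.1.1 - w.1.1 * w.1.2, w.2)) (by fun_prop))
  exact (StronglyMeasurable.integral_prod_right' (ν := volume) h.stronglyMeasurable).measurable

theorem measurable_evolutionPairing (hν : IsTimeAverage ν c)
    (hF : Measurable (Function.uncurry F)) (φ : 𝓢(ℝ, ℂ)) :
    Measurable fun t => evolutionPairing ν c F t φ := by
  have := hν.prob
  exact hν.meas.mul (StronglyMeasurable.integral_prod_right' (ν := ν)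
    (measurable_inner_pairing hF φ).stronglyMeasurable).measurable

theorem norm_inner_pairing_le (hF : Measurable (Function.uncurry F)) (hB : 0 ≤ B)
    (hFB : ∀ τ, eLpNorm (F τ) 2 volume ≤ ENNReal.ofReal B) (t s : ℝ) (φ : 𝓢(ℝ, ℂ)) :
    ‖∫ x, F t x * propagator s φ x‖ ≤ B * ‖φ.toLp 2 volume‖ := by
  rw [← norm_toLp_propagator s]
  exact norm_integral_mul_schwartz_le (aestronglyMeasurable_slice hF t) hB (hFB t) _

theorem integrable_inner_pairing (hν : IsTimeAverage ν c) (hF : Measurable (Function.uncurry F))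
    (hB : 0 ≤ B) (hFB : ∀ τ, eLpNorm (F τ) 2 volume ≤ ENNReal.ofReal B) (t : ℝ) (φ : 𝓢(ℝ, ℂ)) :
    Integrable (fun σ => ∫ x, F (t * σ) x * propagator (t - t * σ) φ x) ν := by
  have := hν.prob
  refine Integrable.of_bound ?_ (B * ‖φ.toLp 2 volume‖)
    (ae_of_all _ fun σ => norm_inner_pairing_le hF hB hFB _ _ φ)
  exact ((measurable_inner_pairing hF φ).comp
    (measurable_const.prodMk measurable_id)).aestronglyMeasurable

theorem norm_evolutionPairing_le (hν : IsTimeAverage ν c) (ht : |t| ≤ 1)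
    (hF : Measurable (Function.uncurry F)) (hB : 0 ≤ B)
    (hFB : ∀ τ, eLpNorm (F τ) 2 volume ≤ ENNReal.ofReal B) (φ : 𝓢(ℝ, ℂ)) :
    ‖evolutionPairing ν c F t φ‖ ≤ B * ‖φ.toLp 2 volume‖ := by
  have := hν.prob
  have h1 : ‖∫ σ, (∫ x, F (t * σ) x * propagator (t - t * σ) φ x) ∂ν‖ ≤
      B * ‖φ.toLp 2 volume‖ := by
    refine (norm_integral_le_of_norm_le_const
      (ae_of_all _ fun σ => norm_inner_pairing_le hF hB hFB _ _ φ)).trans ?_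
    simp
  rw [evolutionPairing, norm_mul]
  calc _ ≤ 1 * (B * ‖φ.toLp 2 volume‖) := by gcongr; exact hν.norm_le t ht
    _ = _ := one_mul _

theorem evolutionPairing_add_schwartz (hν : IsTimeAverage ν c)
    (hF : Measurable (Function.uncurry F)) (hB : 0 ≤ B)
    (hFB : ∀ τ, eLpNorm (F τ) 2 volume ≤ ENNReal.ofReal B) (t : ℝ) (φ ψ : 𝓢(ℝ, ℂ)) :
    evolutionPairing ν c F t (φ + ψ) = evolutionPairing ν c F t φ + evolutionPairing ν c F t ψ := by
  rw [evolutionPairing, evolutionPairing, evolutionPairing, ← mul_add,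
    ← integral_add (integrable_inner_pairing hν hF hB hFB t φ)
      (integrable_inner_pairing hν hF hB hFB t ψ)]
  congr 1
  refine integral_congr_ae (ae_of_all _ fun σ => ?_)
  have hi := fun χ => integrable_mul_schwartz (p := 2) (by norm_num)
    (aestronglyMeasurable_slice hF (t * σ)) ((hFB _).trans_lt ENNReal.ofReal_lt_top) χ
  simp only [map_add, _root_.add_apply, mul_add]
  exact integral_add (hi _) (hi _)

theorem evolutionPairing_smul_schwartz (a : ℂ) (φ : 𝓢(ℝ, ℂ)) :
    evolutionPairing ν c F t (a • φ) = a * evolutionPairing ν c F t φ := by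
  simp only [evolutionPairing, map_smul, _root_.smul_apply, smul_eq_mul, mul_left_comm _ a,
    integral_const_mul]

theorem evolutionPairing_sub (hν : IsTimeAverage ν c)
    (hF : Measurable (Function.uncurry F)) (hB : 0 ≤ B)
    (hFB : ∀ τ, eLpNorm (F τ) 2 volume ≤ ENNReal.ofReal B)
    (hG : Measurable (Function.uncurry G))
    (hGB : ∀ τ, eLpNorm (G τ) 2 volume ≤ ENNReal.ofReal B) (t : ℝ) (φ : 𝓢(ℝ, ℂ)) :
    evolutionPairing ν c (fun τ x => F τ x - G τ x) t φ =
      evolutionPairing ν c F t φ - evolutionPairing ν c G t φ := by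
  rw [evolutionPairing, evolutionPairing, evolutionPairing, ← mul_sub,
    ← integral_sub (integrable_inner_pairing hν hF hB hFB t φ)
      (integrable_inner_pairing hν hG hB hGB t φ)]
  congr 1
  refine integral_congr_ae (ae_of_all _ fun σ => ?_)
  have hi := integrable_mul_schwartz (p := 2) (by norm_num)
    (aestronglyMeasurable_slice hF (t * σ)) ((hFB _).trans_lt ENNReal.ofReal_lt_top)
  have hi' := integrable_mul_schwartz (p := 2) (by norm_num)
    (aestronglyMeasurable_slice hG (t * σ)) ((hGB _).trans_lt ENNReal.ofReal_lt_top)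
  simp only [sub_mul]
  exact integral_sub (hi _) (hi' _)

theorem evolutionPairing_compSubConst (y : ℝ) (φ : 𝓢(ℝ, ℂ)) :
    evolutionPairing ν c F t (φ.compSubConstCLM ℂ y) =
      evolutionPairing ν c (fun τ x => F τ (x + y)) t φ := by
  rw [evolutionPairing, evolutionPairing]
  congr 1
  refine integral_congr_ae (ae_of_all _ fun σ => ?_)
  simp only [propagator_compSubConst]
  rw [← integral_add_right_eq_self _ y]
  simp only [add_sub_cancel_right]

/-- The evolution maps the `L²` Hölder class into itself. -/
theorem exists_evolution_holderLp (hν : IsTimeAverage ν c) (hF : Measurable (Function.uncurry F))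
    (hB : 0 ≤ B) (h : ∀ τ, HolderLp 2 B (F τ)) :
    ∃ w : ℝ → ℝ → ℂ, (∀ t, HolderLp 2 B (w t)) ∧
      (∀ x r : ℝ, Measurable fun t => ∫ y in x..x + r, w t y) ∧
      ∀ t φ, ∫ x, w t x * φ x = evolutionPairing ν c F (clamp t) φ := by
  have hFB : ∀ τ, eLpNorm (F τ) 2 volume ≤ ENNReal.ofReal B := fun τ => (h τ).norm
  have hbd := fun t => norm_evolutionPairing_le hν (abs_clamp_le t) hF hB hFB
  have hex : ∀ t, ∃ V : Lp ℂ 2 (volume : Measure ℝ), ∀ φ : 𝓢(ℝ, ℂ),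
      inner ℂ V (φ.toLp 2) = evolutionPairing ν c F (clamp t) φ := fun t =>
    exists_inner_eq
      { toFun := evolutionPairing ν c F (clamp t)
        map_add' := evolutionPairing_add_schwartz hν hF hB hFB _
        map_smul' := evolutionPairing_smul_schwartz } (hbd t)
  choose V hV using hex
  have hp : ∀ t (φ : 𝓢(ℝ, ℂ)), ∫ x, (starRingEnd ℂ) (V t x) * φ x =
      evolutionPairing ν c F (clamp t) φ := fun t φ => by
    rw [← inner_toLp_schwartz, hV]
  have hmem : ∀ t, MemLp (fun x => (starRingEnd ℂ) (V t x)) 2 volume := fun t =>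
    (Lp.memLp (V t)).star
  -- The inner product is conjugate-linear in its first slot while the pairing is bilinear, hence
  -- the conjugate.
  refine ⟨fun t x => (starRingEnd ℂ) (V t x), fun t => ⟨(hmem t).1, ?_, fun y => ?_⟩, ?_, hp⟩
  · exact eLpNorm_le_of_pairing (hmem t) hB fun φ => by rw [hp]; exact hbd t φ
  · have hmem' : MemLp (fun x => (starRingEnd ℂ) (V t (x + y))) 2 volume :=
      (hmem t).comp_measurePreserving (measurePreserving_add_right volume y)
    refine eLpNorm_le_of_pairing (hmem'.sub (hmem t)) (by positivity) fun φ => ?_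
    have hFy : Measurable (Function.uncurry fun τ x => F τ (x + y)) :=
      hF.comp (f := fun z : ℝ × ℝ => (z.1, z.2 + y)) (by fun_prop)
    have hFyB : ∀ τ, eLpNorm (fun x => F τ (x + y)) 2 volume ≤ ENNReal.ofReal B := fun τ =>
      (eLpNorm_comp_measurePreserving (aestronglyMeasurable_slice hF τ)
        (measurePreserving_add_right volume y)).trans_le (hFB τ)
    -- The increment of the evolution is the evolution of the increment, so the Hölder seminorm is
    -- bounded exactly as the norm is.
    have h1 : ∫ x, ((starRingEnd ℂ) (V t (x + y)) - (starRingEnd ℂ) (V t x)) * φ x =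
        evolutionPairing ν c (fun τ x => F τ (x + y) - F τ x) (clamp t) φ := by
      rw [evolutionPairing_sub hν hFy hB hFyB hF hFB, ← evolutionPairing_compSubConst, ← hp, ← hp]
      simp only [sub_mul]
      rw [integral_sub (integrable_mul_schwartz (p := 2) (by norm_num) hmem'.1 hmem'.2 φ)
        (integrable_mul_schwartz (p := 2) (by norm_num) (hmem t).1 (hmem t).2 φ)]
      congr 1
      rw [← integral_add_right_eq_self (fun x => _ * (φ.compSubConstCLM ℂ y) x) y]
      simp
    simp only [Pi.sub_apply]
    rw [h1]
    exact norm_evolutionPairing_le hν (abs_clamp_le t)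
      (F := fun τ x => F τ (x + y) - F τ x) (hFy.sub hF) (by positivity)
      (fun τ => (h τ).diff y) φ
  -- Weak measurability in time, by density from Schwartz functions to all of `L²`; testing against
  -- indicators of intervals then yields the interval integrals.
  · have hinner : ∀ g : Lp ℂ 2 (volume : Measure ℝ), Measurable fun t => inner ℂ (V t) g := by
      intro g
      obtain ⟨u, hu, hug⟩ := mem_closure_iff_seq_limit.1 (denseRange_toL2 g)
      choose φ hφ using hu
      refine measurable_of_tendsto_metrizable (f := fun k t => inner ℂ (V t) (u k))
        (fun k => ?_) (tendsto_pi_nhds.2 fun t => ?_)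
      · have : (fun t => inner ℂ (V t) (u k)) =
            fun t => evolutionPairing ν c F (clamp t) (φ k) := by
          funext t
          rw [← hV, ← hφ k]
          rfl
        rw [this]
        exact (measurable_evolutionPairing hν hF (φ k)).comp measurable_clamp
      · exact tendsto_const_nhds.inner hug
    have hset : ∀ a b : ℝ, Measurable fun t => ∫ y in Ioc a b, (starRingEnd ℂ) (V t y) := by
      intro a b
      convert hinner (indicatorConstLp 2 (measurableSet_Ioc (a := a) (b := b))
        (measure_Ioc_lt_top.ne) (1 : ℂ)) using 2 with t
      rw [← inner_conj_symm, L2.inner_indicatorConstLp_one, integral_conj]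
    intro x r
    exact (hset x (x + r)).sub (hset (x + r) x)

theorem exists_evolution_L2 (hν : IsTimeAverage ν c) (hF : Measurable (Function.uncurry F))
    (hB : 0 ≤ B) (h : ∀ τ, HolderLp 2 B (F τ)) :
    ∃ w : ℝ → ℝ → ℂ, UniformHolder {2} (embConst * B) w ∧ (∀ t, HolderLp 2 B (w t)) ∧
      ∀ t φ, ∫ x, w t x * φ x = evolutionPairing ν c F (clamp t) φ := by
  obtain ⟨w, hw, hm, hp⟩ := exists_evolution_holderLp hν hF hB h
  have hae : ∀ t, rep (w t) =ᵐ[volume] w t := fun t =>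
    (hw t).rep_ae_eq hB le_rfl (by norm_num)
  have hr : ∀ t, HolderLp 2 B (rep (w t)) := fun t => (hw t).congr_ae (hae t)
  refine ⟨fun t => rep (w t), ⟨measurable_uncurry_rep hB le_rfl (by norm_num) hw hm,
    fun t => (hw t).continuous_rep hB le_rfl (by norm_num),
    fun t => (hw t).norm_rep_le_embConst hB le_rfl (by norm_num), ?_⟩, hr, fun t φ => ?_⟩
  · rintro p rfl t
    exact (hr t).mono (by nlinarith [one_le_embConst])
  · rw [← hp]
    refine integral_congr_ae ?_
    filter_upwards [hae t] with x hx
    rw [hx]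

end

/-! ### Multipliers of the `L²` Hölder class -/

/-- The dangerous term is the increment of `f` times `g`, as `f` is Hölder only in `L^q`. But `g`
lies in `L² ∩ L^∞`, hence in `L^r` with `1/r = 1/2 - 1/q`, possibly `r = ∞`. So `L^q` Hölder
functions that are bounded act on the `L²` class. -/
theorem HolderLp.mul_multiplier {q : ℝ≥0∞} (hq : 2 ≤ q) {f g : ℝ → ℂ} {A B : ℝ}
    (hA : 0 ≤ A) (hB : 0 ≤ B) (hf : HolderLp q A f) (hg : HolderLp 2 B g)
    (hfb : ∀ x, ‖f x‖ ≤ A) (hgb : ∀ x, ‖g x‖ ≤ B) :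
    HolderLp 2 (2 * (A * B)) (fun x => f x * g x) := by
  have hq' : q⁻¹ ≤ 2⁻¹ := ENNReal.inv_le_inv.2 hq
  set r : ℝ≥0∞ := (2⁻¹ - q⁻¹)⁻¹ with hr
  have : ENNReal.HolderTriple q r 2 := ⟨by rw [hr, inv_inv, add_tsub_cancel_of_le hq']⟩
  have hr2 : 2 ≤ r := by
    rw [hr, ← ENNReal.inv_le_inv, inv_inv]
    exact tsub_le_self
  have hgr : ∀ y, eLpNorm (fun x => g (x + y)) r volume ≤ ENNReal.ofReal B := by
    intro y
    have h2 : eLpNorm (fun x => g (x + y)) 2 volume ≤ ENNReal.ofReal B :=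
      (eLpNorm_comp_add hg.aesm 2 y).trans_le hg.norm
    by_cases hrt : r = ⊤
    · rw [hrt]; exact eLpNorm_top_le_ofReal fun x => hgb _
    · exact eLpNorm_le_ofReal_of_bound (by norm_num) hr2 hrt h2 fun x => hgb _
  refine holderLp_mul_of (by norm_num) (by positivity) hf.aesm hg.aesm
    (eLpNorm_mul_le_ofReal (p := ⊤) (q := 2) hA hf.aesm hg.aesm (eLpNorm_top_le_ofReal hfb)
      hg.norm) (fun y => ?_) (fun y => ?_)
  · have := eLpNorm_mul_le_ofReal (p := q) (q := r) (r := 2) (by positivity)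
      ((aestronglyMeasurable_comp_add hf.aesm y).sub hf.aesm)
      (aestronglyMeasurable_comp_add hg.aesm y) (hf.diff y) (hgr y)
    rwa [mul_right_comm] at this
  · have := eLpNorm_mul_le_ofReal (p := ⊤) (q := 2) (r := 2) hA hf.aesm
      ((aestronglyMeasurable_comp_add hg.aesm y).sub hg.aesm) (eLpNorm_top_le_ofReal hfb)
      (hg.diff y)
    rwa [← mul_assoc] at this

theorem admissible_two : Admissible {2} :=
  ⟨⟨2, rfl⟩, by rintro p rfl; exact ⟨le_rfl, by norm_num⟩⟩

namespace UniformHolder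

variable {q : ℝ≥0∞} {A B : ℝ} {P v w D : ℝ → ℝ → ℂ}

theorem mul_multiplier (hq : 2 ≤ q) (hP : UniformHolder {q} A P) (hv : UniformHolder {2} B v) :
    UniformHolder {2} (2 * (A * B)) (fun t x => P t x * v t x) where
  meas := hP.meas.mul hv.meas
  cont t := (hP.cont t).mul (hv.cont t)
  bound := hP.norm_mul_le hv
  holder p hp t := by
    obtain rfl : p = 2 := hp
    exact (hP.holder q rfl t).mul_multiplier hq hP.nonneg hv.nonneg (hv.holder 2 rfl t)
      (hP.bound t) (hv.bound t)

theorem mul_add_multiplier (hq : 2 ≤ q) (hP : UniformHolder {q} A P)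
    (hv : UniformHolder {2} B v) {C : ℝ} (hw : UniformHolder {2} C w) :
    UniformHolder {2} (2 * (A + B) * C) (fun t x => (P t x + v t x) * w t x) := by
  have h := (hP.mul_multiplier hq hw).add admissible_two (hv.mul_multiplier le_rfl hw)
  simp only [← add_mul] at h
  exact h.mono (le_of_eq (by ring))

/-- The nonlinearity for the remainder lies in the `L²` class. -/
theorem cubic_add_sub (hq : 2 ≤ q) (hP : UniformHolder {q} A P) (hv : UniformHolder {2} B v) :
    UniformHolder {2} (12 * (A + B) ^ 2 * B)
      (fun t x => cubic (P t x + v t x) - cubic (P t x)) := by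
  have hA := hP.nonneg
  have hB := hv.nonneg
  have h1 := hP.conj.mul_add_multiplier hq hv.conj (hP.mul_add_multiplier hq hv hv)
  have h2 := hP.conj.mul_add_multiplier hq hv.conj (hP.mul_multiplier hq hv)
  have h3 := hP.mul_multiplier hq (hP.mul_multiplier hq hv.conj)
  have h := (h1.add admissible_two h2).add admissible_two h3
  have e : (fun t x => cubic (P t x + v t x) - cubic (P t x)) = fun t x =>
      ((starRingEnd ℂ) (P t x) + (starRingEnd ℂ) (v t x)) * ((P t x + v t x) * v t x) +
        ((starRingEnd ℂ) (P t x) + (starRingEnd ℂ) (v t x)) * (P t x * v t x) +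
        P t x * (P t x * (starRingEnd ℂ) (v t x)) := by
    funext t x
    rw [cubic_sub_cubic, add_sub_cancel_left, map_add]
    ring
  rw [e]
  refine h.mono ?_
  nlinarith [mul_nonneg hA hB, mul_nonneg hB hB, mul_nonneg hA hA,
    mul_nonneg (mul_nonneg hA hB) hB, mul_nonneg (mul_nonneg hA hB) hA,
    mul_nonneg (mul_nonneg hB hB) hB]

end UniformHolder

theorem norm_cubic_sub_cubic_le {a b : ℂ} {M : ℝ} (ha : ‖a‖ ≤ M) (hb : ‖b‖ ≤ M) :
    ‖cubic a - cubic b‖ ≤ 3 * M ^ 2 * ‖a - b‖ := by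
  have hM : 0 ≤ M := (norm_nonneg _).trans ha
  rw [cubic_sub_cubic]
  refine (norm_add_le _ _).trans ((add_le_add_left (norm_add_le _ _) _).trans ?_)
  simp only [norm_mul, RCLike.norm_conj]
  have h1 : ‖a - b‖ * ‖a‖ * ‖a‖ ≤ ‖a - b‖ * M * M := by gcongr
  have h2 : ‖b‖ * ‖a - b‖ * ‖a‖ ≤ M * ‖a - b‖ * M := by gcongr
  have h3 : ‖b‖ * ‖b‖ * ‖a - b‖ ≤ M * M * ‖a - b‖ := by gcongr
  linarith

/-! ### Limits in the regularity classes -/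

theorem eLpNorm_le_of_tendsto {p : ℝ≥0∞} {f : ℕ → ℝ → ℂ} {g : ℝ → ℂ} {C : ℝ≥0∞}
    (hf : ∀ k, AEStronglyMeasurable (f k) volume) (hb : ∀ k, eLpNorm (f k) p volume ≤ C)
    (h : ∀ x, Tendsto (fun k => f k x) atTop (𝓝 (g x))) : eLpNorm g p volume ≤ C :=
  Lp.eLpNorm_le_of_ae_tendsto (Eventually.of_forall hb) hf (ae_of_all _ h)

/-- By Fatou the norms are lower semicontinuous, so the Hölder ball is closed under uniform
convergence even though the Hölder seminorms of the differences need not tend to zero. -/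
theorem UniformHolder.of_tendsto {S : Set ℝ≥0∞} {B : ℝ} {f : ℕ → ℝ → ℝ → ℂ} {g : ℝ → ℝ → ℂ}
    (hf : ∀ k, UniformHolder S B (f k))
    (h : ∀ t, TendstoUniformly (fun k => f k t) (g t) atTop) : UniformHolder S B g := by
  have hp : ∀ t x, Tendsto (fun k => f k t x) atTop (𝓝 (g t x)) := fun t x => (h t).tendsto_at x
  have hcont : ∀ t, Continuous (g t) := fun t =>
    (h t).continuous (Eventually.of_forall fun k => (hf k).cont t).frequently
  refine ⟨?_, hcont, fun t x => ?_, fun p hpS t => ⟨?_, ?_, fun y => ?_⟩⟩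
  · exact measurable_of_tendsto_metrizable (fun k => (hf k).meas)
      (tendsto_pi_nhds.2 fun z => hp z.1 z.2)
  · exact le_of_tendsto (hp t x).norm (Eventually.of_forall fun k => (hf k).bound t x)
  · exact (hcont t).aestronglyMeasurable
  · exact eLpNorm_le_of_tendsto (fun k => ((hf k).cont t).aestronglyMeasurable)
      (fun k => ((hf k).holder p hpS t).norm) (hp t)
  · refine eLpNorm_le_of_tendsto (f := fun k x => f k t (x + y) - f k t x)
      (fun k => Continuous.aestronglyMeasurable ?_)
      (fun k => ((hf k).holder p hpS t).diff y) fun x => (hp t (x + y)).sub (hp t x)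
    have := (hf k).cont t
    fun_prop

theorem tendsto_evolutionPairing {ν : Measure ℝ} {c : ℝ → ℂ} (hν : IsTimeAverage ν c)
    {F : ℕ → ℝ → ℝ → ℂ} {G : ℝ → ℝ → ℂ} {B : ℝ} (hF : ∀ k, UniformHolder {2} B (F k))
    (h : ∀ t x, Tendsto (fun k => F k t x) atTop (𝓝 (G t x))) (t : ℝ) (φ : 𝓢(ℝ, ℂ)) :
    Tendsto (fun k => evolutionPairing ν c (F k) t φ) atTop
      (𝓝 (evolutionPairing ν c G t φ)) := by
  have := hν.prob
  have hB := (hF 0).nonneg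
  refine Tendsto.const_mul _ ?_
  refine tendsto_integral_of_dominated_convergence (fun _ => B * ‖φ.toLp 2 volume‖) (fun k => ?_)
    (integrable_const _) (fun k => ae_of_all _ fun σ => ?_) (ae_of_all _ fun σ => ?_)
  · exact (integrable_inner_pairing hν (hF k).meas hB
      (fun τ => ((hF k).holder 2 rfl τ).norm) t φ).1
  · exact norm_inner_pairing_le (hF k).meas hB (fun τ => ((hF k).holder 2 rfl τ).norm) _ _ φ
  · refine tendsto_integral_of_dominated_convergence
      (fun x => B * ‖propagator (t - t * σ) φ x‖) (fun k => ?_)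
      ((propagator (t - t * σ) φ).integrable.norm.const_mul B)
      (fun k => ae_of_all _ fun x => ?_) (ae_of_all _ fun x => (h _ x).mul_const _)
    · exact (((hF k).cont _).mul (propagator (t - t * σ) φ).continuous).aestronglyMeasurable
    · rw [norm_mul]
      gcongr
      exact (hF k).bound _ x

/-! ### The contraction for the remainder -/

theorem UniformHolder.neg {S : Set ℝ≥0∞} {A : ℝ} {f : ℝ → ℝ → ℂ} (hf : UniformHolder S A f) :
    UniformHolder S A (fun t x => -f t x) where
  meas := hf.meas.neg
  cont t := (hf.cont t).neg
  bound t x := by rw [norm_neg]; exact hf.bound t x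
  holder p hp t := by
    have h := hf.holder p hp t
    refine ⟨h.aesm.neg, ?_, fun y => ?_⟩
    · exact (eLpNorm_neg (f t) p volume).trans_le h.norm
    · rw [eLpNorm_congr_norm_ae (g := fun x => f t (x + y) - f t x) (ae_of_all _ fun x => by
        rw [neg_sub_neg, norm_sub_rev])]
      exact h.diff y

theorem UniformHolder.sub {S : Set ℝ≥0∞} (hS : Admissible S) {A B : ℝ} {f g : ℝ → ℝ → ℂ}
    (hf : UniformHolder S A f) (hg : UniformHolder S B g) :
    UniformHolder S (A + B) (fun t x => f t x - g t x) := by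
  simpa only [sub_eq_add_neg] using hf.add hS hg.neg

theorem UniformHolder.zero {S : Set ℝ≥0∞} {A : ℝ} (hA : 0 ≤ A) :
    UniformHolder S A (fun _ _ => 0) where
  meas := measurable_const
  cont t := continuous_const
  bound t x := by simpa using hA
  holder p hp t := ⟨aestronglyMeasurable_const, by simp, fun y => by simp⟩

/-- This is `2^{-1/2} ≤ 2^{-1/4}`: at averaging scale `2^{-k}`, an `L²` norm of order `2^{-k}`
contributes less than the Hölder error. -/
theorem sqrt_two_mul_half_le_ratio : (2 : ℝ) ^ (1 / 2 : ℝ) * (1 / 2) ≤ ratio := by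
  have h : (2 : ℝ) ^ (1 / 2 : ℝ) * (1 / 2) = (1 / 2) ^ (1 / 2 : ℝ) := by
    have h1 : (1 / 2 : ℝ) = (1 / 2) ^ (1 / 2 : ℝ) * (1 / 2) ^ (1 / 2 : ℝ) := by
      rw [← Real.rpow_add (by norm_num)]; norm_num
    have h2 : (2 : ℝ) ^ (1 / 2 : ℝ) * (1 / 2) ^ (1 / 2 : ℝ) = 1 := by
      rw [← Real.mul_rpow (by norm_num) (by norm_num)]; norm_num
    calc (2 : ℝ) ^ (1 / 2 : ℝ) * (1 / 2)
        = (2 : ℝ) ^ (1 / 2 : ℝ) * ((1 / 2) ^ (1 / 2 : ℝ) * (1 / 2) ^ (1 / 2 : ℝ)) := by rw [← h1]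
      _ = _ := by rw [← mul_assoc, h2, one_mul]
  rw [h]
  exact Real.rpow_le_rpow_of_exponent_ge (by norm_num) (by norm_num) (by norm_num)

/-- An `L²` bound with geometric decay gives a uniform bound with geometric decay. -/
theorem HolderLp.norm_le_geometric {f : ℝ → ℂ} {A : ℝ} (hA : 0 ≤ A) (h : HolderLp 2 A f)
    (hc : Continuous f) (k : ℕ) (hf : eLpNorm f 2 volume ≤ ENNReal.ofReal (A * (1 / 2) ^ k))
    (x : ℝ) : ‖f x‖ ≤ A * embConst * ratio ^ k := by
  have h1 := h.norm_rep_le hA le_rfl (by norm_num) (by positivity) hf x k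
  rw [h.rep_eq_self hA le_rfl (by norm_num) hc] at h1
  refine h1.trans ?_
  have h2 : ((2 : ℝ) ^ (1 / 2 : ℝ)) ^ k * (1 / 2) ^ k ≤ ratio ^ k := by
    rw [← mul_pow]
    exact pow_le_pow_left₀ (by positivity) sqrt_two_mul_half_le_ratio k
  have h3 : A * (((2 : ℝ) ^ (1 / 2 : ℝ)) ^ k * (1 / 2) ^ k) ≤ A * ratio ^ k := by gcongr
  rw [embConst]
  have h4 : A * (1 + 1 / (1 - ratio)) * ratio ^ k = A * ratio ^ k + A * ratio ^ k / (1 - ratio) := by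
    ring
  rw [h4]
  linarith

/-- The `L²` stability of the evolution with constant `1`, stated through pairings because the
functions are characterized only by them. -/
theorem eLpNorm_sub_le_of_pairing {ν : Measure ℝ} {c : ℝ → ℂ} (hν : IsTimeAverage ν c)
    {F G v w : ℝ → ℝ → ℂ} {A B C : ℝ} (hC : 0 ≤ C)
    (hF : UniformHolder {2} A F) (hG : UniformHolder {2} A G)
    (hv : UniformHolder {2} B v) (hw : UniformHolder {2} B w)
    (hvF : ∀ t φ, ∫ x, v t x * φ x = evolutionPairing ν c F (clamp t) φ)
    (hwG : ∀ t φ, ∫ x, w t x * φ x = evolutionPairing ν c G (clamp t) φ)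
    (hFG : ∀ t, eLpNorm (fun x => F t x - G t x) 2 volume ≤ ENNReal.ofReal C) (t : ℝ) :
    eLpNorm (fun x => v t x - w t x) 2 volume ≤ ENNReal.ofReal C := by
  have hmem : ∀ {f : ℝ → ℝ → ℂ} {K : ℝ}, UniformHolder {2} K f → MemLp (f t) 2 volume := fun hf =>
    ⟨((hf.holder 2 rfl t).aesm), (hf.holder 2 rfl t).norm.trans_lt ENNReal.ofReal_lt_top⟩
  refine eLpNorm_le_of_pairing ((hmem hv).sub (hmem hw)) hC fun φ => ?_
  have h1 : ∫ x, (v t x - w t x) * φ x =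
      evolutionPairing ν c (fun τ x => F τ x - G τ x) (clamp t) φ := by
    rw [evolutionPairing_sub hν hF.meas hF.nonneg (fun τ => (hF.holder 2 rfl τ).norm) hG.meas
      (fun τ => (hG.holder 2 rfl τ).norm), ← hvF, ← hwG]
    simp only [sub_mul]
    exact integral_sub (integrable_mul_schwartz (p := 2) (by norm_num) (hmem hv).1 (hmem hv).2 φ)
      (integrable_mul_schwartz (p := 2) (by norm_num) (hmem hw).1 (hmem hw).2 φ)
  simp only [Pi.sub_apply]
  rw [h1]
  exact norm_evolutionPairing_le (F := fun τ x => F τ x - G τ x) hν (abs_clamp_le t)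
    (hF.meas.sub hG.meas) hC hFG φ

section

variable {ν : Measure ℝ} {c : ℝ → ℂ} {q : ℝ≥0∞} {δ : ℝ} {P D : ℝ → ℝ → ℂ}

/-- The forcing term in the equation for the remainder. -/
def remainderForcing (P D v : ℝ → ℝ → ℂ) (τ x : ℝ) : ℂ :=
  D τ x + (cubic (P τ x + v τ x) - cubic (P τ x))

theorem uniformHolder_remainderForcing (hq : 2 ≤ q) (hδ : 216 * embConst ^ 3 * δ ≤ 1)
    (hP : UniformHolder {q} δ P) (hD : UniformHolder {2} δ D) {v : ℝ → ℝ → ℂ}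
    (hv : UniformHolder {2} (2 * embConst * δ) v) :
    UniformHolder {2} (2 * δ) (remainderForcing P D v) := by
  have h0 := hP.nonneg
  have hE := one_le_embConst
  have hE0 : 0 ≤ embConst := zero_le_one.trans hE
  have hE3 : (1 : ℝ) ≤ embConst ^ 3 := one_le_pow₀ hE
  have hδ1 : δ ≤ 1 := by nlinarith
  refine (hD.add admissible_two (hP.cubic_add_sub hq hv)).mono ?_
  have h1 : δ + 2 * embConst * δ ≤ 3 * embConst * δ := by nlinarith
  have h2 : (δ + 2 * embConst * δ) ^ 2 ≤ (3 * embConst * δ) ^ 2 :=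
    pow_le_pow_left₀ (by positivity) h1 2
  have h3 : 12 * (δ + 2 * embConst * δ) ^ 2 * (2 * embConst * δ) ≤
      12 * (3 * embConst * δ) ^ 2 * (2 * embConst * δ) := by gcongr
  -- The source of `216 = 12 · 9 · 2`: the smallness condition makes the cubic part at most `δ`,
  -- which with the forcing `D` gives the total `2δ`.
  have h4 : 12 * (3 * embConst * δ) ^ 2 * (2 * embConst * δ) =
      (216 * embConst ^ 3 * δ) * (δ * δ) := by ring
  have h5 : (216 * embConst ^ 3 * δ) * (δ * δ) ≤ 1 * (1 * δ) := by gcongr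
  linarith

theorem norm_remainderForcing_sub_le (hδ : 216 * embConst ^ 3 * δ ≤ 1)
    (hP : UniformHolder {q} δ P) {v w : ℝ → ℝ → ℂ}
    (hv : UniformHolder {2} (2 * embConst * δ) v) (hw : UniformHolder {2} (2 * embConst * δ) w)
    (t x : ℝ) :
    ‖remainderForcing P D v t x - remainderForcing P D w t x‖ ≤ 1 / 2 * ‖v t x - w t x‖ := by
  have h0 := hP.nonneg
  have hE := one_le_embConst
  have hE0 : 0 ≤ embConst := zero_le_one.trans hE
  have hE3 : (1 : ℝ) ≤ embConst ^ 3 := one_le_pow₀ hE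
  have hδ1 : δ ≤ 1 := by nlinarith
  have h1 : δ + 2 * embConst * δ ≤ 3 * embConst * δ := by nlinarith
  have hb : ∀ {u : ℝ → ℝ → ℂ}, UniformHolder {2} (2 * embConst * δ) u →
      ‖P t x + u t x‖ ≤ 3 * embConst * δ := fun hu =>
    (norm_add_le _ _).trans ((add_le_add (hP.bound t x) (hu.bound t x)).trans h1)
  have h2 := norm_cubic_sub_cubic_le (hb hv) (hb hw)
  rw [add_sub_add_left_eq_sub] at h2
  have e : remainderForcing P D v t x - remainderForcing P D w t x =
      cubic (P t x + v t x) - cubic (P t x + w t x) := by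
    simp only [remainderForcing]; ring
  rw [e]
  refine h2.trans ?_
  -- The Lipschitz constant is `27 E² δ²` with `E = embConst`, and both `E² δ ≤ 1/216` and `δ ≤ 1`
  -- are available.
  have h3 : 3 * (3 * embConst * δ) ^ 2 ≤ 1 / 2 := by
    have h4 : embConst ^ 2 * δ ≤ embConst ^ 3 * δ := by
      have : embConst ^ 2 ≤ embConst ^ 3 := pow_le_pow_right₀ hE (by norm_num)
      gcongr
    have h5 : embConst ^ 2 * δ * δ ≤ embConst ^ 2 * δ * 1 := by gcongr
    nlinarith
  gcongr

/-- The remainder of the Picard expansion, by contraction. -/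
theorem exists_remainder (hν : IsTimeAverage ν c) (hq : 2 ≤ q)
    (hδ : 216 * embConst ^ 3 * δ ≤ 1) (hP : UniformHolder {q} δ P) (hD : UniformHolder {2} δ D) :
    ∃ v, UniformHolder {2} (2 * embConst * δ) v ∧
      UniformHolder {2} (2 * δ) (remainderForcing P D v) ∧
      ∀ t φ, ∫ x, v t x * φ x = evolutionPairing ν c (remainderForcing P D v) (clamp t) φ := by
  have h0 := hP.nonneg
  have hE0 : 0 ≤ embConst := zero_le_one.trans one_le_embConst
  -- The forcing has size `2δ`. The evolution keeps its `L²` Hölder size, and passing to the sup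
  -- bound costs the factor `embConst`.
  set B := 2 * embConst * δ with hBdef
  have hB : 0 ≤ B := by positivity
  have hN := fun v (hv : UniformHolder {2} B v) => uniformHolder_remainderForcing hq hδ hP hD hv
  have hstep : ∀ v, UniformHolder {2} B v → ∃ w, UniformHolder {2} B w ∧
      ∀ t φ, ∫ x, w t x * φ x = evolutionPairing ν c (remainderForcing P D v) (clamp t) φ := by
    intro v hv
    obtain ⟨w, hw, -, hp⟩ := exists_evolution_L2 hν (hN v hv).meas (by positivity)
      ((hN v hv).holder 2 rfl)
    exact ⟨w, hw.mono (le_of_eq (by rw [hBdef]; ring)), hp⟩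
  choose! T hT hTp using hstep
  set u : ℕ → ℝ → ℝ → ℂ := fun k => T^[k] (fun _ _ => 0) with hu
  have hsucc : ∀ k, u (k + 1) = T (u k) := fun k => Function.iterate_succ_apply' _ _ _
  have hcls : ∀ k, UniformHolder {2} B (u k) := by
    intro k
    induction k with
    | zero => exact UniformHolder.zero hB
    | succ k ih => rw [hsucc]; exact hT _ ih
  have hpair : ∀ k t φ, ∫ x, u (k + 1) t x * φ x =
      evolutionPairing ν c (remainderForcing P D (u k)) (clamp t) φ := by
    intro k t φ
    rw [hsucc]
    exact hTp _ (hcls k) t φ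
  have hdiff := fun k => (hcls (k + 1)).sub admissible_two (hcls k)
  -- The contraction holds in `L²` only. In the Hölder class the successive differences are merely
  -- bounded, by `B + B`.
  have hL2 : ∀ k t, eLpNorm (fun x => u (k + 1) t x - u k t x) 2 volume ≤
      ENNReal.ofReal ((B + B) * (1 / 2) ^ k) := by
    intro k
    induction k with
    | zero =>
      intro t
      simpa using ((hdiff 0).holder 2 rfl t).norm
    | succ k ih =>
      refine eLpNorm_sub_le_of_pairing hν (by positivity) (hN _ (hcls (k + 1))) (hN _ (hcls k))
        (hcls (k + 2)) (hcls (k + 1)) (hpair (k + 1)) (hpair k) fun t => ?_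
      refine (eLpNorm_le_mul_eLpNorm_of_ae_le_mul (c := 1 / 2) (ae_of_all _ fun x =>
        norm_remainderForcing_sub_le hδ hP (hcls (k + 1)) (hcls k) t x) 2).trans ?_
      rw [pow_succ, mul_comm ((1 / 2 : ℝ) ^ k), mul_left_comm, ENNReal.ofReal_mul (by norm_num)]
      gcongr
      exact ih t
  set K := (B + B) * embConst with hK
  -- Interpolating the `L²` decay `2^{-k}` with the Hölder bound turns the contraction into uniform
  -- convergence, fast enough to pass to the limit in the nonlinearity.
  have hgeo : ∀ t x k, dist (u k t x) (u (k + 1) t x) ≤ K * ratio ^ k := by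
    intro t x k
    rw [dist_comm, dist_eq_norm]
    exact HolderLp.norm_le_geometric (by positivity) ((hdiff k).holder 2 rfl t) ((hdiff k).cont t)
      k (hL2 k t) x
  have hlim : ∀ t x, Tendsto (fun k => u k t x) atTop (𝓝 (limUnder atTop fun k => u k t x)) :=
    fun t x => (cauchySeq_of_le_geometric ratio K ratio_lt_one (hgeo t x)).tendsto_limUnder
  set v : ℝ → ℝ → ℂ := fun t x => limUnder atTop fun k => u k t x with hv
  have hunif : ∀ t, TendstoUniformly (fun k => u k t) (v t) atTop := by
    intro t
    rw [Metric.tendstoUniformly_iff]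
    intro ε hε
    have h1 : Tendsto (fun k => K * ratio ^ k / (1 - ratio)) atTop (𝓝 0) := by
      have := ((tendsto_pow_atTop_nhds_zero_of_lt_one ratio_pos.le ratio_lt_one).const_mul
        K).div_const (1 - ratio)
      simpa using this
    filter_upwards [h1.eventually (gt_mem_nhds hε)] with k hk x
    rw [dist_comm]
    exact (dist_le_of_le_geometric_of_tendsto ratio K ratio_lt_one (hgeo t x) (hlim t x)
      k).trans_lt hk
  have hvc : UniformHolder {2} B v := UniformHolder.of_tendsto hcls hunif
  refine ⟨v, hvc, hN v hvc, fun t φ => ?_⟩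
  have h1 : Tendsto (fun k => ∫ x, u (k + 1) t x * φ x) atTop (𝓝 (∫ x, v t x * φ x)) := by
    refine tendsto_integral_of_dominated_convergence (fun x => B * ‖φ x‖) (fun k => ?_)
      (φ.integrable.norm.const_mul B) (fun k => ae_of_all _ fun x => ?_)
      (ae_of_all _ fun x => (((hlim t x).comp (tendsto_add_atTop_nat 1)).mul_const _))
    · exact (((hcls _).cont _).mul φ.continuous).aestronglyMeasurable
    · rw [norm_mul]
      gcongr
      exact (hcls _).bound _ x
  refine tendsto_nhds_unique h1 ?_
  simp only [hpair]
  refine tendsto_evolutionPairing hν (fun k => hN _ (hcls k)) (fun τ x => ?_) _ φ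
  have hc : Continuous cubic := by unfold cubic; fun_prop
  exact ((((hc.tendsto _).comp ((hlim τ x).const_add (P τ x)))).sub_const _).const_add _

end

/-! ### Weak derivatives tested against Schwartz functions -/

/-- A weak derivative may be tested against smooth functions without compact support, as long as
the integrals converge. -/
theorem integral_deriv_mul_eq_of_integrable {f g : ℝ → ℂ}
    (h : ∀ φ : ℝ → ℝ, ContDiff ℝ ∞ φ → HasCompactSupport φ →
      ∫ x, ((deriv φ x : ℝ) : ℂ) * f x = -∫ x, (φ x : ℂ) * g x)
    (hf : AEStronglyMeasurable f volume) (hg : AEStronglyMeasurable g volume)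
    {a : ℝ → ℝ} (ha : ContDiff ℝ ∞ a) (h1 : Integrable fun x => ((deriv a x : ℝ) : ℂ) * f x)
    (h2 : Integrable fun x => (a x : ℂ) * f x) (h3 : Integrable fun x => (a x : ℂ) * g x) :
    ∫ x, ((deriv a x : ℝ) : ℂ) * f x = -∫ x, (a x : ℂ) * g x := by
  obtain ⟨η, hηd, hηs, hη0, hηle⟩ : ∃ η : ℝ → ℝ, ContDiff ℝ ∞ η ∧ HasCompactSupport η ∧
      η 0 = 1 ∧ ∀ x, ‖η x‖ ≤ 1 := by
    let b : ContDiffBump (0 : ℝ) := ⟨1, 2, by norm_num, by norm_num⟩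
    exact ⟨b, b.contDiff, b.hasCompactSupport, b.one_of_mem_closedBall (by simp [b]),
      fun x => by rw [Real.norm_of_nonneg b.nonneg]; exact b.le_one⟩
  have hη' : Continuous (deriv η) := hηd.continuous_deriv (by simp)
  obtain ⟨C, hC⟩ := hη'.bounded_above_of_compact_support hηs.deriv
  have hC0 : 0 ≤ C := (norm_nonneg _).trans (hC 0)
  have hpos : ∀ k : ℕ, (0 : ℝ) < k + 1 := fun k => by positivity
  -- Cutoffs at scale `k + 1`. The term with the differentiated cutoff carries a factor `1 / (k +
  -- 1)` and vanishes in the limit by dominated convergence.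
  set φ : ℕ → ℝ → ℝ := fun k x => η (x / (k + 1)) * a x with hφ
  have hφd : ∀ k, ContDiff ℝ ∞ (φ k) := fun k =>
    (hηd.comp (contDiff_id.div_const _)).mul ha
  have hφs : ∀ k, HasCompactSupport (φ k) := by
    intro k
    refine HasCompactSupport.mul_right ?_
    have := hηs.comp_homeomorph
      (Homeomorph.mulRight₀ ((k : ℝ) + 1)⁻¹ (inv_ne_zero (hpos k).ne'))
    simpa [Function.comp_def, div_eq_mul_inv] using this
  have hder : ∀ k x, deriv (φ k) x =
      deriv η (x / (k + 1)) / (k + 1) * a x + η (x / (k + 1)) * deriv a x := by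
    intro k x
    have e1 : HasDerivAt (fun x : ℝ => η (x / (k + 1))) (deriv η (x / (k + 1)) * (1 / (k + 1))) x :=
      HasDerivAt.comp x (hηd.differentiable (by simp) _).hasDerivAt
        ((hasDerivAt_id x).div_const _)
    have e2 := (e1.mul (ha.differentiable (by simp) x).hasDerivAt).deriv
    rw [hφ]
    refine e2.trans ?_
    ring
  have hk0 : Tendsto (fun k : ℕ => ((k : ℝ) + 1)⁻¹) atTop (𝓝 0) :=
    tendsto_inv_atTop_zero.comp (tendsto_natCast_atTop_atTop.atTop_add tendsto_const_nhds)
  have hη1 : ∀ x : ℝ, Tendsto (fun k : ℕ => η (x / (k + 1))) atTop (𝓝 1) := by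
    intro x
    have e1 : Tendsto (fun k : ℕ => x / ((k : ℝ) + 1)) atTop (𝓝 0) := by
      simpa [div_eq_mul_inv] using hk0.const_mul x
    have e2 := (hηd.continuous.tendsto 0).comp e1
    rwa [hη0] at e2
  have hη2 : ∀ x : ℝ, Tendsto (fun k : ℕ => deriv η (x / (k + 1)) / ((k : ℝ) + 1)) atTop (𝓝 0) := by
    intro x
    refine squeeze_zero_norm (a := fun k : ℕ => C * ((k : ℝ) + 1)⁻¹) (fun k => ?_)
      (by simpa using hk0.const_mul C)
    rw [norm_div, div_eq_mul_inv, Real.norm_of_nonneg (hpos k).le]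
    have := hpos k
    gcongr
    exact hC _
  have L : Tendsto (fun k => ∫ x, ((deriv (φ k) x : ℝ) : ℂ) * f x) atTop
      (𝓝 (∫ x, ((deriv a x : ℝ) : ℂ) * f x)) := by
    refine tendsto_integral_of_dominated_convergence
      (fun x => C * ‖(a x : ℂ) * f x‖ + ‖((deriv a x : ℝ) : ℂ) * f x‖) (fun k => ?_)
      ((h2.norm.const_mul C).add h1.norm) (fun k => ae_of_all _ fun x => ?_)
      (ae_of_all _ fun x => ?_)
    · exact (Complex.continuous_ofReal.comp
        ((hφd k).continuous_deriv (by simp))).aestronglyMeasurable.mul hf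
    · rw [hder]
      push_cast
      rw [add_mul]
      refine (norm_add_le _ _).trans (add_le_add ?_ ?_)
      · rw [mul_assoc, norm_mul]
        gcongr
        rw [norm_div]
        have e : ‖((k : ℂ) + 1)‖ = (k : ℝ) + 1 := by
          rw [show ((k : ℂ) + 1) = (((k : ℝ) + 1 : ℝ) : ℂ) by push_cast; ring, Complex.norm_real,
            Real.norm_of_nonneg (hpos k).le]
        rw [e, Complex.norm_real]
        have : (1 : ℝ) ≤ k + 1 := by linarith [(Nat.cast_nonneg k : (0 : ℝ) ≤ k)]
        exact (div_le_self (norm_nonneg _) this).trans (hC _)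
      · rw [mul_assoc, norm_mul, Complex.norm_real]
        exact mul_le_of_le_one_left (norm_nonneg _) (hηle _)
    · refine Tendsto.mul_const _ ?_
      refine (Complex.continuous_ofReal.tendsto _).comp ?_
      simp only [hder]
      have := ((hη2 x).mul_const (a x)).add ((hη1 x).mul_const (deriv a x))
      simpa using this
  have R : Tendsto (fun k => -∫ x, (φ k x : ℂ) * g x) atTop (𝓝 (-∫ x, (a x : ℂ) * g x)) := by
    refine (tendsto_integral_of_dominated_convergence
      (fun x => ‖(a x : ℂ) * g x‖) (fun k => ?_) h3.norm (fun k => ae_of_all _ fun x => ?_)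
      (ae_of_all _ fun x => ?_)).neg
    · exact (Complex.continuous_ofReal.comp (hφd k).continuous).aestronglyMeasurable.mul hg
    · rw [hφ]
      push_cast
      rw [mul_assoc, norm_mul, Complex.norm_real]
      exact mul_le_of_le_one_left (norm_nonneg _) (hηle _)
    · refine Tendsto.mul_const _ ((Complex.continuous_ofReal.tendsto _).comp ?_)
      simpa using (hη1 x).mul_const (a x)
  refine tendsto_nhds_unique L ?_
  simp only [h _ (hφd _) (hφs _)]
  exact R

/-- Weak derivatives are tested against real compactly supported functions, the propagator against
complex Schwartz ones. The real and imaginary parts are treated separately, each through the cutoff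
argument. -/
theorem TemperedDeriv.of_testFunction {p : ℝ≥0∞} (hp : 1 ≤ p) {f g : ℝ → ℂ}
    (h : ∀ φ : ℝ → ℝ, ContDiff ℝ ∞ φ → HasCompactSupport φ →
      ∫ x, ((deriv φ x : ℝ) : ℂ) * f x = -∫ x, (φ x : ℂ) * g x)
    (hf : MemLp f p volume) (hg : MemLp g p volume) : TemperedDeriv f g := by
  intro χ
  have hd : ∀ x, HasDerivAt χ (SchwartzMap.derivCLM ℂ ℂ χ x) x := fun x => by
    rw [SchwartzMap.derivCLM_apply]; exact χ.differentiableAt.hasDerivAt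
  have hre : ∀ x, HasDerivAt (fun x => (χ x).re) (SchwartzMap.derivCLM ℂ ℂ χ x).re x := fun x =>
    (Complex.reCLM.hasFDerivAt.comp_hasDerivAt x (hd x))
  have him : ∀ x, HasDerivAt (fun x => (χ x).im) (SchwartzMap.derivCLM ℂ ℂ χ x).im x := fun x =>
    (Complex.imCLM.hasFDerivAt.comp_hasDerivAt x (hd x))
  have hire : ∀ {u : ℝ → ℂ}, MemLp u p volume → ∀ ψ : 𝓢(ℝ, ℂ),
      Integrable fun x => ((ψ x).re : ℂ) * u x := fun hu ψ =>
    (integrable_mul_schwartz hp hu.1 hu.2 ψ).mono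
      ((Complex.continuous_ofReal.comp
        (Complex.continuous_re.comp ψ.continuous)).aestronglyMeasurable.mul hu.1)
      (ae_of_all _ fun x => by
        rw [norm_mul, norm_mul, Complex.norm_real, mul_comm]
        gcongr
        exact Complex.abs_re_le_norm _)
  have hiim : ∀ {u : ℝ → ℂ}, MemLp u p volume → ∀ ψ : 𝓢(ℝ, ℂ),
      Integrable fun x => ((ψ x).im : ℂ) * u x := fun hu ψ =>
    (integrable_mul_schwartz hp hu.1 hu.2 ψ).mono
      ((Complex.continuous_ofReal.comp
        (Complex.continuous_im.comp ψ.continuous)).aestronglyMeasurable.mul hu.1)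
      (ae_of_all _ fun x => by
        rw [norm_mul, norm_mul, Complex.norm_real, mul_comm]
        gcongr
        exact Complex.abs_im_le_norm _)
  have hsplit : ∀ {u : ℝ → ℂ}, MemLp u p volume → ∀ ψ : 𝓢(ℝ, ℂ),
      ∫ x, u x * ψ x =
        (∫ x, ((ψ x).re : ℂ) * u x) + Complex.I * ∫ x, ((ψ x).im : ℂ) * u x := by
    intro u hu ψ
    rw [← integral_const_mul, ← integral_add (hire hu ψ) ((hiim hu ψ).const_mul _)]
    refine integral_congr_ae (ae_of_all _ fun x => ?_)
    have e := Complex.re_add_im (ψ x)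
    change u x * ψ x = ((ψ x).re : ℂ) * u x + Complex.I * (((ψ x).im : ℂ) * u x)
    linear_combination -(u x) * e
  have key := fun {a : ℝ → ℝ} => integral_deriv_mul_eq_of_integrable h hf.1 hg.1 (a := a)
  have hχ : ContDiff ℝ ∞ χ := χ.smooth'
  have h1 := key (a := fun x => (χ x).re) (Complex.reCLM.contDiff.comp hχ)
    (by simpa only [(hre _).deriv] using hire hf _) (hire hf χ) (hire hg χ)
  have h2 := key (a := fun x => (χ x).im) (Complex.imCLM.contDiff.comp hχ)
    (by simpa only [(him _).deriv] using hiim hf _) (hiim hf χ) (hiim hg χ)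
  simp only [(hre _).deriv] at h1
  simp only [(him _).deriv] at h2
  rw [hsplit hf, hsplit hg, h1, h2]
  ring

theorem IsWeakDeriv.ae_eq {u g : ℝ → ℂ} (h : IsWeakDeriv 0 u g) : u =ᵐ[volume] g := by
  refine ae_eq_of_integral_contDiff_smul_eq h.1 h.2.1 fun φ hφ hs => ?_
  simpa using h.2.2 φ hφ hs

theorem IsWeakDeriv.integral_deriv {j : ℕ} {u g g' : ℝ → ℂ} (h : IsWeakDeriv j u g)
    (h' : IsWeakDeriv (j + 1) u g') {φ : ℝ → ℝ} (hφ : ContDiff ℝ ∞ φ) (hs : HasCompactSupport φ) :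
    ∫ x, ((deriv φ x : ℝ) : ℂ) * g x = -∫ x, (φ x : ℂ) * g' x := by
  have h1 := h.2.2 (deriv φ) (by simpa using hφ.iterate_deriv 1) hs.deriv
  have h2 := h'.2.2 φ hφ hs
  rw [iteratedDeriv_succ'] at h2
  rw [h1, pow_succ, mul_assoc] at h2
  have := mul_left_cancel₀ (pow_ne_zero j (by norm_num : (-1 : ℂ) ≠ 0)) h2
  rw [this]; ring

/-- Data with small Sobolev norm. -/
theorem exists_weaklyRegular {k N : ℕ} (hN : 1 ≤ N) {u₀ : ℝ → ℂ} {ε : ℝ} (hε : 0 < ε)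
    (h : sobolevNorm k N u₀ ≤ ENNReal.ofReal ε) :
    ∃ f : ℝ → ℂ, f =ᵐ[volume] u₀ ∧ WeaklyRegular (exponents N 1) k (2 * ε) (fun _ => f) := by
  have hN' : (1 : ℝ≥0∞) ≤ N := by exact_mod_cast hN
  -- The factor `2` creates the strict inequality needed to extract an actual family of weak
  -- derivatives from the infimum.
  have hlt : sobolevNorm k N u₀ < ENNReal.ofReal (2 * ε) :=
    h.trans_lt ((ENNReal.ofReal_lt_ofReal_iff (by positivity)).2 (by linarith))
  simp only [sobolevNorm, iInf_lt_iff] at hlt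
  obtain ⟨g, hg, hsum⟩ := hlt
  have hbd : ∀ j ≤ k, eLpNorm (g j) N volume ≤ ENNReal.ofReal (2 * ε) := fun j hj =>
    (Finset.single_le_sum (f := fun j => eLpNorm (g j) N volume) (fun _ _ => zero_le)
      (Finset.mem_range.2 (by omega))).trans hsum.le
  have hm : ∀ j : ℕ, ∃ f : ℝ → ℂ, Measurable f ∧ (j ≤ k → f =ᵐ[volume] g j) := by
    intro j
    by_cases hj : j ≤ k
    · have := (hg j hj).2.1.aestronglyMeasurable
      exact ⟨this.mk, this.stronglyMeasurable_mk.measurable, fun _ => this.ae_eq_mk.symm⟩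
    · exact ⟨0, measurable_const, fun h => absurd h hj⟩
  choose f hfm hfg using hm
  have hfn : ∀ j ≤ k, eLpNorm (f j) N volume ≤ ENNReal.ofReal (2 * ε) := fun j hj => by
    rw [eLpNorm_congr_ae (hfg j hj)]; exact hbd j hj
  have hfL : ∀ j ≤ k, MemLp (f j) N volume := fun j hj =>
    ⟨(hfm j).aestronglyMeasurable, (hfn j hj).trans_lt ENNReal.ofReal_lt_top⟩
  have hbase : ∀ j ≤ k, Measurable (Function.uncurry fun (_ : ℝ) => f j) ∧
      ∀ p ∈ exponents N 1, ∀ _ : ℝ, eLpNorm (f j) p volume ≤ ENNReal.ofReal (2 * ε) := by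
    refine fun j hj => ⟨(hfm j).comp measurable_snd, fun p hp _ => ?_⟩
    obtain rfl : p = N := by
      rcases hp with rfl | rfl
      · rfl
      · simp
    exact hfn j hj
  have hder : ∀ j, j + 1 ≤ k → TemperedDeriv (f j) (f (j + 1)) := by
    intro j hj
    refine TemperedDeriv.of_testFunction hN' (fun φ hφ hs => ?_) (hfL j (by omega)) (hfL _ hj)
    have h1 := (hg j (by omega)).integral_deriv (hg (j + 1) hj) hφ hs
    have e1 : ∫ x, ((deriv φ x : ℝ) : ℂ) * f j x = ∫ x, ((deriv φ x : ℝ) : ℂ) * g j x := by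
      refine integral_congr_ae ?_
      filter_upwards [hfg j (by omega)] with x hx
      rw [hx]
    have e2 : ∫ x, (φ x : ℂ) * f (j + 1) x = ∫ x, (φ x : ℂ) * g (j + 1) x := by
      refine integral_congr_ae ?_
      filter_upwards [hfg (j + 1) hj] with x hx
      rw [hx]
    rw [e1, e2, h1]
  have hreg : ∀ m j, j + m ≤ k → WeaklyRegular (exponents N 1) m (2 * ε) (fun _ => f j) := by
    intro m
    induction m with
    | zero => exact fun j hj => hbase j (by omega)
    | succ m ih =>
      exact fun j hj => ⟨hbase j (by omega), fun _ => f (j + 1), fun _ => hder j (by omega),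
        ih (j + 1) (by omega)⟩
  exact ⟨f 0, (hfg 0 (by omega)).trans ((hg 0 (by omega)).ae_eq).symm, hreg k 0 (by omega)⟩

/-! ### The Picard iterates -/

theorem isTimeAverage_dirac : IsTimeAverage (Measure.dirac 0) (fun _ => 1) where
  prob := inferInstance
  mem := by rw [ae_dirac_eq]; exact ⟨le_rfl, zero_le_one⟩
  meas := measurable_const
  norm_le t _ := by simp

theorem evolutionPairing_dirac (F : ℝ → ℝ → ℂ) (t : ℝ) (φ : 𝓢(ℝ, ℂ)) :
    evolutionPairing (Measure.dirac 0) (fun _ => 1) F t φ = ∫ x, F 0 x * propagator t φ x := by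
  rw [evolutionPairing, integral_dirac]
  simp

/-- Lebesgue measure on `[0, 1]`. -/
def unitMeasure : Measure ℝ := volume.restrict (Icc 0 1)

/-- The weight of the Duhamel integral. -/
def duhamelWeight (t : ℝ) : ℂ := -(Complex.I * t)

theorem isTimeAverage_unitMeasure : IsTimeAverage unitMeasure duhamelWeight where
  prob := ⟨by simp [unitMeasure]⟩
  mem := ae_restrict_mem measurableSet_Icc
  meas := by unfold duhamelWeight; fun_prop
  norm_le t ht := by simpa [duhamelWeight] using ht

/-- The substitution `τ = tσ` puts the Duhamel integral on a fixed interval, for either sign of `t`;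
its Jacobian `t` goes into the weight. -/
theorem evolutionPairing_unitMeasure (F : ℝ → ℝ → ℂ) (t : ℝ) (φ : 𝓢(ℝ, ℂ)) :
    evolutionPairing unitMeasure duhamelWeight F t φ =
      -(Complex.I * ∫ τ in (0 : ℝ)..t, ∫ x, F τ x * propagator (t - τ) φ x) := by
  have h := intervalIntegral.smul_integral_comp_mul_left (a := 0) (b := 1)
    (fun τ => ∫ x, F τ x * propagator (t - τ) φ x) t
  rw [mul_zero, mul_one] at h
  rw [← h, evolutionPairing, unitMeasure, duhamelWeight, integral_Icc_eq_integral_Ioc,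
    ← intervalIntegral.integral_of_le zero_le_one, Complex.real_smul]
  ring

theorem exponents_one_subset (N k : ℕ) : exponents N 1 ⊆ exponents N k := by
  rintro p (rfl | rfl)
  · exact mem_insert _ _
  · simp [exponents]

theorem Regular.zero {S : Set ℝ≥0∞} {m : ℕ} {A : ℝ} (hA : 0 ≤ A) :
    Regular S m A (fun _ _ => 0) := by
  induction m with
  | zero => exact UniformHolder.zero hA
  | succ m ih => exact ⟨UniformHolder.zero hA, _, fun t x => hasDerivAt_const x 0, ih⟩

/-- The constant of one Picard step. -/
def stepConst (n : ℕ) : ℝ := 3 * (2 ^ (2 * n + 1)) ^ 2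

/-- The constants of the Picard iterates. -/
def picardConst (n : ℕ) : ℕ → ℝ
  | 0 => evolutionConst
  | j + 1 => picardConst n j + evolutionConst * (stepConst n * picardConst n j ^ 3)

theorem stepConst_nonneg (n : ℕ) : 0 ≤ stepConst n := by unfold stepConst; positivity

theorem picardConst_nonneg (n j : ℕ) : 0 ≤ picardConst n j := by
  induction j with
  | zero => exact evolutionConst_nonneg
  | succ j ih =>
    have := evolutionConst_nonneg
    have := stepConst_nonneg n
    unfold picardConst
    positivity

theorem picardConst_mono (n : ℕ) : Monotone (picardConst n) := by
  refine monotone_nat_of_le_succ fun j => ?_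
  have := evolutionConst_nonneg
  have := stepConst_nonneg n
  have := picardConst_nonneg n j
  rw [picardConst]
  have : 0 ≤ evolutionConst * (stepConst n * picardConst n j ^ 3) := by positivity
  linarith

/-- The difference of two nonlinearities, with a constant that is linear in the size. -/
theorem Regular.cubic_sub_cubic_linear {N k m n : ℕ} (hN : 2 * (k + 2) ≤ N) (hk : 1 ≤ k)
    (hm : m ≤ 2 * n) {A δ : ℝ} (hA : 0 ≤ A) (hδ : 0 ≤ δ) (hδ1 : δ ≤ 1) {a b : ℝ → ℝ → ℂ}
    (hab : Regular (exponents N k) m (A * δ) (fun t x => a t x - b t x))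
    (ha : Regular (exponents N 1) m (A * δ) a) (hb : Regular (exponents N 1) m (A * δ) b) :
    Regular (exponents N (k + 2)) m (stepConst n * A ^ 3 * δ)
      (fun t x => cubic (a t x) - cubic (b t x)) := by
  refine (Regular.cubic_sub_cubic hN hk hab ha hb).mono ?_
  have h1 : (2 : ℝ) ^ (m + 1) ≤ 2 ^ (2 * n + 1) := pow_le_pow_right₀ (by norm_num) (by omega)
  have h2 : A * δ * (A * δ) ^ 2 ≤ A ^ 3 * δ := by
    have h3 : A * δ * (A * δ) ^ 2 = A ^ 3 * δ * (δ * δ) := by ring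
    rw [h3]
    exact mul_le_of_le_one_right (by positivity) (mul_le_one₀ hδ1 hδ hδ1)
  calc _ ≤ 3 * (2 ^ (2 * n + 1)) ^ 2 * (A ^ 3 * δ) := by gcongr
    _ = _ := by rw [stepConst]; ring

/-- Consecutive partial sums of the Picard expansion, of index `j` and `j + 1`. -/
structure PicardPair (n : ℕ) (δ : ℝ) (j : ℕ) (s : (ℝ → ℝ → ℂ) × (ℝ → ℝ → ℂ)) : Prop where
  diff : Regular (exponents (4 * n + 2) (2 * j + 1)) (2 * n - 2 - 2 * j) (picardConst n j * δ)
    (fun t x => s.2 t x - s.1 t x)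
  fst : Regular (exponents (4 * n + 2) 1) (2 * n - 2 - 2 * j) (picardConst n j * δ) s.1
  snd : Regular (exponents (4 * n + 2) 1) (2 * n - 2 - 2 * j) (picardConst n j * δ) s.2

theorem PicardPair.forcing {n : ℕ} {δ : ℝ} (hδ : 0 ≤ δ) (hδ1 : δ ≤ 1) {j : ℕ} (hj : j < n)
    {s : (ℝ → ℝ → ℂ) × (ℝ → ℝ → ℂ)} (h : PicardPair n δ j s) :
    Regular (exponents (4 * n + 2) (2 * (j + 1) + 1)) (2 * n - 2 - 2 * j)
      (stepConst n * picardConst n j ^ 3 * δ) (fun t x => cubic (s.2 t x) - cubic (s.1 t x)) :=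
  Regular.cubic_sub_cubic_linear (k := 2 * j + 1) (by omega) (by omega) (by omega) (picardConst_nonneg n j) hδ hδ1
    h.diff h.snd h.fst

/-- The new correction is the evolution of the last cubic difference, which lies both in its own
smaller exponent and in `L^N`. The former gives the new difference, the latter allows it to be added
to the partial sum. -/
theorem PicardPair.exists_next {n : ℕ} {δ : ℝ} (hδ : 0 ≤ δ) (hδ1 : δ ≤ 1) {j : ℕ}
    (hj : j + 1 < n) {s : (ℝ → ℝ → ℂ) × (ℝ → ℝ → ℂ)} (h : PicardPair n δ j s) :
    ∃ W : ℝ → ℝ → ℂ, PicardPair n δ (j + 1) (s.2, fun t x => s.2 t x + W t x) ∧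
      ∀ t φ, ∫ x, W t x * φ x = evolutionPairing unitMeasure duhamelWeight
        (fun t x => cubic (s.2 t x) - cubic (s.1 t x)) (clamp t) φ := by
  have hS := admissible_exponents (N := 4 * n + 2) (k := 2 * (j + 1) + 1) (by omega) (by omega)
  have hE := evolutionConst_nonneg
  have hs := stepConst_nonneg n
  have hp := picardConst_nonneg n j
  have hF := h.forcing hδ hδ1 (by omega)
  -- The bound `j + 1 < n` matters here: it leaves the two derivatives that the evolution consumes.
  rw [show 2 * n - 2 - 2 * j = 2 * n - 2 - 2 * (j + 1) + 2 by omega] at hF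
  obtain ⟨W, hW, hpair⟩ := exists_evolution hS isTimeAverage_unitMeasure (by positivity) _
    (hF.weaklyRegular hS)
  have hc : picardConst n (j + 1) * δ =
      picardConst n j * δ + evolutionConst * (stepConst n * picardConst n j ^ 3 * δ) := by
    rw [picardConst]; ring
  have hW' := hW.mono (B := picardConst n (j + 1) * δ) (by
    rw [hc]; exact le_add_of_nonneg_left (by positivity))
  have h2 := h.snd.of_le (m' := 2 * n - 2 - 2 * (j + 1)) (by omega)
  refine ⟨W, ⟨?_, h2.mono ?_, ?_⟩, hpair⟩
  · simpa only [add_sub_cancel_left] using hW'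
  · rw [hc]; exact le_add_of_nonneg_right (by positivity)
  · rw [hc]
    exact h2.add (admissible_exponents le_rfl (by omega))
      (hW.subset (exponents_one_subset _ _))

/-- The partial sums `P j = ∑_{k < j} u^k` of the Picard expansion. -/
theorem exists_picard {n : ℕ} (hn : 1 ≤ n) {δ : ℝ} (hδ : 0 ≤ δ) (hδ1 : δ ≤ 1) {f : ℝ → ℂ}
    (hf : WeaklyRegular (exponents (4 * n + 2) 1) (2 * n) δ (fun _ => f)) :
    ∃ P : ℕ → ℝ → ℝ → ℂ, (P 0 = fun _ _ => 0) ∧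
      (∀ j ≤ n, UniformHolder (exponents (4 * n + 2) 1) (picardConst n n * δ) (P j)) ∧
      (∀ j < n, UniformHolder (exponents (4 * n + 2) (2 * (j + 1) + 1))
        (stepConst n * picardConst n n ^ 3 * δ) fun t x => cubic (P (j + 1) t x) - cubic (P j t x)) ∧
      (∀ t φ, ∫ x, P 1 t x * φ x = ∫ x, f x * propagator (clamp t) φ x) ∧
      ∀ j, j + 1 < n → ∀ t φ, ∫ x, (P (j + 2) t x - P (j + 1) t x) * φ x =
        evolutionPairing unitMeasure duhamelWeight
          (fun t x => cubic (P (j + 1) t x) - cubic (P j t x)) (clamp t) φ := by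
  have hS := admissible_exponents (N := 4 * n + 2) (k := 1) le_rfl (by omega)
  obtain ⟨m, hm⟩ : ∃ m, 2 * n = m + 2 := ⟨2 * n - 2, by omega⟩
  rw [hm] at hf
  obtain ⟨U, hU, hUp⟩ := exists_evolution hS isTimeAverage_dirac hδ m hf
  have hstep : ∀ (j : ℕ) (s : (ℝ → ℝ → ℂ) × (ℝ → ℝ → ℂ)), j + 1 < n ∧ PicardPair n δ j s →
      ∃ W : ℝ → ℝ → ℂ, PicardPair n δ (j + 1) (s.2, fun t x => s.2 t x + W t x) ∧
      ∀ t φ, ∫ x, W t x * φ x = evolutionPairing unitMeasure duhamelWeight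
        (fun t x => cubic (s.2 t x) - cubic (s.1 t x)) (clamp t) φ :=
    fun j s h => h.2.exists_next hδ hδ1 h.1
  choose! T hT hTp using hstep
  -- The recursion runs on pairs `(P j, P (j + 1))`, starting from zero and the free evolution,
  -- because the next correction depends on both.
  let s : ℕ → (ℝ → ℝ → ℂ) × (ℝ → ℝ → ℂ) := fun j => Nat.rec (fun _ _ => 0, U)
    (fun j s => (s.2, fun t x => s.2 t x + T j s t x)) j
  have hs : ∀ j, s (j + 1) = ((s j).2, fun t x => (s j).2 t x + T j (s j) t x) := fun _ => rfl
  have hE := evolutionConst_nonneg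
  have hgood : ∀ j < n, PicardPair n δ j (s j) := by
    intro j
    induction j with
    | zero =>
      intro _
      have hm0 : 2 * n - 2 - 2 * 0 = m := by omega
      refine ⟨?_, ?_, ?_⟩ <;> rw [hm0]
      · simpa [s, picardConst] using hU
      · exact Regular.zero (mul_nonneg hE hδ)
      · exact hU
    | succ j ih => exact fun hj => hs j ▸ hT j (s j) ⟨hj, ih (by omega)⟩
  have hle : ∀ j < n, picardConst n j ≤ picardConst n n := fun j hj =>
    picardConst_mono n hj.le
  have hst := stepConst_nonneg n
  refine ⟨fun j => (s j).1, rfl, fun j hj => ?_, fun j hj => ?_, fun t φ => ?_, fun j hj t φ => ?_⟩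
  · cases j with
    | zero => exact UniformHolder.zero (mul_nonneg (picardConst_nonneg n n) hδ)
    | succ j =>
      refine (hgood j (by omega)).snd.uniformHolder.mono ?_
      have := hle j (by omega)
      gcongr
  · refine ((hgood j hj).forcing hδ hδ1 hj).uniformHolder.mono ?_
    have := hle j hj
    have := picardConst_nonneg n j
    gcongr
  · exact (hUp t φ).trans (evolutionPairing_dirac _ _ _)
  · rw [← hTp j (s j) ⟨hj, hgood j (by omega)⟩]
    refine integral_congr_ae (ae_of_all _ fun x => ?_)
    simp only [hs, add_sub_cancel_left]

/-! ### Functions bounded in time with values in `Lᵖ ∩ L^∞` -/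

/-- Jointly measurable functions bounded by `A` in `Lᵖ` and in `L^∞`, uniformly in time. -/
structure UniformLp (p : ℝ≥0∞) (A : ℝ) (F : ℝ → ℝ → ℂ) : Prop where
  meas : Measurable (Function.uncurry F)
  norm : ∀ t, eLpNorm (F t) p volume ≤ ENNReal.ofReal A
  bound : ∀ t x, ‖F t x‖ ≤ A

theorem UniformHolder.uniformLp {S : Set ℝ≥0∞} {A : ℝ} {F : ℝ → ℝ → ℂ} (h : UniformHolder S A F)
    {q p : ℝ≥0∞} (hq : q ∈ S) (hq1 : 1 ≤ q) (hqp : q ≤ p) (hp : p ≠ ⊤) : UniformLp p A F :=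
  ⟨h.meas, fun t => eLpNorm_le_ofReal_of_bound hq1 hqp hp (h.holder q hq t).norm (h.bound t),
    h.bound⟩

namespace UniformLp

variable {p : ℝ≥0∞} {A B : ℝ} {F G : ℝ → ℝ → ℂ}

theorem nonneg (h : UniformLp p A F) : 0 ≤ A := (norm_nonneg _).trans (h.bound 0 0)

theorem aesm (h : UniformLp p A F) (t : ℝ) : AEStronglyMeasurable (F t) volume :=
  aestronglyMeasurable_slice h.meas t

theorem lt_top (h : UniformLp p A F) (t : ℝ) : eLpNorm (F t) p volume < ⊤ :=
  (h.norm t).trans_lt ENNReal.ofReal_lt_top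

theorem add (hp : 1 ≤ p) (hF : UniformLp p A F) (hG : UniformLp p B G) :
    UniformLp p (A + B) (fun t x => F t x + G t x) where
  meas := hF.meas.add hG.meas
  norm t := by
    refine (eLpNorm_add_le (hF.aesm t) (hG.aesm t) hp).trans ?_
    rw [ENNReal.ofReal_add hF.nonneg hG.nonneg]
    exact add_le_add (hF.norm t) (hG.norm t)
  bound t x := (norm_add_le _ _).trans (add_le_add (hF.bound t x) (hG.bound t x))

theorem sub (hp : 1 ≤ p) (hF : UniformLp p A F) (hG : UniformLp p B G) :
    UniformLp p (A + B) (fun t x => F t x - G t x) where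
  meas := hF.meas.sub hG.meas
  norm t := by
    refine (eLpNorm_sub_le (hF.aesm t) (hG.aesm t) hp).trans ?_
    rw [ENNReal.ofReal_add hF.nonneg hG.nonneg]
    exact add_le_add (hF.norm t) (hG.norm t)
  bound t x := (norm_sub_le _ _).trans (add_le_add (hF.bound t x) (hG.bound t x))

theorem cubic (hF : UniformLp p A F) : UniformLp p (A ^ 2 * A) (fun t x => cubic (F t x)) := by
  have h0 := hF.nonneg
  have hle : ∀ t x, ‖CubicNLS.cubic (F t x)‖ ≤ A ^ 2 * ‖F t x‖ := fun t x => by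
    rw [CubicNLS.cubic, norm_mul, norm_pow, Complex.norm_real, norm_norm]
    gcongr
    exact hF.bound t x
  refine ⟨?_, fun t => ?_, fun t x => (hle t x).trans ?_⟩
  · have : Continuous CubicNLS.cubic := by unfold CubicNLS.cubic; fun_prop
    exact this.measurable.comp hF.meas
  · rw [ENNReal.ofReal_mul (by positivity)]
    exact (eLpNorm_le_mul_eLpNorm_of_ae_le_mul (ae_of_all _ fun x => hle t x) p).trans
      (by gcongr; exact hF.norm t)
  · gcongr
    exact hF.bound t x

theorem memLp_slab (hp : 1 ≤ p) (hpt : p ≠ ⊤) (hF : UniformLp p A F) :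
    MemLp (Function.uncurry F) p slabMeasure := by
  refine ⟨hF.meas.aestronglyMeasurable, ?_⟩
  have hp0 : p ≠ 0 := (zero_lt_one.trans_le hp).ne'
  have hpp : 0 < p.toReal := ENNReal.toReal_pos hp0 hpt
  rw [eLpNorm_lt_top_iff_lintegral_rpow_enorm_lt_top hp0 hpt, slabMeasure,
    lintegral_prod _ (hF.meas.enorm.pow_const _).aemeasurable]
  have h : ∀ t, ∫⁻ x, ‖F t x‖ₑ ^ p.toReal ≤ ENNReal.ofReal A ^ p.toReal := by
    intro t
    have := hF.norm t
    rw [eLpNorm_eq_lintegral_rpow_enorm_toReal hp0 hpt] at this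
    calc _ = ((∫⁻ x, ‖F t x‖ₑ ^ p.toReal) ^ (1 / p.toReal)) ^ p.toReal := by
          rw [← ENNReal.rpow_mul, one_div_mul_cancel hpp.ne', ENNReal.rpow_one]
      _ ≤ _ := by gcongr
  refine (lintegral_mono h).trans_lt ?_
  rw [lintegral_const]
  exact ENNReal.mul_lt_top (ENNReal.rpow_lt_top_of_nonneg hpp.le ENNReal.ofReal_ne_top)
    (measure_lt_top _ _)

/-- On a bounded time interval every time exponent is dominated by the supremum, so uniform bounds
in `L²` and `L^∞` are enough. -/
theorem memStrichartz (hF : UniformLp 2 A F) : MemStrichartz F := by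
  have h : ∀ (p q : ℝ≥0∞), (∀ t, eLpNorm (F t) q volume ≤ ENNReal.ofReal A) →
      mixedNorm p q F < ⊤ := by
    intro p q hq
    refine (eLpNorm_le_of_ae_enorm_bound (C := ENNReal.ofReal A) (ae_of_all _ fun t => ?_)).trans_lt
      ?_
    · simpa using hq t
    · rw [smul_eq_mul]
      exact ENNReal.mul_lt_top ENNReal.ofReal_lt_top
        (ENNReal.rpow_lt_top_of_nonneg (by positivity) (measure_ne_top _ _))
  exact ⟨hF.meas.aestronglyMeasurable, h _ _ hF.norm,
    h _ _ fun t => eLpNorm_top_le_ofReal (hF.bound t)⟩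

/-! ### The Duhamel integral -/

/-- The propagated test function is bounded in the dual exponent, uniformly in time, by the
smoothing kernel. Requiring `p > 1` makes that dual exponent finite. -/
theorem integrable_duhamel (hp : 1 < p) (hF : UniformLp p A F) {t : ℝ} (ht : |t| ≤ 1)
    (φ : 𝓢(ℝ, ℂ)) :
    Integrable (fun z : ℝ × ℝ => F z.1 z.2 * propagator (t - z.1) φ z.2)
      ((volume.restrict (uIoc 0 t)).prod volume) := by
  have hm : Measurable fun z : ℝ × ℝ => F z.1 z.2 * propagator (t - z.1) φ z.2 :=
    hF.meas.mul ((continuous_propagator φ).measurable.comp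
      (f := fun z : ℝ × ℝ => (t - z.1, z.2)) (by fun_prop))
  refine ⟨hm.aestronglyMeasurable, ?_⟩
  rw [HasFiniteIntegral, lintegral_prod _ hm.enorm.aemeasurable]
  set q := ENNReal.conjExponent p with hq
  have hq1 : 1 ≤ q := by rw [hq, ENNReal.conjExponent]; exact le_self_add
  have hqt : q ≠ ⊤ := by
    rw [hq, ENNReal.conjExponent]
    exact ENNReal.add_ne_top.2 ⟨ENNReal.one_ne_top,
      ENNReal.inv_ne_top.2 (tsub_pos_of_lt hp).ne'⟩
  set C := ENNReal.ofReal A * (ENNReal.ofReal kernelConst * eLpNorm (helmholtz φ) q volume) with hC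
  have hCt : C < ⊤ := ENNReal.mul_lt_top ENNReal.ofReal_lt_top
    (ENNReal.mul_lt_top ENNReal.ofReal_lt_top ((helmholtz φ).eLpNorm_lt_top q volume))
  calc _ ≤ ∫⁻ _ in uIoc 0 t, C := by
        refine setLIntegral_mono' measurableSet_uIoc fun τ hτ => ?_
        have hs : |t - τ| ≤ 1 := by
          refine le_trans ?_ ht
          rw [abs_sub_comm]
          have := abs_sub_right_of_mem_uIcc (uIoc_subset_uIcc hτ)
          rw [sub_zero] at this
          rwa [abs_sub_comm]
        refine (lintegral_enorm_mul_le hp.le (hF.aesm τ)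
          (propagator (t - τ) φ).continuous.aestronglyMeasurable).trans ?_
        rw [hC]
        gcongr
        · exact hF.norm τ
        · exact eLpNorm_propagator_le hs φ hq1 hqt
    _ = C * volume (uIoc 0 t) := by rw [lintegral_const, Measure.restrict_apply_univ]
    _ < ⊤ := ENNReal.mul_lt_top hCt (by rw [uIoc]; exact measure_Ioc_lt_top)

end UniformLp

/-- The time integral in Duhamel's formula, paired with `φ`. -/
def duhamelIntegral (F : ℝ → ℝ → ℂ) (t : ℝ) (φ : 𝓢(ℝ, ℂ)) : ℂ :=
  ∫ τ in (0 : ℝ)..t, ∫ x, F τ x * propagator (t - τ) φ x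

theorem duhamelIntegral_sub {p : ℝ≥0∞} (hp : 1 < p) {A B : ℝ} {F G : ℝ → ℝ → ℂ}
    (hF : UniformLp p A F) (hG : UniformLp p B G) {t : ℝ} (ht : |t| ≤ 1) (φ : 𝓢(ℝ, ℂ)) :
    duhamelIntegral (fun τ x => F τ x - G τ x) t φ =
      duhamelIntegral F t φ - duhamelIntegral G t φ := by
  have hi : ∀ {H : ℝ → ℝ → ℂ} {C : ℝ}, UniformLp p C H → IntervalIntegrable
      (fun τ => ∫ x, H τ x * propagator (t - τ) φ x) volume 0 t := fun hH => by
    rw [intervalIntegrable_iff]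
    exact (hH.integrable_duhamel hp ht φ).integral_prod_left
  rw [duhamelIntegral, duhamelIntegral, duhamelIntegral, ← intervalIntegral.integral_sub (hi hF)
    (hi hG)]
  refine intervalIntegral.integral_congr fun τ _ => ?_
  simp only [sub_mul]
  exact integral_sub (integrable_mul_schwartz hp.le (hF.aesm τ) (hF.lt_top τ) _)
    (integrable_mul_schwartz hp.le (hG.aesm τ) (hG.lt_top τ) _)

theorem isDuhamel_of_pairing {p : ℝ≥0∞} (hp : 1 < p) {A B : ℝ} {f : ℝ → ℂ} {F w : ℝ → ℝ → ℂ}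
    (hf : MemLp f p volume) (hF : UniformLp p A F) (hw : UniformLp p B w)
    (h : ∀ t ∈ Icc (-1 : ℝ) 1, ∀ φ, ∫ x, w t x * φ x =
      (∫ x, f x * propagator t φ x) - Complex.I * duhamelIntegral F t φ) : IsDuhamel f F w :=
  fun t ht φ => ⟨integrable_mul_schwartz hp.le (hw.aesm t) (hw.lt_top t) φ,
    integrable_mul_schwartz hp.le hf.1 hf.2 _,
    hF.integrable_duhamel hp (abs_le.2 ht) φ, h t ht φ⟩

theorem IsDuhamel.congr_datum {f g : ℝ → ℂ} {F w : ℝ → ℝ → ℂ} (h : IsDuhamel f F w)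
    (hfg : f =ᵐ[volume] g) : IsDuhamel g F w := by
  intro t ht φ
  obtain ⟨h1, h2, h3, h4⟩ := h t ht φ
  have e : (fun x => f x * propagator t φ x) =ᵐ[volume] fun x => g x * propagator t φ x := by
    filter_upwards [hfg] with x hx
    rw [hx]
  exact ⟨h1, h2.congr e, h3, by rw [h4, integral_congr_ae e]⟩

/-! ### Assembling the solution -/

section

variable {n : ℕ} {p : ℝ≥0∞} {A : ℝ} {f : ℝ → ℂ} {P : ℕ → ℝ → ℝ → ℂ}

/-- The partial sums satisfy the Duhamel formula with the nonlinearity of the previous one. -/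
theorem integral_picard_mul (hp : 1 < p) (hP0 : P 0 = fun _ _ => 0)
    (hP : ∀ j ≤ n, UniformLp p A (P j))
    (h1 : ∀ t φ, ∫ x, P 1 t x * φ x = ∫ x, f x * propagator (clamp t) φ x)
    (h2 : ∀ j, j + 1 < n → ∀ t φ, ∫ x, (P (j + 2) t x - P (j + 1) t x) * φ x =
      evolutionPairing unitMeasure duhamelWeight
        (fun t x => cubic (P (j + 1) t x) - cubic (P j t x)) (clamp t) φ)
    {t : ℝ} (ht : t ∈ Icc (-1 : ℝ) 1) (φ : 𝓢(ℝ, ℂ)) :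
    ∀ j < n, ∫ x, P (j + 1) t x * φ x = (∫ x, f x * propagator t φ x) -
      Complex.I * duhamelIntegral (fun τ x => cubic (P j τ x)) t φ := by
  intro j
  induction j with
  | zero =>
    intro _
    have e : duhamelIntegral (fun τ x => cubic (P 0 τ x)) t φ = 0 := by
      simp [duhamelIntegral, hP0, cubic]
    rw [e, zero_add, h1, clamp_of_mem ht, mul_zero, sub_zero]
  | succ j ih =>
    intro hj
    have h3 := h2 j hj t φ
    have hi := fun k hk => integrable_mul_schwartz hp.le ((hP k hk).aesm t) ((hP k hk).lt_top t) φ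
    simp only [sub_mul] at h3
    rw [integral_sub (hi _ (by omega)) (hi _ (by omega)), evolutionPairing_unitMeasure,
      clamp_of_mem ht, ih (by omega)] at h3
    have h4 := duhamelIntegral_sub hp (hP (j + 1) (by omega)).cubic (hP j (by omega)).cubic
      (abs_le.2 ht) φ
    rw [duhamelIntegral] at h4
    -- The Duhamel terms telescope: the correction contributes the new nonlinearity minus the old
    -- one, and the induction hypothesis already contains the old one.
    rw [h4] at h3
    linear_combination h3

theorem isPicardSequence_of_partialSums (hp : 1 < p) (hf : MemLp f p volume)
    (hn : 1 ≤ n) (hP0 : P 0 = fun _ _ => 0) (hP : ∀ j ≤ n, UniformLp p A (P j))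
    (h : ∀ t ∈ Icc (-1 : ℝ) 1, ∀ φ : 𝓢(ℝ, ℂ), ∀ j < n, ∫ x, P (j + 1) t x * φ x =
      (∫ x, f x * propagator t φ x) -
        Complex.I * duhamelIntegral (fun τ x => cubic (P j τ x)) t φ) :
    IsPicardSequence n f (fun j t x => P (j + 1) t x - P j t x) := by
  have hsum : ∀ j t x, ∑ k ∈ Finset.range j, (P (k + 1) t x - P k t x) = P j t x := by
    intro j t x
    rw [Finset.sum_range_sub (fun k => P k t x), hP0, sub_zero]
  have hA : 0 ≤ A := (hP 0 (by omega)).nonneg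
  refine ⟨?_, fun j hj1 hj => ?_⟩
  · have hz : UniformLp p 0 (0 : ℝ → ℝ → ℂ) :=
      ⟨measurable_const, fun t => by simp, fun t x => by simp⟩
    simp only [hP0, sub_zero, zero_add]
    refine isDuhamel_of_pairing hp hf hz (hP 1 hn) fun t ht φ => ?_
    have := h t ht φ 0 (by omega)
    simpa [hP0, duhamelIntegral, cubic] using this
  -- Subtracting the earlier iterates leaves `P (j + 1) - P 1`. Its Duhamel formula has zero datum
  -- since `P 1` is the free evolution.
  · have e : (fun t x => (P (j + 1) t x - P j t x) +
        ∑ k ∈ Finset.Ico 1 j, (P (k + 1) t x - P k t x)) = fun t x => P (j + 1) t x - P 1 t x := by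
      funext t x
      rw [add_comm, ← Finset.sum_Ico_succ_top hj1 (fun k => P (k + 1) t x - P k t x),
        Finset.sum_Ico_eq_sub _ (by omega), hsum, hsum]
    rw [e]
    simp only [hsum]
    refine isDuhamel_of_pairing hp (f := 0) MemLp.zero (hP j hj.le).cubic
      ((hP (j + 1) hj).sub hp.le (hP 1 hn)) fun t ht φ => ?_
    have hi := fun k hk => integrable_mul_schwartz hp.le ((hP k hk).aesm t) ((hP k hk).lt_top t) φ
    simp only [sub_mul]
    rw [integral_sub (hi _ hj) (hi _ hn), h t ht φ j hj]
    have h0 := h t ht φ 0 (by omega)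
    have e0 : duhamelIntegral (fun τ x => cubic (P 0 τ x)) t φ = 0 := by
      simp [duhamelIntegral, hP0, cubic]
    rw [e0, mul_zero, sub_zero, zero_add] at h0
    rw [h0]
    simp

end

theorem sobolevNorm_mono {k l : ℕ} (hkl : k ≤ l) (p : ℝ≥0∞) (f : ℝ → ℂ) :
    sobolevNorm k p f ≤ sobolevNorm l p f := by
  refine le_iInf₂ fun g hg => (iInf₂_le g fun j hj => hg j (hj.trans hkl)).trans ?_
  exact Finset.sum_le_sum_of_subset (Finset.range_mono (by omega))

/-- Local solutions for data with `2n` small derivatives in `L^{4n+2}`. -/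
theorem exists_hasLocalSolution {n : ℕ} (hn : 1 ≤ n) :
    ∃ ε : ℝ, 0 < ε ∧ ∀ u₀ : ℝ → ℂ,
      sobolevNorm (2 * n) ((4 * n + 2 : ℕ) : ℝ≥0∞) u₀ ≤ ENNReal.ofReal ε →
        HasLocalSolution n u₀ := by
  have hE := one_le_embConst
  have hE0 : 0 < embConst := zero_lt_one.trans_le hE
  have hst := stepConst_nonneg n
  have hpc := picardConst_nonneg n n
  -- One constant bounds both the partial sum and the forcing `D`; the extra `1` ensures `K ≥ 1`,
  -- hence `δ ≤ 1`.
  set K : ℝ := picardConst n n + stepConst n * picardConst n n ^ 3 + 1 with hK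
  have hpc3 : 0 ≤ stepConst n * picardConst n n ^ 3 := by positivity
  have hK1 : 1 ≤ K := by linarith
  have hL1 : 1 ≤ 216 * embConst ^ 3 * K := by
    have : (1 : ℝ) ≤ embConst ^ 3 := one_le_pow₀ hE
    nlinarith
  set δ : ℝ := 1 / (216 * embConst ^ 3 * K) with hδ
  have hδ0 : 0 < δ := by positivity
  have hδ1 : δ ≤ 1 := by rw [hδ]; exact div_le_one_of_le₀ hL1 (by positivity)
  have hsmall : 216 * embConst ^ 3 * (K * δ) ≤ 1 := by
    rw [← mul_assoc, hδ, mul_one_div_cancel (by positivity)]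
  refine ⟨δ / 2, by positivity, fun u₀ hu₀ => ?_⟩
  obtain ⟨f, hfu, hf⟩ := exists_weaklyRegular (by omega) (by positivity) hu₀
  rw [mul_div_cancel₀ δ (two_ne_zero)] at hf
  obtain ⟨P, hP0, hP, hcub, hfree, hstep⟩ := exists_picard hn hδ0.le hδ1 hf
  set N : ℝ≥0∞ := ((4 * n + 2 : ℕ) : ℝ≥0∞) with hN
  have hN2 : 2 ≤ N := by
    have : 2 ≤ 4 * n + 2 := by omega
    rw [hN]; exact_mod_cast this
  have hN1 : 1 < N := lt_of_lt_of_le (by norm_num) hN2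
  have hNt : N ≠ ⊤ := ENNReal.natCast_ne_top _
  have hmem : N ∈ exponents (4 * n + 2) 1 := mem_insert _ _
  have hPK : picardConst n n * δ ≤ K * δ := by gcongr; linarith
  have hDK : stepConst n * picardConst n n ^ 3 * δ ≤ K * δ := by gcongr; linarith
  have hPn : UniformHolder {N} (K * δ) (P n) :=
    ((hP n le_rfl).mono hPK).subset (by rintro q rfl; exact hmem)
  obtain ⟨m, rfl⟩ : ∃ m, n = m + 1 := ⟨n - 1, by omega⟩
  have hD : UniformHolder {2} (K * δ)
      (fun t x => cubic (P (m + 1) t x) - cubic (P m t x)) := by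
    refine ((hcub m (by omega)).mono hDK).subset ?_
    rintro q rfl
    refine mem_insert_of_mem _ ?_
    -- The arithmetic that fixes the exponent of the data: after all the Picard steps, `(4n + 2) /
    -- (2n + 1) = 2`.
    rw [mem_singleton_iff, eq_comm, ← show (2 : ℝ≥0∞) * (2 * (m + 1) + 1 : ℕ) = (4 * (m + 1) + 2 : ℕ) by
      push_cast; ring]
    exact ENNReal.mul_div_cancel_right (Nat.cast_ne_zero.2 (by omega)) (ENNReal.natCast_ne_top _)
  obtain ⟨v, hv, hforce, hvp⟩ := exists_remainder isTimeAverage_unitMeasure hN2 hsmall hPn hD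
  have hPL : ∀ j ≤ m + 1, UniformLp N (picardConst (m + 1) (m + 1) * δ) (P j) := fun j hj =>
    (hP j hj).uniformLp hmem hN1.le le_rfl hNt
  have hvL : UniformLp N _ v := hv.uniformLp rfl (by norm_num) hN2 hNt
  have hu := (hPL (m + 1) le_rfl).add hN1.le hvL
  have hfL : MemLp f N volume := by
    obtain ⟨h1, h2⟩ := hf.base
    exact ⟨aestronglyMeasurable_slice h1 0, (h2 N hmem 0).trans_lt ENNReal.ofReal_lt_top⟩
  have hpic := fun t (ht : t ∈ Icc (-1 : ℝ) 1) φ =>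
    integral_picard_mul hN1 hP0 hPL hfree hstep ht φ
  have hseq := isPicardSequence_of_partialSums hN1 hfL (by omega) hP0 hPL hpic
  -- The term `|P n|² P n` cancels, so adding the formulas for `P n` and `v` leaves only the
  -- nonlinearity of `u = P n + v`.
  have heq : remainderForcing (P (m + 1))
      (fun t x => cubic (P (m + 1) t x) - cubic (P m t x)) v =
      fun t x => cubic (P (m + 1) t x + v t x) - cubic (P m t x) := by
    funext t x
    simp only [remainderForcing]
    ring
  rw [heq] at hvp
  refine ⟨fun t x => P (m + 1) t x + v t x, fun j t x => P (j + 1) t x - P j t x, v, ?_,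
    hu.memLp_slab hN1.le hNt, ⟨hseq.1.congr_datum hfu, hseq.2⟩,
    (hv.uniformLp rfl (by norm_num) le_rfl (by norm_num)).memStrichartz, fun t x => ?_⟩
  · refine IsDuhamel.congr_datum (isDuhamel_of_pairing hN1 hfL hu.cubic hu fun t ht φ => ?_) hfu
    have h1 := hpic t ht φ m (by omega)
    have h2 := hvp t φ
    rw [clamp_of_mem ht, evolutionPairing_unitMeasure] at h2
    have h3 := duhamelIntegral_sub hN1 hu.cubic (hPL m (by omega)).cubic (abs_le.2 ht) φ
    rw [duhamelIntegral] at h3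
    rw [h3] at h2
    simp only [add_mul]
    rw [integral_add (integrable_mul_schwartz hN1.le ((hPL _ le_rfl).aesm t)
      ((hPL _ le_rfl).lt_top t) φ) (integrable_mul_schwartz hN1.le (hvL.aesm t) (hvL.lt_top t) φ)]
    linear_combination h1 + h2
  · rw [Finset.sum_range_sub (fun k => P k t x), hP0, sub_zero]

end CubicNLS

end

theorem theorem2p1 :
    (∀ n : ℕ, 1 ≤ n → ∃ ε : ℝ, 0 < ε ∧ ∀ u₀ : ℝ → ℂ,
      CubicNLS.sobolevNorm (2 * n + 1) ((4 * n + 2 : ℕ) : ℝ≥0∞) u₀ ≤ ENNReal.ofReal ε →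
        CubicNLS.HasLocalSolution n u₀) ∧
    (∃ ε : ℝ, 0 < ε ∧ ∀ u₀ : ℝ → ℂ,
      CubicNLS.sobolevNorm 2 6 u₀ ≤ ENNReal.ofReal ε →
        CubicNLS.HasLocalSolution 1 u₀) := by
  -- The construction uses only `2n` derivatives. The first claim discards one derivative, and the
  -- second is the case `n = 1`, with two derivatives in `L⁶`.
  refine ⟨fun n hn => ?_, ?_⟩
  · obtain ⟨ε, hε, h⟩ := CubicNLS.exists_hasLocalSolution hn
    exact ⟨ε, hε, fun u₀ hu₀ =>
      h u₀ ((CubicNLS.sobolevNorm_mono (Nat.le_succ _) _ _).trans hu₀)⟩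
  · obtain ⟨ε, hε, h⟩ := CubicNLS.exists_hasLocalSolution le_rfl
    exact ⟨ε, hε, fun u₀ hu₀ => h u₀ (by simpa using hu₀)⟩
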